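/- **Setting.** Let $M$ be a connected smooth manifold without boundary (Hausdorff, second countable, of dimension $n$), $U\subseteq\mathbb R^m$ a closed set, $F:M\times U\to TM$ a control system (locally Lipschitz, every $F(\cdot,u)$ a smooth vector field, $\partial F/\partial x$ continuous on $M\times U$) and $L:M\times U\to\mathbb R$ smooth. An admissible pair is a bounded measurable control $u:[0,1]\to U$ together with a Lipschitz path $x:[0,1]\to M$ such that $\dot x(t)=F(x(t),u(t))$ for a.e. $t$. Let $$c(x_0,x_1)=\inf\int_0^1L(x(t),u(t))\,dt\in\mathbb R\cup\{\pm\infty\},$$ the infimum over all admissible pairs with $x(0)=x_0$, $x(1)=x_1$ ($+\infty$ if there are none). Let $\mu,\nu$ be Borel probability measures on $M$. A Borel map $T:M\to M$ with $T_*\mu=\nu$ is an optimal map if it minimizes $\int_M c(x,T(x))\,d\mu(x)$ among all such maps. For functions with values in $\mathbb R\cup\{-\infty\}$ put $f^{c_1}(y)=\inf_{x}(c(x,y)-f(x))$ and $g^{c_2}(x)=\inf_y(c(x,y)-g(y))$. A Kantorovich potential is a function $f:M\to\mathbb R\cup\{-\infty\}$ with $f^{c_1c_2}=f$, $f\in L^1(\mu)$,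 $f^{c_1}\in L^1(\nu)$, such that $(f,f^{c_1})$ maximizes $\int g\,d\mu+\int h\,d\nu$ among all pairs $g\in L^1(\mu)$, $h\in L^1(\nu)$ of functions $M\to\mathbb R\cup\{-\infty\}$ with $g(x)+h(y)\le c(x,y)$ for all $x,y\in M$. **Theorem.** Assume: 1. $\mu$ and $\nu$ are compactly supported and absolutely continuous with respect to Lebesgue measure; 2. $c$ is continuous and bounded below, and locally Lipschitz in $x$ with a constant locally independent of $y$ (all $x_0,y_0\in M$ have neighbourhoods $V,W$ such that, for one constant, $c(\cdot,y)$ is Lipschitz on $V$ for every $y\in W$); 3. $c$ is complete: for all $x_0,x_1\in M$ the infimum defining $c(x_0,x_1)$ is attained by an admissible pair from $x_0$ to $x_1$; 4. the Hamiltonian $H:T^*M\to\mathbb R$, $H(p_x)=\max_{u\in U}\big(p_x(F(x,u))-L(x,u)\big)$, is well defined (the maximum exists) and $C^2$; 5. the Hamiltonian vector field $\overrightarrow H$ is complete; let $e^{t\overrightarrow H}$ be its flow and $\pi:T^*M\to M$ the projection. Then there is a Kantorovich potential that is real-valued and locally Lipschitz on $M$. Moreover, let $f$ be any Kantorovich potential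 that is finite and locally Lipschitz on an open set of full $\mu$-measure. Then $f$ is differentiable at $\mu$-a.e. $x$, and the map $x\mapsto\varphi_1(x)=\pi\big(e^{\overrightarrow H}(-df_x)\big)$, defined $\mu$-a.e., is the unique optimal map up to $\mu$-null sets: it agrees $\mu$-a.e. with an optimal map, and every optimal map agrees with it $\mu$-a.e. -/

import Mathlib

open Set MeasureTheory
open scoped Manifold ContDiff Topology NNReal

noncomputable section

namespace ControlTransport

/-- The model space `ℝⁿ` (Euclidean norm). -/
abbrev E (n : ℕ) : Type := EuclideanSpace ℝ (Fin n)

/-! ### Control systems and the optimal control cost -/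

section Control

variable {n m : ℕ} {M : Type*} [TopologicalSpace M] [ChartedSpace (E n) M]

/-- `f : M → ℝ` is locally Lipschitz on the set `S`, with respect to charts of `M`. -/
def IsLocallyLipschitzOn (n : ℕ) {M : Type*} [TopologicalSpace M] [ChartedSpace (E n) M]
    (f : M → ℝ) (S : Set M) : Prop :=
  ∀ x₀ ∈ S, ∃ K : ℝ≥0, ∃ V ∈ 𝓝[S] x₀, V ⊆ (chartAt (E n) x₀).source ∧
    ∀ x ∈ V, ∀ x' ∈ V, |f x - f x'| ≤ K * ‖extChartAt (𝓡 n) x₀ x - extChartAt (𝓡 n) x₀ x'‖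

/-- The curve `x : ℝ → M`, restricted to `[0,1]`, is Lipschitz (by compactness of `[0,1]` this is
continuity together with a Lipschitz estimate in charts near every time). -/
def IsLipschitzPath (n : ℕ) {M : Type*} [TopologicalSpace M] [ChartedSpace (E n) M]
    (x : ℝ → M) : Prop :=
  ContinuousOn x (Icc 0 1) ∧ ∀ t₀ ∈ Icc (0 : ℝ) 1, ∃ K : ℝ≥0, ∃ S ∈ 𝓝[Icc 0 1] t₀,
    MapsTo x S (chartAt (E n) (x t₀)).source ∧
    LipschitzOnWith K (fun t => extChartAt (𝓡 n) (x t₀) (x t)) S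

variable [IsManifold (𝓡 n) ∞ M]

/-- The coordinate expression `(q, u) ↦ F(q, u) ∈ ℝⁿ` of the control system `F` in the chart
around `x₀`. -/
def localRep (F : (x : M) → E m → TangentSpace (𝓡 n) x) (x₀ : M) (q : E n) (u : E m) : E n :=
  (trivializationAt (E n) (TangentSpace (𝓡 n) : M → Type) x₀
    ⟨(extChartAt (𝓡 n) x₀).symm q, F ((extChartAt (𝓡 n) x₀).symm q) u⟩).2

/-- `F : M × U → TM` is a control system with control set `U ⊆ ℝᵐ`: the set `U` is closed, `F` is
(locally, in charts) Lipschitz on `M × U`, every `F(·, u)` is a smooth vector field, and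
`∂F/∂x` is continuous on `M × U`. The values of `F` at controls outside `U` play no role. -/
structure IsControlSystem (U : Set (E m)) (F : (x : M) → E m → TangentSpace (𝓡 n) x) : Prop where
  isClosed : IsClosed U
  lipschitz : ∀ x₀ : M, LocallyLipschitzOn ((extChartAt (𝓡 n) x₀).target ×ˢ U)
    (fun p : E n × E m => localRep F x₀ p.1 p.2)
  smooth : ∀ u ∈ U, ContMDiff (𝓡 n) (𝓡 n).tangent ∞
    (fun x : M => (⟨x, F x u⟩ : TangentBundle (𝓡 n) M))
  continuous_deriv : ∀ x₀ : M, ContinuousOn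
    (fun p : E n × E m => fderiv ℝ (fun q => localRep F x₀ q p.2) p.1)
    ((extChartAt (𝓡 n) x₀).target ×ˢ U)

/-- The Lagrangian `L` is smooth on `M × U`. -/
def IsSmoothLagrangian (n : ℕ) {m : ℕ} {M : Type*} [TopologicalSpace M] [ChartedSpace (E n) M]
    (U : Set (E m)) (L : M → E m → ℝ) : Prop :=
  ContMDiffOn ((𝓡 n).prod (𝓡 m)) 𝓘(ℝ, ℝ) ∞ (fun p : M × E m => L p.1 p.2) (univ ×ˢ U)

/-- `(x(·), u(·))` is an admissible pair on `[0,1]`: the control `u` is measurable and bounded with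
values in `U`, the path `x` is Lipschitz, and `ẋ(t) = F(x(t), u(t))` for almost every `t`.
Only the restrictions to `[0,1]` matter. -/
structure IsAdmissiblePair (U : Set (E m)) (F : (x : M) → E m → TangentSpace (𝓡 n) x)
    (x : ℝ → M) (u : ℝ → E m) : Prop where
  measurable : AEMeasurable u (volume.restrict (Icc 0 1))
  bounded : Bornology.IsBounded (u '' Icc 0 1)
  mem : ∀ t ∈ Icc (0 : ℝ) 1, u t ∈ U
  lipschitz : IsLipschitzPath n x
  ode : ∀ᵐ t ∂(volume.restrict (Icc (0 : ℝ) 1)),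
    HasMFDerivAt 𝓘(ℝ, ℝ) (𝓡 n) x t ((1 : ℝ →L[ℝ] ℝ).smulRight (F (x t) (u t)))

/-- The action `∫₀¹ L(x(t), u(t)) dt`. -/
def action (L : M → E m → ℝ) (x : ℝ → M) (u : ℝ → E m) : ℝ :=
  ∫ t in (0 : ℝ)..1, L (x t) (u t)

/-- The optimal control cost: the infimum of the action over the admissible pairs whose path
goes from `x₀` to `x₁`; it is `+∞` if there is none. -/
def cost (U : Set (E m)) (F : (x : M) → E m → TangentSpace (𝓡 n) x) (L : M → E m → ℝ)
    (x₀ x₁ : M) : EReal :=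
  sInf {r : EReal | ∃ x : ℝ → M, ∃ u : ℝ → E m, IsAdmissiblePair U F x u ∧
    x 0 = x₀ ∧ x 1 = x₁ ∧ r = (action L x u : EReal)}

/-- The cost is complete: the infimum is attained for every pair of end points. In particular
the cost is then finite. -/
def IsCompleteCost (U : Set (E m)) (F : (x : M) → E m → TangentSpace (𝓡 n) x)
    (L : M → E m → ℝ) : Prop :=
  ∀ x₀ x₁ : M, ∃ x : ℝ → M, ∃ u : ℝ → E m, IsAdmissiblePair U F x u ∧
    x 0 = x₀ ∧ x 1 = x₁ ∧ (action L x u : EReal) = cost U F L x₀ x₁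

/-- The cost as a real-valued function; no information is lost when the cost is complete. -/
def realCost (U : Set (E m)) (F : (x : M) → E m → TangentSpace (𝓡 n) x) (L : M → E m → ℝ)
    (x y : M) : ℝ :=
  (cost U F L x y).toReal

/-- `c(x, y)` is locally Lipschitz in `x`, with a constant locally independent of `y`. -/
def IsLocallyLipschitzInFst (n : ℕ) {M : Type*} [TopologicalSpace M] [ChartedSpace (E n) M]
    (c : M → M → ℝ) : Prop :=
  ∀ x₀ y₀ : M, ∃ K : ℝ≥0, ∃ V ∈ 𝓝 x₀, ∃ W ∈ 𝓝 y₀, V ⊆ (chartAt (E n) x₀).source ∧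
    ∀ y ∈ W, ∀ x ∈ V, ∀ x' ∈ V,
      |c x y - c x' y| ≤ K * ‖extChartAt (𝓡 n) x₀ x - extChartAt (𝓡 n) x₀ x'‖

end Control

/-! ### The cotangent bundle, Hamiltonians and their flows -/

section Hamiltonian

variable {n m : ℕ} {M : Type*} [TopologicalSpace M] [ChartedSpace (E n) M]
  [IsManifold (𝓡 n) ∞ M]

/-- The total space `T*M`, as a vector bundle over `M`. -/
abbrev Cotangent (n : ℕ) (M : Type*) [TopologicalSpace M] [ChartedSpace (E n) M] : Type _ :=
  Bundle.TotalSpace (E n →L[ℝ] ℝ)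
    (fun x : M => TangentSpace (𝓡 n) x →L[ℝ] Bundle.Trivial M ℝ x)

/-- The model with corners of the manifold `T*M`; its model space is `ℝⁿ × (ℝⁿ)*`, and
`extChartAt (cotangentModel n) z` is the canonical chart `(q, p)` of `T*M` induced by the chart
of `M` around the base point of `z`. -/
abbrev cotangentModel (n : ℕ) := (𝓡 n).prod 𝓘(ℝ, E n →L[ℝ] ℝ)

/-- The function `p_x ↦ p_x(F(x, u)) - L(x, u)` on `T*M`. -/
def controlHamiltonian (F : (x : M) → E m → TangentSpace (𝓡 n) x) (L : M → E m → ℝ) (u : E m)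
    (z : Cotangent n M) : ℝ :=
  (z.2 (F z.1 u) : ℝ) - L z.1 u

/-- The maximized Hamiltonian `H(p_x) = max_{u ∈ U} (p_x(F(x, u)) - L(x, u))`. -/
def maxHamiltonian (U : Set (E m)) (F : (x : M) → E m → TangentSpace (𝓡 n) x)
    (L : M → E m → ℝ) (z : Cotangent n M) : ℝ :=
  sSup ((fun u => controlHamiltonian F L u z) '' U)

/-- The maximized Hamiltonian is well defined: the maximum over `U` exists at every covector. -/
def IsWellDefinedMaxHamiltonian (U : Set (E m)) (F : (x : M) → E m → TangentSpace (𝓡 n) x)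
    (L : M → E m → ℝ) : Prop :=
  ∀ z : Cotangent n M, ∃ u ∈ U, ∀ v ∈ U, controlHamiltonian F L v z ≤ controlHamiltonian F L u z

/-- The canonical symplectic form `∑ dqᵢ ∧ dpᵢ` of `T*M` in canonical coordinates. -/
def symplecticForm {n : ℕ} (w ξ : E n × (E n →L[ℝ] ℝ)) : ℝ :=
  ξ.2 w.1 - w.2 ξ.1

/-- `γ` is a global trajectory of the Hamiltonian vector field of `H`: in every canonical chart,
its velocity `w` satisfies `ω(w, ·) = dH`, i.e. `q̇ = ∂H/∂p`, `ṗ = -∂H/∂q`. (These equations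
are preserved by changes of canonical charts.) -/
def IsHamiltonianTrajectory (H : Cotangent n M → ℝ) (γ : ℝ → Cotangent n M) : Prop :=
  Continuous γ ∧ ∀ (z₀ : Cotangent n M) (t : ℝ),
    γ t ∈ (extChartAt (cotangentModel n) z₀).source →
    ∃ w : E n × (E n →L[ℝ] ℝ),
      HasDerivAt (fun s => extChartAt (cotangentModel n) z₀ (γ s)) w t ∧
      ∀ ξ : E n × (E n →L[ℝ] ℝ),
        fderiv ℝ (fun ζ => H ((extChartAt (cotangentModel n) z₀).symm ζ))
          (extChartAt (cotangentModel n) z₀ (γ t)) ξ = symplecticForm w ξ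

/-- The Hamiltonian vector field of `H` is complete: a global trajectory starts at every
covector. -/
def IsCompleteHamiltonian (H : Cotangent n M → ℝ) : Prop :=
  ∀ z : Cotangent n M, ∃ γ : ℝ → Cotangent n M, γ 0 = z ∧ IsHamiltonianTrajectory H γ

/-- The flow `e^{tH⃗}` of a complete Hamiltonian vector field (trajectories are unique when `H` is
`C²` and `M` is Hausdorff). -/
def hamiltonianFlow (H : Cotangent n M → ℝ) (hH : IsCompleteHamiltonian H) (t : ℝ)
    (z : Cotangent n M) : Cotangent n M :=
  (hH z).choose t

/-- The covector `-df_x`. -/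
def negDifferential (n : ℕ) {M : Type*} [TopologicalSpace M] [ChartedSpace (E n) M]
    (f : M → ℝ) (x : M) : Cotangent n M :=
  ⟨x, -(mfderiv (𝓡 n) 𝓘(ℝ, ℝ) f x : TangentSpace (𝓡 n) x →L[ℝ] ℝ)⟩

/-- `φ(x, t) = π(e^{tH⃗}(-df_x))`. -/
def displacement (H : Cotangent n M → ℝ) (hH : IsCompleteHamiltonian H) (f : M → ℝ) (x : M)
    (t : ℝ) : M :=
  (hamiltonianFlow H hH t (negDifferential n f x)).proj

end Hamiltonian

/-! ### Optimal transport -/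

section Transport

variable {M : Type*} [TopologicalSpace M] [MeasurableSpace M]

/-- `μ` is compactly supported. -/
def IsCompactlySupported (μ : Measure M) : Prop :=
  ∃ K : Set M, IsCompact K ∧ μ Kᶜ = 0

/-- `μ` is absolutely continuous with respect to the Lebesgue measure (class) of the manifold:
in every chart, it does not charge Lebesgue null sets. -/
def IsLebesgueAC (n : ℕ) [ChartedSpace (E n) M] (μ : Measure M) : Prop :=
  ∀ (x₀ : M) (N : Set (E n)), volume N = 0 →
    μ ((extChartAt (𝓡 n) x₀).source ∩ extChartAt (𝓡 n) x₀ ⁻¹' N) = 0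

/-- `T` is an optimal map from `μ` to `ν` for the cost `c`: it is a Borel map with `T_* μ = ν`, of
finite total cost, that minimizes the total cost among all Borel maps `S` with `S_* μ = ν`. (For a
measurable cost that is bounded below, a map whose cost is not integrable has total cost `+∞`.) -/
def IsOptimalMap (c : M → M → ℝ) (μ ν : Measure M) (T : M → M) : Prop :=
  Measurable T ∧ μ.map T = ν ∧ Integrable (fun x => c x (T x)) μ ∧
    ∀ S : M → M, Measurable S → μ.map S = ν → Integrable (fun x => c x (S x)) μ →
      ∫ x, c x (T x) ∂μ ≤ ∫ x, c x (S x) ∂μ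

/-- The transform `f^{c₁}(y) = inf_x (c(x, y) - f(x))`. -/
def c₁Transform (c : M → M → ℝ) (f : M → EReal) (y : M) : EReal :=
  ⨅ x : M, ((c x y : EReal) - f x)

/-- The transform `g^{c₂}(x) = inf_y (c(x, y) - g(y))`. -/
def c₂Transform (c : M → M → ℝ) (g : M → EReal) (x : M) : EReal :=
  ⨅ y : M, ((c x y : EReal) - g y)

/-- The function `g : M → ℝ ∪ {-∞}` is in `L¹(μ)`. -/
def IsL1 (g : M → EReal) (μ : Measure M) : Prop :=
  (∀ x, g x ≠ ⊤) ∧ (∀ᵐ x ∂μ, g x ≠ ⊥) ∧ Integrable (fun x => (g x).toReal) μ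

/-- The pairs `(g, h) ∈ L¹(μ) × L¹(ν)` with `g(x) + h(y) ≤ c(x, y)` for all `x, y`. -/
def IsDualPair (c : M → M → ℝ) (μ ν : Measure M) (g h : M → EReal) : Prop :=
  IsL1 g μ ∧ IsL1 h ν ∧ ∀ x y, g x + h y ≤ (c x y : EReal)

/-- The dual functional `∫ g dμ + ∫ h dν`. -/
def dualValue (μ ν : Measure M) (g h : M → EReal) : ℝ :=
  ∫ x, (g x).toReal ∂μ + ∫ y, (h y).toReal ∂ν

/-- `f` is a Kantorovich potential: it is `c`-concave, and the pair `(f, f^{c₁})` is a maximizer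
of the dual problem of Kantorovich. -/
structure IsKantorovichPotential (c : M → M → ℝ) (μ ν : Measure M) (f : M → EReal) : Prop where
  concave : c₂Transform c (c₁Transform c f) = f
  dualPair : IsDualPair c μ ν f (c₁Transform c f)
  maximal : ∀ g h : M → EReal, IsDualPair c μ ν g h →
    dualValue μ ν g h ≤ dualValue μ ν f (c₁Transform c f)

/-- The function `f : M → ℝ ∪ {-∞}` is finite and locally Lipschitz on `S`. -/
def IsFiniteLocallyLipschitzOn (n : ℕ) [ChartedSpace (E n) M] (f : M → EReal) (S : Set M) : Prop :=
  (∀ x ∈ S, f x ≠ ⊥ ∧ f x ≠ ⊤) ∧ IsLocallyLipschitzOn n (fun x => (f x).toReal) S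

end Transport

end ControlTransport

end

open ControlTransport

noncomputable section

set_option linter.unusedSectionVars false

namespace ControlTransport

/-! ### Lipschitz curves and their derivatives -/

section Curves

variable {V : Type*} [NormedAddCommGroup V] [NormedSpace ℝ V]

/-! The two halves of the argument meet at one observation. Let `(f, f^{c₁})` be an optimal dual
pair, suppose `f(x) + f^{c₁}(y) = c(x, y)`, and let `f` be differentiable at `x`. Since `f(z) +
f^{c₁}(y) ≤ c(z, y)` for all `z`, the function `f + f^{c₁}(y)` touches `c(·, y)` from below at `x`.
The claim is that `y` is then determined by `x` and `df_x` (`displacement_eq_of_touching`).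

To see this, take a minimizing pair `(x(·), u(·))` from `x` to `y`. The touching function bounds
from below the cost of reaching `y` from points near `x`, and such a bound can be carried along the
minimizer. From `z` near `x(t)`, follow the control `u` backwards to an earlier time `a`, evaluate
the old bound at the point reached, and subtract the action spent on `[a, t]`. The result bounds the
remaining cost from `z` at time `t`, is sharp at `x(t)`, and is differentiable there with derivative
`-p(t)`, where `p` solves the adjoint equation (`exists_adjoint_propagation`). Replacing `u` by a
constant control on a short interval shows that `u(t)` maximizes `p(F) - L` for a.e. `t`
(`ae_maximality`). Only the starting point is varied, so the multiplier is normal automatically.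
Since `H` dominates `p(F(x, u(t))) - L(x, u(t))` with equality at `(x(t), p(t))`, the two
differentials agree there, so `(x, p)` is a trajectory of the Hamiltonian field
(`hasDerivWithinAt_of_maximality`). Uniqueness for this `C¹` field identifies it, chart by chart,
with the flow line starting at `-df_x` (`IsHamiltonianTrajectory.eqOn_Icc`, `exists_isCalibratedAt`,
`forall_Icc_of_local_step`).

On the transport side, Hahn–Banach and Riesz give a plan without duality gap on the compact
supports, with a measurable pair tight on it (`exists_plan_and_pair`). A `c`-transform over the
compact support of `ν` turns this pair into a locally Lipschitz potential
(`exists_isKantorovichPotential`). Any other potential has the same dual value, so its pair is tight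
almost everywhere for the plan and along every optimal map. Rademacher's theorem
(`IsLebesgueAC.ae_mdifferentiableAt`) makes the potential differentiable `μ`-a.e. By the first half,
the plan and the graphs of all optimal maps lie, up to null sets, on the graph of the displacement;
`exists_isOptimalMap` deduces existence and uniqueness. -/

theorem lipschitzOnWith_of_sub_eq_integral {y G : ℝ → V} {a b : ℝ} {C : ℝ≥0}
    (hG : ∀ t ∈ Icc a b, ‖G t‖ ≤ C)
    (hy : ∀ s ∈ Icc a b, ∀ t ∈ Icc a b, y t - y s = ∫ τ in s..t, G τ) :
    LipschitzOnWith C y (Icc a b) := by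
  refine LipschitzOnWith.of_dist_le_mul fun t ht s hs => ?_
  rw [dist_eq_norm, hy s hs t ht, Real.dist_eq]
  exact intervalIntegral.norm_integral_le_of_norm_le_const fun τ hτ =>
    hG τ (uIcc_subset_Icc hs ht (uIoc_subset_uIcc hτ))

theorem ae_hasDerivAt_of_sub_eq_integral [CompleteSpace V] {y G : ℝ → V} {a b : ℝ}
    (hG : IntervalIntegrable G volume a b)
    (hy : ∀ s ∈ Icc a b, ∀ t ∈ Icc a b, y t - y s = ∫ τ in s..t, G τ) :
    ∀ᵐ t, t ∈ Icc a b → HasDerivAt y (G t) t := by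
  -- The end points are discarded: the formula for `y` holds only on `Icc a b`, and a two-sided
  -- derivative is claimed.
  have h1 : ∀ᵐ x : ℝ, x ≠ a := by simp [ae_iff, measure_singleton]
  have h2 : ∀ᵐ x : ℝ, x ≠ b := by simp [ae_iff, measure_singleton]
  filter_upwards [hG.ae_hasDerivAt_integral, h1, h2] with t ht hta htb hm
  have hab : a ≤ b := hm.1.trans hm.2
  have h3 := ht (uIcc_of_le hab ▸ hm) a (by simp)
  have hn : Icc a b ∈ 𝓝 t :=
    Icc_mem_nhds (lt_of_le_of_ne hm.1 (Ne.symm hta)) (lt_of_le_of_ne hm.2 htb)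
  refine (h3.const_add (y a)).congr_of_eventuallyEq ?_
  filter_upwards [hn] with s hs
  rw [← hy a ⟨le_rfl, hab⟩ s hs]; abel

theorem lipschitzOnWith_clm_apply {V' : Type*} [NormedAddCommGroup V'] [NormedSpace ℝ V']
    {p : ℝ → V →L[ℝ] V'} {δ : ℝ → V} {s : Set ℝ} {K K' B B' : ℝ≥0}
    (hp : LipschitzOnWith K p s) (hδ : LipschitzOnWith K' δ s) (hB : ∀ t ∈ s, ‖p t‖ ≤ B)
    (hB' : ∀ t ∈ s, ‖δ t‖ ≤ B') :
    LipschitzOnWith (B * K' + K * B') (fun t => p t (δ t)) s := by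
  refine LipschitzOnWith.of_dist_le_mul fun t ht t' ht' => ?_
  have h1 := hp.dist_le_mul t ht t' ht'
  have h2 := hδ.dist_le_mul t ht t' ht'
  rw [dist_eq_norm] at h1 h2 ⊢
  have e : p t (δ t) - p t' (δ t') = p t (δ t - δ t') + (p t - p t') (δ t') := by
    simp
  rw [e]
  calc ‖p t (δ t - δ t') + (p t - p t') (δ t')‖
      ≤ ‖p t‖ * ‖δ t - δ t'‖ + ‖p t - p t'‖ * ‖δ t'‖ :=
        (norm_add_le _ _).trans (add_le_add ((p t).le_opNorm _) ((p t - p t').le_opNorm _))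
    _ ≤ B * (K' * dist t t') + (K * dist t t') * B' := by
        gcongr
        · exact hB t ht
        · exact hB' t' ht'
    _ = _ := by push_cast; ring

theorem integral_sub_eq_integral_of_mem_Icc {G : ℝ → V} {a b c : ℝ}
    (hG : IntervalIntegrable G volume a b) (hc : c ∈ Icc a b) {s t : ℝ} (hs : s ∈ Icc a b)
    (ht : t ∈ Icc a b) : (∫ τ in c..t, G τ) - (∫ τ in c..s, G τ) = ∫ τ in s..t, G τ := by
  have hI : uIcc a b = Icc a b := uIcc_of_le (hc.1.trans hc.2)
  have hsub : ∀ {p q : ℝ}, p ∈ Icc a b → q ∈ Icc a b → IntervalIntegrable G volume p q :=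
    fun hp hq => hG.mono_set (by rw [hI]; exact uIcc_subset_Icc hp hq)
  exact intervalIntegral.integral_interval_sub_left (hsub hc ht) (hsub hc hs)

/-- The difference between `y` and the primitive of `G` is absolutely continuous with derivative
zero almost everywhere, hence constant. This turns a differential equation valid at a.e. time into
an integral equation. -/
theorem sub_eq_integral_of_lipschitzOn [CompleteSpace V] {y G : ℝ → V} {a b : ℝ} {K C : ℝ≥0}
    (hy : LipschitzOnWith K y (Icc a b)) (hG : IntervalIntegrable G volume a b)
    (hC : ∀ t ∈ Icc a b, ‖G t‖ ≤ C)
    (hd : ∀ᵐ t, t ∈ Icc a b → HasDerivAt y (G t) t) {s t : ℝ} (hs : s ∈ Icc a b)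
    (ht : t ∈ Icc a b) : y t - y s = ∫ τ in s..t, G τ := by
  have hab : a ≤ b := hs.1.trans hs.2
  have hI : uIcc a b = Icc a b := uIcc_of_le hab
  have ha : a ∈ Icc a b := ⟨le_rfl, hab⟩
  have hac : AbsolutelyContinuousOnInterval (fun x => y x - ∫ τ in a..x, G τ) a b := by
    have h1 : AbsolutelyContinuousOnInterval y a b :=
      LipschitzOnWith.absolutelyContinuousOnInterval (K := K) (hI.symm ▸ hy)
    have h2 : AbsolutelyContinuousOnInterval (fun x => ∫ τ in a..x, G τ) a b := by
      refine LipschitzOnWith.absolutelyContinuousOnInterval (K := C) ?_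
      rw [hI]
      exact lipschitzOnWith_of_sub_eq_integral hC fun s hs t ht =>
        integral_sub_eq_integral_of_mem_Icc hG ha hs ht
    exact h1.sub h2
  obtain ⟨D, hD⟩ := hac.const_of_ae_hasDerivAt_zero (by
    filter_upwards [hd, hG.ae_hasDerivAt_integral] with x h1 h2 hx
    have h3 := (h1 (hI ▸ hx)).sub (h2 hx a (by simp))
    rw [sub_self] at h3
    exact h3)
  have h1 := hD s (hI ▸ hs)
  have h2 := hD t (hI ▸ ht)
  have h3 := integral_sub_eq_integral_of_mem_Icc hG ha hs ht
  rw [← h3, sub_eq_sub_iff_sub_eq_sub]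
  exact h2.trans h1.symm

theorem abs_sub_le_of_lipschitzOn_of_ae_deriv_le {y d : ℝ → ℝ} {a b C : ℝ} {K : ℝ≥0} (hab : a ≤ b)
    (hy : LipschitzOnWith K y (Icc a b))
    (hd : ∀ᵐ t, t ∈ Icc a b → HasDerivAt y (d t) t ∧ |d t| ≤ C) :
    |y b - y a| ≤ C * (b - a) := by
  have hac : AbsolutelyContinuousOnInterval y a b :=
    LipschitzOnWith.absolutelyContinuousOnInterval (K := K) (by rwa [uIcc_of_le hab])
  rw [← hac.integral_deriv_eq_sub]
  have h := intervalIntegral.norm_integral_le_of_norm_le_const_ae (f := deriv y) (a := a) (b := b)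
    (C := C) (by
      filter_upwards [hd] with t ht hm
      rw [uIoc_of_le hab] at hm
      obtain ⟨h1, h2⟩ := ht (Ioc_subset_Icc_self hm)
      rw [h1.deriv]; exact h2)
  rwa [abs_of_nonneg (sub_nonneg.2 hab)] at h

/-- Existence for an integral equation of Carathéodory type on a short interval. -/
theorem exists_integral_equation_solution [CompleteSpace V] {G : ℝ → V → V} {a b t₀ : ℝ}
    {K : ℝ≥0} {s : Set V}
    {y₀ : V} (ht₀ : t₀ ∈ Icc a b) (hK : K * (b - a) < 1) (hs : IsClosed s) (hne : s.Nonempty)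
    (hlip : ∀ t ∈ Icc a b, LipschitzOnWith K (G t) s)
    (hint : ∀ y : ℝ → V, Continuous y → (∀ t, y t ∈ s) →
      IntervalIntegrable (fun t => G t (y t)) volume a b)
    (hmaps : ∀ y : ℝ → V, Continuous y → (∀ t, y t ∈ s) →
      ∀ t ∈ Icc a b, y₀ + ∫ τ in t₀..t, G τ (y τ) ∈ s) :
    ∃ y : ℝ → V, Continuous y ∧ (∀ t, y t ∈ s) ∧
      ∀ t ∈ Icc a b, y t = y₀ + ∫ τ in t₀..t, G τ (y τ) := by
  have hab : a ≤ b := ht₀.1.trans ht₀.2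
  have hI : uIcc a b = Icc a b := uIcc_of_le hab
  have : Nonempty s := hne.to_subtype
  have : CompleteSpace s := hs.completeSpace_coe
  have : Nonempty (Icc a b) := ⟨⟨t₀, ht₀⟩⟩
  -- The fixed point is sought in the complete space `C([a, b], s)`. Its elements are continued as
  -- constants beyond the end points, so that the hypotheses on curves defined on `ℝ` apply.
  let ext : C(Icc a b, s) → ℝ → V := fun z t => (z (projIcc a b hab t) : V)
  have hext : ∀ z, Continuous (ext z) := fun z =>
    continuous_subtype_val.comp (z.continuous.comp continuous_projIcc)
  have hexts : ∀ z t, ext z t ∈ s := fun z t => (z _).2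
  have hcont : ∀ z, ContinuousOn (fun t => y₀ + ∫ τ in t₀..t, G τ (ext z τ)) (Icc a b) := by
    intro z
    have h := intervalIntegral.continuousOn_primitive_interval' (hint _ (hext z) (hexts z))
      (a := t₀) (by rwa [hI])
    rw [hI] at h
    exact continuousOn_const.add h
  let T : C(Icc a b, s) → C(Icc a b, s) := fun z =>
    ⟨fun t => ⟨y₀ + ∫ τ in t₀..t, G τ (ext z τ), hmaps _ (hext z) (hexts z) t t.2⟩,
      Continuous.subtype_mk (continuousOn_iff_continuous_domRestrict.1 (hcont z)) _⟩
  have hTapp : ∀ z t, (T z t : V) = y₀ + ∫ τ in t₀..t, G τ (ext z τ) := fun _ _ => rfl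
  have hKab : ((K * (b - a).toNNReal : ℝ≥0) : ℝ) = K * (b - a) := by
    rw [NNReal.coe_mul, Real.coe_toNNReal _ (sub_nonneg.2 hab)]
  have hT : ContractingWith (K * (b - a).toNNReal) T := by
    refine ⟨by rw [← NNReal.coe_lt_coe, hKab]; exact hK, LipschitzWith.of_dist_le_mul fun z z' => ?_⟩
    rw [ContinuousMap.dist_le (by positivity), hKab]
    intro t
    have hsub : ∀ z, IntervalIntegrable (fun τ => G τ (ext z τ)) volume t₀ t := fun z =>
      (hint _ (hext z) (hexts z)).mono_set (by rw [hI]; exact uIcc_subset_Icc ht₀ t.2)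
    have e : dist (T z t) (T z' t) =
        ‖∫ τ in t₀..t, (G τ (ext z τ) - G τ (ext z' τ))‖ := by
      rw [intervalIntegral.integral_sub (hsub z) (hsub z'), Subtype.dist_eq, dist_eq_norm, hTapp,
        hTapp, add_sub_add_left_eq_sub]
    rw [e]
    have hb := intervalIntegral.norm_integral_le_of_norm_le_const (a := t₀) (b := t)
      (f := fun τ => G τ (ext z τ) - G τ (ext z' τ)) (C := K * dist z z') (by
        intro τ hτ
        have hτ' : τ ∈ Icc a b := uIcc_subset_Icc ht₀ t.2 (uIoc_subset_uIcc hτ)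
        rw [← dist_eq_norm]
        refine ((hlip τ hτ').dist_le_mul _ (hexts z τ) _ (hexts z' τ)).trans ?_
        gcongr
        exact (ContinuousMap.dist_apply_le_dist (f := z) (g := z') _))
    refine hb.trans ?_
    have h2 : |(t : ℝ) - t₀| ≤ b - a := by
      rw [abs_le]; constructor <;> linarith [t.2.1, t.2.2, ht₀.1, ht₀.2]
    calc (K : ℝ) * dist z z' * |(t : ℝ) - t₀| ≤ K * dist z z' * (b - a) := by gcongr
      _ = _ := by ring
  have : Nonempty C(Icc a b, s) := ⟨ContinuousMap.const _ (Classical.arbitrary s)⟩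
  have hfix := hT.fixedPoint_isFixedPt
  set z := ContractingWith.fixedPoint T hT
  refine ⟨ext z, hext z, hexts z, fun t ht => ?_⟩
  have h1 : T z ⟨t, ht⟩ = z ⟨t, ht⟩ := by rw [hfix]
  have h2 : ext z t = z ⟨t, ht⟩ := by simp [ext, projIcc_of_mem hab ht]
  rw [h2, ← h1, hTapp]

end Curves

/-- Measurability is the point, since `H` is controlled only on `A ×ˢ K` and `w` is only a.e.
measurable: the image measure under `t ↦ (ξ t, w t)` is concentrated on `A ×ˢ K`, where `H` is
continuous. -/
theorem intervalIntegrable_of_continuousOn_prod {Q W V : Type*} [TopologicalSpace Q] [T2Space Q]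
    [MeasurableSpace Q] [BorelSpace Q] [SecondCountableTopology Q] [TopologicalSpace W] [T2Space W]
    [MeasurableSpace W] [BorelSpace W] [SecondCountableTopology W] [NormedAddCommGroup V]
    {A : Set Q} {K : Set W} {H : Q × W → V}
    (hA : IsCompact A) (hK : IsCompact K) (hH : ContinuousOn H (A ×ˢ K)) {a b : ℝ} (hab : a ≤ b)
    {ξ : ℝ → Q} {w : ℝ → W} (hξ : ContinuousOn ξ (Icc a b)) (hξA : ∀ t ∈ Icc a b, ξ t ∈ A)
    (hw : AEMeasurable w (volume.restrict (Icc a b))) (hwK : ∀ t ∈ Icc a b, w t ∈ K) :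
    IntervalIntegrable (fun t => H (ξ t, w t)) volume a b := by
  obtain ⟨C, hC⟩ := (hA.prod hK).exists_bound_of_continuousOn hH
  have hm : MeasurableSet (A ×ˢ K) := hA.measurableSet.prod hK.measurableSet
  have hpair : AEMeasurable (fun t => (ξ t, w t)) (volume.restrict (Icc a b)) :=
    (hξ.aemeasurable measurableSet_Icc).prodMk hw
  have hae : ∀ᵐ z ∂((volume.restrict (Icc a b)).map fun t => (ξ t, w t)), z ∈ A ×ˢ K := by
    refine (ae_map_iff hpair hm).2 ?_
    exact (ae_restrict_iff' measurableSet_Icc).2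
      (Filter.Eventually.of_forall fun t ht => ⟨hξA t ht, hwK t ht⟩)
  have hsm : AEStronglyMeasurable H ((volume.restrict (Icc a b)).map fun t => (ξ t, w t)) := by
    have := hH.aestronglyMeasurable (μ := (volume.restrict (Icc a b)).map fun t => (ξ t, w t)) hm
    rwa [Measure.restrict_eq_self_of_ae_mem hae] at this
  rw [intervalIntegrable_iff_integrableOn_Icc_of_le hab]
  refine Integrable.of_bound (hsm.comp_aemeasurable hpair) C ?_
  exact (ae_restrict_iff' measurableSet_Icc).2
    (Filter.Eventually.of_forall fun t ht => hC _ ⟨hξA t ht, hwK t ht⟩)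

/-! ### Families of vector fields on Euclidean space depending on a control -/

section Family

variable {Q W V : Type*} [NormedAddCommGroup Q] [NormedSpace ℝ Q] [NormedAddCommGroup W]
  [NormedAddCommGroup V] [NormedSpace ℝ V]

/-- `G` is continuous on `Ω × U`, differentiable in the first variable, and the partial derivative
is continuous on `Ω × U`. -/
structure IsC1Family (Ω : Set Q) (U : Set W) (G : Q → W → V) : Prop where
  cont : ContinuousOn (fun p : Q × W => G p.1 p.2) (Ω ×ˢ U)
  diff : ∀ w ∈ U, ∀ q ∈ Ω, DifferentiableAt ℝ (fun q => G q w) q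
  cont_fderiv : ContinuousOn (fun p : Q × W => fderiv ℝ (fun q => G q p.2) p.1) (Ω ×ˢ U)

variable {Ω : Set Q} {U : Set W} {G : Q → W → V}

theorem IsC1Family.exists_bound (hG : IsC1Family Ω U G) {A : Set Q} {K : Set W}
    (hA : IsCompact A) (hK : IsCompact K) (hAΩ : A ⊆ Ω) (hKU : K ⊆ U) :
    ∃ C : ℝ≥0, ∀ w ∈ K, ∀ q ∈ A, ‖G q w‖ ≤ C ∧ ‖fderiv ℝ (fun q => G q w) q‖ ≤ C := by
  obtain ⟨C, hC⟩ := (hA.prod hK).exists_bound_of_continuousOn (hG.cont.mono (prod_mono hAΩ hKU))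
  obtain ⟨D, hD⟩ := (hA.prod hK).exists_bound_of_continuousOn
    (hG.cont_fderiv.mono (prod_mono hAΩ hKU))
  refine ⟨(max C D).toNNReal, fun w hw q hq => ⟨?_, ?_⟩⟩
  · exact (hC (q, w) ⟨hq, hw⟩).trans ((le_max_left _ _).trans (Real.le_coe_toNNReal _))
  · exact (hD (q, w) ⟨hq, hw⟩).trans ((le_max_right _ _).trans (Real.le_coe_toNNReal _))

theorem IsC1Family.lipschitzOnWith (hG : IsC1Family Ω U G) {A : Set Q} (hA : Convex ℝ A)
    (hAΩ : A ⊆ Ω) {w : W} (hw : w ∈ U) {C : ℝ≥0}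
    (hC : ∀ q ∈ A, ‖fderiv ℝ (fun q => G q w) q‖ ≤ C) :
    LipschitzOnWith C (fun q => G q w) A :=
  hA.lipschitzOnWith_of_nnnorm_fderiv_le (𝕜 := ℝ) (fun q hq => hG.diff w hw q (hAΩ hq)) hC

/-- Uniform continuity of the partial derivative on a compact set and the mean value inequality
along segments. Uniformity in the control matters because the control varies along a trajectory
without any continuity. -/
theorem IsC1Family.uniform_differentiability (hG : IsC1Family Ω U G) {A : Set Q} {K : Set W}
    (hA : IsCompact A) (hAc : Convex ℝ A) (hK : IsCompact K) (hAΩ : A ⊆ Ω) (hKU : K ⊆ U)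
    {κ : ℝ} (hκ : 0 < κ) :
    ∃ ρ > 0, ∀ w ∈ K, ∀ q ∈ A, ∀ q' ∈ A, ‖q' - q‖ < ρ →
      ‖G q' w - G q w - fderiv ℝ (fun q => G q w) q (q' - q)‖ ≤ κ * ‖q' - q‖ := by
  have huc := (hA.prod hK).uniformContinuousOn_of_continuous
    (hG.cont_fderiv.mono (prod_mono hAΩ hKU))
  obtain ⟨ρ, hρ, h⟩ := Metric.uniformContinuousOn_iff.1 huc κ hκ
  refine ⟨ρ, hρ, fun w hw q hq q' hq' hqq => ?_⟩
  have hseg : segment ℝ q q' ⊆ A := hAc.segment_subset hq hq'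
  refine (convex_segment q q').norm_image_sub_le_of_norm_hasFDerivWithin_le'
    (f := fun q => G q w) (f' := fun y => fderiv ℝ (fun q => G q w) y)
    (fun y hy => (hG.diff w (hKU hw) y (hAΩ (hseg hy))).hasFDerivAt.hasFDerivWithinAt)
    (fun y hy => ?_) (left_mem_segment ℝ q q') (right_mem_segment ℝ q q')
  have h1 : dist ((y, w) : Q × W) (q, w) < ρ := by
    rw [Prod.dist_eq, dist_self, max_lt_iff]
    refine ⟨lt_of_le_of_lt ?_ hqq, hρ⟩
    rw [dist_eq_norm]
    have := norm_sub_le_of_mem_segment hy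
    exact this
  have := h (y, w) ⟨hseg hy, hw⟩ (q, w) ⟨hq, hw⟩ h1
  rw [dist_eq_norm] at this
  exact this.le

variable [MeasurableSpace Q] [BorelSpace Q] [SecondCountableTopology Q]
  [MeasurableSpace W] [BorelSpace W] [SecondCountableTopology W]

/-- A curve `ξ` in `Ω` driven on `[a, b]` by the bounded measurable control `w`. -/
structure IsLocalTrajectory (Ω : Set Q) (U : Set W) (F : Q → W → Q) (a b : ℝ) (ξ : ℝ → Q)
    (w : ℝ → W) : Prop where
  cont : ContinuousOn ξ (Icc a b)
  mem : ∀ t ∈ Icc a b, ξ t ∈ Ω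
  meas : AEMeasurable w (volume.restrict (Icc a b))
  bdd : Bornology.IsBounded (w '' Icc a b)
  memU : ∀ t ∈ Icc a b, w t ∈ U
  eq : ∀ s ∈ Icc a b, ∀ t ∈ Icc a b, ξ t - ξ s = ∫ τ in s..t, F (ξ τ) (w τ)

variable {F : Q → W → Q}

theorem IsLocalTrajectory.mono {a b a' b' : ℝ} {ξ : ℝ → Q} {w : ℝ → W}
    (h : IsLocalTrajectory Ω U F a b ξ w) (ha : a ≤ a') (hb : b' ≤ b) :
    IsLocalTrajectory Ω U F a' b' ξ w := by
  have hs : Icc a' b' ⊆ Icc a b := Icc_subset_Icc ha hb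
  exact ⟨h.cont.mono hs, fun t ht => h.mem t (hs ht), h.meas.mono_measure
    (Measure.restrict_mono hs le_rfl), h.bdd.subset (image_mono hs), fun t ht => h.memU t (hs ht),
    fun s hs' t ht => h.eq s (hs hs') t (hs ht)⟩

theorem IsLocalTrajectory.intervalIntegrable [ProperSpace W] (hU : IsClosed U) {H : Q → W → V}
    (hH : ContinuousOn (fun p : Q × W => H p.1 p.2) (Ω ×ˢ U)) {a b : ℝ} (hab : a ≤ b)
    {ξ : ℝ → Q} {w : ℝ → W} (h : IsLocalTrajectory Ω U F a b ξ w) :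
    IntervalIntegrable (fun t => H (ξ t) (w t)) volume a b := by
  refine intervalIntegrable_of_continuousOn_prod (H := fun p => H p.1 p.2)
    (isCompact_Icc.image_of_continuousOn h.cont)
    h.bdd.isCompact_closure (hH.mono (prod_mono ?_ ?_)) hab h.cont
    (fun t ht => mem_image_of_mem _ ht) h.meas
    (fun t ht => subset_closure (mem_image_of_mem _ ht))
  · rintro _ ⟨t, ht, rfl⟩; exact h.mem t ht
  · exact closure_minimal (by rintro _ ⟨t, ht, rfl⟩; exact h.memU t ht) hU

theorem IsLocalTrajectory.exists_bound [ProperSpace W] (hU : IsClosed U) {H : Q → W → V}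
    (hH : ContinuousOn (fun p : Q × W => H p.1 p.2) (Ω ×ˢ U)) {a b : ℝ}
    {ξ : ℝ → Q} {w : ℝ → W} (h : IsLocalTrajectory Ω U F a b ξ w) :
    ∃ C : ℝ≥0, ∀ t ∈ Icc a b, ‖H (ξ t) (w t)‖ ≤ C := by
  obtain ⟨C, hC⟩ := ((isCompact_Icc.image_of_continuousOn h.cont).prod
    h.bdd.isCompact_closure).exists_bound_of_continuousOn (hH.mono (prod_mono
      (by rintro _ ⟨t, ht, rfl⟩; exact h.mem t ht)
      (closure_minimal (by rintro _ ⟨t, ht, rfl⟩; exact h.memU t ht) hU)))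
  exact ⟨C.toNNReal, fun t ht => (hC (ξ t, w t) ⟨mem_image_of_mem _ ht,
    subset_closure (mem_image_of_mem _ ht)⟩).trans (Real.le_coe_toNNReal _)⟩

theorem IsLocalTrajectory.lipschitz [ProperSpace W] (hU : IsClosed U)
    (hF : ContinuousOn (fun p : Q × W => F p.1 p.2) (Ω ×ˢ U)) {a b : ℝ}
    {ξ : ℝ → Q} {w : ℝ → W} (h : IsLocalTrajectory Ω U F a b ξ w) :
    ∃ C : ℝ≥0, LipschitzOnWith C ξ (Icc a b) := by
  obtain ⟨C, hC⟩ := h.exists_bound hU hF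
  exact ⟨C, lipschitzOnWith_of_sub_eq_integral hC h.eq⟩

theorem IsLocalTrajectory.ae_hasDerivAt [CompleteSpace Q] [ProperSpace W] (hU : IsClosed U)
    (hF : ContinuousOn (fun p : Q × W => F p.1 p.2) (Ω ×ˢ U)) {a b : ℝ} (hab : a ≤ b)
    {ξ : ℝ → Q} {w : ℝ → W} (h : IsLocalTrajectory Ω U F a b ξ w) :
    ∀ᵐ t, t ∈ Icc a b → HasDerivAt ξ (F (ξ t) (w t)) t :=
  ae_hasDerivAt_of_sub_eq_integral (h.intervalIntegrable hU hF hab) h.eq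

/-- The value may be prescribed at any time `t₀`, so trajectories can be run backwards. `h1` makes
the integral operator a contraction; `h2` keeps in the ball of radius `r` what passes through the
half ball. -/
theorem exists_local_trajectory [CompleteSpace Q] [ProperSpace Q] (hF : IsC1Family Ω U F)
    {q₀ : Q} {r : ℝ} (hB : Metric.closedBall q₀ r ⊆ Ω) {K : Set W} (hK : IsCompact K)
    (hKU : K ⊆ U) {C : ℝ≥0}
    (hC : ∀ w ∈ K, ∀ q ∈ Metric.closedBall q₀ r,
      ‖F q w‖ ≤ C ∧ ‖fderiv ℝ (fun q => F q w) q‖ ≤ C)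
    {a b : ℝ} (h1 : C * (b - a) < 1) (h2 : C * (b - a) ≤ r / 2) {w : ℝ → W}
    (hw : AEMeasurable w (volume.restrict (Icc a b))) (hwK : ∀ t ∈ Icc a b, w t ∈ K)
    {t₀ : ℝ} (ht₀ : t₀ ∈ Icc a b) {z : Q} (hz : z ∈ Metric.closedBall q₀ (r / 2)) :
    ∃ ξ : ℝ → Q, Continuous ξ ∧ (∀ t, ξ t ∈ Metric.closedBall q₀ r) ∧ ξ t₀ = z ∧
      IsLocalTrajectory Ω U F a b ξ w := by
  have hab : a ≤ b := ht₀.1.trans ht₀.2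
  have hI : uIcc a b = Icc a b := uIcc_of_le hab
  have hr : 0 ≤ r := by have := dist_nonneg.trans hz; linarith
  have hint : ∀ y : ℝ → Q, Continuous y → (∀ t, y t ∈ Metric.closedBall q₀ r) →
      IntervalIntegrable (fun t => F (y t) (w t)) volume a b := fun y hy hyB =>
    intervalIntegrable_of_continuousOn_prod (H := fun p => F p.1 p.2)
      (isCompact_closedBall q₀ r) hK (hF.cont.mono (prod_mono hB hKU)) hab hy.continuousOn
      (fun t _ => hyB t) hw hwK
  obtain ⟨ξ, hξ, hξB, he⟩ := exists_integral_equation_solution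
    (G := fun t q => F q (w t)) (y₀ := z) ht₀ h1 (Metric.isClosed_closedBall (x := q₀) (ε := r))
    ⟨q₀, Metric.mem_closedBall_self hr⟩
    (fun t ht => hF.lipschitzOnWith (convex_closedBall q₀ r) hB (hKU (hwK t ht))
      fun q hq => (hC _ (hwK t ht) q hq).2) hint (fun y _ hyB t ht => by
      have hb := intervalIntegral.norm_integral_le_of_norm_le_const (a := t₀) (b := t)
        (f := fun τ => F (y τ) (w τ)) (C := C) (fun τ hτ =>
          (hC _ (hwK τ (uIcc_subset_Icc ht₀ ht (uIoc_subset_uIcc hτ))) _ (hyB τ)).1)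
      have h3 : |t - t₀| ≤ b - a := by
        rw [abs_le]; constructor <;> linarith [ht.1, ht.2, ht₀.1, ht₀.2]
      have h4 : (C : ℝ) * |t - t₀| ≤ C * (b - a) := by gcongr
      rw [mem_closedBall_iff_norm] at hz ⊢
      calc ‖z + (∫ τ in t₀..t, F (y τ) (w τ)) - q₀‖
          = ‖(z - q₀) + ∫ τ in t₀..t, F (y τ) (w τ)‖ := by congr 1; abel
        _ ≤ ‖z - q₀‖ + ‖∫ τ in t₀..t, F (y τ) (w τ)‖ := norm_add_le _ _
        _ ≤ r := by linarith)
  refine ⟨ξ, hξ, hξB, ?_, hξ.continuousOn, fun t _ => hB (hξB t), hw,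
    hK.isBounded.subset (by rintro _ ⟨t, ht, rfl⟩; exact hwK t ht), fun t ht => hKU (hwK t ht),
    fun s hs t ht => ?_⟩
  · rw [he t₀ ht₀]; simp
  · rw [he s hs, he t ht, add_sub_add_left_eq_sub]
    exact integral_sub_eq_integral_of_mem_Icc (hint ξ hξ hξB) ht₀ hs ht

/-- Two trajectories with the same control stay close on short intervals. -/
theorem norm_sub_le_of_local_trajectories [CompleteSpace Q] [ProperSpace W] (hU : IsClosed U)
    (hF : IsC1Family Ω U F) {A : Set Q} (hA : Convex ℝ A) (hAΩ : A ⊆ Ω) {C : ℝ≥0} {a b : ℝ}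
    {ξ ξ' : ℝ → Q} {w : ℝ → W}
    (hC : ∀ t ∈ Icc a b, ∀ q ∈ A, ‖fderiv ℝ (fun q => F q (w t)) q‖ ≤ C)
    (h1 : C * (b - a) ≤ 1 / 2)
    (h : IsLocalTrajectory Ω U F a b ξ w) (h' : IsLocalTrajectory Ω U F a b ξ' w)
    (hξ : ∀ t ∈ Icc a b, ξ t ∈ A) (hξ' : ∀ t ∈ Icc a b, ξ' t ∈ A)
    {s t : ℝ} (hs : s ∈ Icc a b) (ht : t ∈ Icc a b) :
    ‖ξ s - ξ' s‖ ≤ 2 * ‖ξ t - ξ' t‖ := by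
  have hab : a ≤ b := hs.1.trans hs.2
  -- At a time of maximal distance, the increment is at most half of that distance and can be
  -- absorbed; no Grönwall inequality is needed.
  obtain ⟨m, hm, hmax⟩ := isCompact_Icc.exists_isMaxOn ⟨s, hs⟩ (h.cont.sub h'.cont).norm
  have hmax' : ∀ τ ∈ Icc a b, ‖ξ τ - ξ' τ‖ ≤ ‖ξ m - ξ' m‖ := fun τ hτ => hmax hτ
  have hsub : ∀ {η : ℝ → Q}, IsLocalTrajectory Ω U F a b η w →
      IntervalIntegrable (fun τ => F (η τ) (w τ)) volume t m := fun hη =>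
    (hη.intervalIntegrable hU hF.cont hab).mono_set
      (by rw [uIcc_of_le hab]; exact uIcc_subset_Icc ht hm)
  have e : (ξ m - ξ' m) - (ξ t - ξ' t) = ∫ τ in t..m, (F (ξ τ) (w τ) - F (ξ' τ) (w τ)) := by
    rw [intervalIntegral.integral_sub (hsub h) (hsub h'), ← h.eq t ht m hm, ← h'.eq t ht m hm]
    abel
  have hb := intervalIntegral.norm_integral_le_of_norm_le_const (a := t) (b := m)
    (f := fun τ => F (ξ τ) (w τ) - F (ξ' τ) (w τ)) (C := C * ‖ξ m - ξ' m‖) (fun τ hτ => by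
      have hτ' : τ ∈ Icc a b := uIcc_subset_Icc ht hm (uIoc_subset_uIcc hτ)
      rw [← dist_eq_norm]
      refine ((hF.lipschitzOnWith hA hAΩ (h.memU τ hτ') (hC τ hτ')).dist_le_mul _ (hξ τ hτ') _
        (hξ' τ hτ')).trans ?_
      rw [dist_eq_norm]
      gcongr
      exact hmax' τ hτ')
  rw [← e] at hb
  have h3 : |m - t| ≤ b - a := by
    rw [abs_le]; constructor <;> linarith [ht.1, ht.2, hm.1, hm.2]
  have h4 : (C : ℝ) * ‖ξ m - ξ' m‖ * |m - t| ≤ 1 / 2 * ‖ξ m - ξ' m‖ := by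
    calc (C : ℝ) * ‖ξ m - ξ' m‖ * |m - t| ≤ C * ‖ξ m - ξ' m‖ * (b - a) := by gcongr
      _ = (C * (b - a)) * ‖ξ m - ξ' m‖ := by ring
      _ ≤ _ := by gcongr
  have h5 : ‖ξ m - ξ' m‖ ≤ ‖ξ t - ξ' t‖ + ‖(ξ m - ξ' m) - (ξ t - ξ' t)‖ := by
    have := norm_add_le (ξ t - ξ' t) ((ξ m - ξ' m) - (ξ t - ξ' t))
    rwa [add_sub_cancel] at this
  have := hmax' s hs
  linarith

/-- With `D = ∂F/∂x` and `ℓ = ∂L/∂x` along a trajectory, this is the adjoint equation of the maximum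
principle. It is affine in `p`, so the contraction argument runs on the whole dual space. -/
theorem exists_adjoint_solution [CompleteSpace V] {D : ℝ → V →L[ℝ] V} {ℓ : ℝ → V →L[ℝ] ℝ}
    {a b : ℝ} {C : ℝ≥0} (hab : a ≤ b) (hC : ∀ t ∈ Icc a b, ‖D t‖ ≤ C) (h1 : C * (b - a) < 1)
    (hD : IntervalIntegrable D volume a b) (hℓ : IntervalIntegrable ℓ volume a b)
    (p₀ : V →L[ℝ] ℝ) :
    ∃ p : ℝ → V →L[ℝ] ℝ, Continuous p ∧
      IntervalIntegrable (fun s => ℓ s - (p s).comp (D s)) volume a b ∧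
      p a = p₀ ∧
      ∀ s ∈ Icc a b, ∀ t ∈ Icc a b, p t - p s = ∫ τ in s..t, (ℓ τ - (p τ).comp (D τ)) := by
  have hint : ∀ y : ℝ → V →L[ℝ] ℝ, Continuous y →
      IntervalIntegrable (fun s => ℓ s - (y s).comp (D s)) volume a b := by
    intro y hy
    refine hℓ.sub ?_
    rw [intervalIntegrable_iff_integrableOn_Icc_of_le hab] at hD ⊢
    obtain ⟨B, hB⟩ := isCompact_Icc.exists_bound_of_continuousOn (hy.continuousOn (s := Icc a b))
    refine Integrable.of_bound ?_ (B * C) ?_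
    · have := (ContinuousLinearMap.compL ℝ V V ℝ).continuous₂.comp_aestronglyMeasurable
        ((hy.aestronglyMeasurable (μ := volume.restrict (Icc a b))).prodMk hD.1)
      exact this
    · refine (ae_restrict_iff' measurableSet_Icc).2 (Filter.Eventually.of_forall fun t ht => ?_)
      refine ((y t).opNorm_comp_le (D t)).trans ?_
      exact mul_le_mul (hB t ht) (hC t ht) (norm_nonneg _) ((norm_nonneg _).trans (hB t ht))
  obtain ⟨p, hp, -, he⟩ := exists_integral_equation_solution (V := V →L[ℝ] ℝ)
    (G := fun t y => ℓ t - y.comp (D t)) (y₀ := p₀) (K := C) (s := univ)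
    (left_mem_Icc.2 hab) h1 isClosed_univ univ_nonempty
    (fun t ht => (LipschitzWith.of_dist_le_mul fun y y' => by
      rw [dist_eq_norm, dist_eq_norm, sub_sub_sub_cancel_left, ← ContinuousLinearMap.sub_comp,
        norm_sub_rev y, mul_comm]
      refine ((y' - y).opNorm_comp_le (D t)).trans ?_
      gcongr
      exact hC t ht).lipschitzOnWith)
    (fun y hy _ => hint y hy) (fun _ _ _ _ _ => mem_univ _)
  refine ⟨p, hp, hint p hp, by rw [he a (left_mem_Icc.2 hab)]; simp, fun s hs t ht => ?_⟩
  rw [he s hs, he t ht, add_sub_add_left_eq_sub]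
  exact integral_sub_eq_integral_of_mem_Icc (hint p hp) (left_mem_Icc.2 hab) hs ht

end Family

/-! ### A local maximum principle -/

section MaximumPrinciple

variable {Q W : Type*} [NormedAddCommGroup Q] [NormedSpace ℝ Q] [ProperSpace Q]
  [CompleteSpace Q] [MeasurableSpace Q] [BorelSpace Q] [SecondCountableTopology Q]
  [NormedAddCommGroup W] [ProperSpace W]
  [MeasurableSpace W] [BorelSpace W] [SecondCountableTopology W]
  {Ω : Set Q} {U : Set W} {F : Q → W → Q} {L : Q → W → ℝ}

/-- The relation `R t z c` ("the cost `c` can be achieved starting from `z` at time `t`") is stable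
under prolonging backwards in time by trajectories. -/
def IsBackwardStable (Ω : Set Q) (U : Set W) (F : Q → W → Q) (L : Q → W → ℝ) (a b : ℝ)
    (R : ℝ → Q → ℝ → Prop) : Prop :=
  ∀ (s t : ℝ) (ξ : ℝ → Q) (w : ℝ → W) (c : ℝ), a ≤ s → s ≤ t → t ≤ b →
    IsLocalTrajectory Ω U F s t ξ w → R t (ξ t) c → R s (ξ s) (c + ∫ τ in s..t, L (ξ τ) (w τ))

/-- The function `g` is a lower bound of the achievable costs `R` near `x`, with the value `c` at
`x`, and it is differentiable at `x` with derivative `-p`. -/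
def TouchesBelow (R : Q → ℝ → Prop) (g : Q → ℝ) (x : Q) (p : Q →L[ℝ] ℝ) (c : ℝ) : Prop :=
  HasFDerivAt g (-p) x ∧ (∀ᶠ z in 𝓝 x, ∀ c', R z c' → g z ≤ c') ∧ g x = c

/-- The new lower bound at time `t` is `z ↦ g (ξ_z a) - ∫ₐᵗ L(ξ_z, u)`, with `ξ_z` the trajectory of
the same control through `z` at time `t`. A competitor starting from `z` can be preceded by `ξ_z`,
to which the bound at time `a` applies. The adjoint equation is what makes the derivative of this
function at `x t` equal to `-p t`, without differentiating the flow itself. -/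
theorem exists_adjoint_propagation (hU : IsClosed U) (hF : IsC1Family Ω U F)
    (hL : IsC1Family Ω U L) {q₀ : Q} {r : ℝ}
    (hB : Metric.closedBall q₀ r ⊆ Ω) {K : Set W} (hK : IsCompact K) (hKU : K ⊆ U) {C : ℝ≥0}
    (hC : ∀ w ∈ K, ∀ q ∈ Metric.closedBall q₀ r,
      ‖F q w‖ ≤ C ∧ ‖fderiv ℝ (fun q => F q w) q‖ ≤ C)
    {a b : ℝ} (hab : a ≤ b) (h1 : C * (b - a) ≤ 1 / 2) (h2 : C * (b - a) ≤ r / 2)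
    {x : ℝ → Q} {u : ℝ → W} (hx : IsLocalTrajectory Ω U F a b x u)
    (hxB : ∀ t ∈ Icc a b, x t ∈ Metric.ball q₀ (r / 2)) (huK : ∀ t ∈ Icc a b, u t ∈ K)
    {R : ℝ → Q → ℝ → Prop} (hR : IsBackwardStable Ω U F L a b R) {g : Q → ℝ} {p₀ : Q →L[ℝ] ℝ}
    {c : ℝ} (hg : TouchesBelow (R a) g (x a) p₀ (c + ∫ τ in a..b, L (x τ) (u τ))) :
    ∃ p : ℝ → Q →L[ℝ] ℝ, Continuous p ∧ p a = p₀ ∧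
      IntervalIntegrable (fun s => fderiv ℝ (fun q => L q (u s)) (x s) -
        (p s).comp (fderiv ℝ (fun q => F q (u s)) (x s))) volume a b ∧
      (∀ s ∈ Icc a b, ∀ t ∈ Icc a b, p t - p s = ∫ τ in s..t,
        (fderiv ℝ (fun q => L q (u τ)) (x τ) -
          (p τ).comp (fderiv ℝ (fun q => F q (u τ)) (x τ)))) ∧
      ∀ t ∈ Icc a b, ∃ g', TouchesBelow (R t) g' (x t) (p t)
        (c + ∫ τ in t..b, L (x τ) (u τ)) := by
  have hxB' : ∀ t ∈ Icc a b, x t ∈ Metric.closedBall q₀ r := fun t ht => by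
    have := hxB t ht
    rw [Metric.mem_ball] at this
    rw [Metric.mem_closedBall]
    have h0 : 0 ≤ dist (x t) q₀ := dist_nonneg
    linarith
  have hba : 0 ≤ b - a := sub_nonneg.2 hab
  obtain ⟨p, hp, hpint, hpa, hpeq⟩ := exists_adjoint_solution (V := Q)
    (D := fun s => fderiv ℝ (fun q => F q (u s)) (x s))
    (ℓ := fun s => fderiv ℝ (fun q => L q (u s)) (x s)) hab
    (fun t ht => (hC _ (huK t ht) _ (hxB' t ht)).2) (by linarith)
    (hx.intervalIntegrable (H := fun q w => fderiv ℝ (fun q => F q w) q) hU hF.cont_fderiv hab)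
    (hx.intervalIntegrable (H := fun q w => fderiv ℝ (fun q => L q w) q) hU hL.cont_fderiv hab) p₀
  refine ⟨p, hp, hpa, hpint, hpeq, fun t ht => ?_⟩
  obtain ⟨CL, hCL⟩ := hL.exists_bound (isCompact_closedBall q₀ r) hK hB hKU
  have hat : a ≤ t := ht.1
  have hsub : Icc a t ⊆ Icc a b := Icc_subset_Icc_right ht.2
  have hta : 0 ≤ t - a := sub_nonneg.2 hat
  have hCt : (C : ℝ) * (t - a) ≤ C * (b - a) := by
    gcongr; exact ht.2
  -- A junk curve is used outside the half ball, so that `ξ` can be chosen for every `z`.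
  have hex : ∀ z : Q, ∃ ξ : ℝ → Q, z ∈ Metric.closedBall q₀ (r / 2) →
      (∀ s, ξ s ∈ Metric.closedBall q₀ r) ∧ ξ t = z ∧ IsLocalTrajectory Ω U F a t ξ u := by
    intro z
    by_cases hz : z ∈ Metric.closedBall q₀ (r / 2)
    · obtain ⟨ξ, -, h⟩ := exists_local_trajectory hF hB hK hKU hC (a := a) (b := t) (w := u)
        (by linarith) (by linarith) (hx.mono le_rfl ht.2).meas (fun s hs => huK s (hsub hs))
        (right_mem_Icc.2 hat) hz
      exact ⟨ξ, fun _ => h⟩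
    · exact ⟨0, fun h => absurd h hz⟩
  choose ξ hξ using hex
  have hxt := hx.mono le_rfl ht.2
  have hest : ∀ z ∈ Metric.closedBall q₀ (r / 2), ∀ s ∈ Icc a t,
      ‖ξ z s - x s‖ ≤ 2 * ‖z - x t‖ := fun z hz s hs => by
    have := norm_sub_le_of_local_trajectories hU hF (convex_closedBall q₀ r) hB
      (fun τ hτ q hq => (hC _ (huK τ (hsub hτ)) q hq).2) (by linarith) (hξ z hz).2.2 hxt
      (fun τ _ => (hξ z hz).1 τ) (fun τ hτ => hxB' τ (hsub hτ)) hs (right_mem_Icc.2 hat)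
    rwa [(hξ z hz).2.1] at this
  have hxtB : x t ∈ Metric.closedBall q₀ (r / 2) := Metric.ball_subset_closedBall (hxB t ht)
  have hξx : ∀ s ∈ Icc a t, ξ (x t) s = x s := fun s hs => by
    have := hest _ hxtB s hs
    rw [sub_self, norm_zero, mul_zero] at this
    exact sub_eq_zero.1 (norm_le_zero_iff.1 this)
  have hnear : ∀ᶠ z in 𝓝 (x t), z ∈ Metric.closedBall q₀ (r / 2) := by
    filter_upwards [Metric.isOpen_ball.mem_nhds (hxB t ht)] with z hz
    exact Metric.ball_subset_closedBall hz
  have htend : Filter.Tendsto (fun z => ξ z a) (𝓝 (x t)) (𝓝 (x a)) := by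
    rw [tendsto_iff_norm_sub_tendsto_zero]
    have h0 : Filter.Tendsto (fun z => 2 * ‖z - x t‖) (𝓝 (x t)) (𝓝 0) := by
      have : Continuous fun z => 2 * ‖z - x t‖ := by fun_prop
      simpa using this.tendsto (x t)
    refine squeeze_zero' (Filter.Eventually.of_forall fun _ => norm_nonneg _) ?_ h0
    filter_upwards [hnear] with z hz using hest z hz a (left_mem_Icc.2 hat)
  obtain ⟨hgd, hgR, hgx⟩ := hg
  have hLint := hx.intervalIntegrable (H := L) hU hL.cont hab
  have hg'x : g (ξ (x t) a) - ∫ τ in a..t, L (ξ (x t) τ) (u τ) =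
      g (x a) - ∫ τ in a..t, L (x τ) (u τ) := by
    rw [hξx a (left_mem_Icc.2 hat)]
    congr 1
    refine intervalIntegral.integral_congr fun τ hτ => ?_
    rw [uIcc_of_le hat] at hτ
    simp only [hξx τ hτ]
  refine ⟨fun z => g (ξ z a) - ∫ τ in a..t, L (ξ z τ) (u τ), ?_, ?_, ?_⟩
  · rw [hasFDerivAt_iff_isLittleO, Asymptotics.isLittleO_iff]
    intro κ hκ
    obtain ⟨P, hP⟩ := isCompact_Icc.exists_bound_of_continuousOn (hp.continuousOn (s := Icc a b))
    have hP0 : 0 ≤ P := (norm_nonneg _).trans (hP a (left_mem_Icc.2 hab))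
    -- Half of the error `κ` is spent on the differentiability of `g` at `x a`, the other half on
    -- the first order remainders of `F` and `L`, weighted by `P ≥ ‖p‖` and integrated over `[a,
    -- t]`. The added ones keep the denominator positive.
    set κ₂ : ℝ := κ / (4 * (P + 1) * (b - a + 1)) with hκ₂
    have hκ₂0 : 0 < κ₂ := by positivity
    obtain ⟨ρ₁, hρ₁, hFd⟩ := hF.uniform_differentiability (isCompact_closedBall q₀ r)
      (convex_closedBall q₀ r) hK hB hKU hκ₂0
    obtain ⟨ρ₂, hρ₂, hLd⟩ := hL.uniform_differentiability (isCompact_closedBall q₀ r)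
      (convex_closedBall q₀ r) hK hB hKU hκ₂0
    rw [hasFDerivAt_iff_isLittleO, Asymptotics.isLittleO_iff] at hgd
    have hgd' := htend.eventually (hgd (show (0 : ℝ) < κ / 4 by positivity))
    have hball : ∀ᶠ z in 𝓝 (x t), ‖z - x t‖ < min ρ₁ ρ₂ / 2 := by
      filter_upwards [Metric.ball_mem_nhds (x t) (show 0 < min ρ₁ ρ₂ / 2 by positivity)] with z hz
      rwa [mem_ball_iff_norm] at hz
    filter_upwards [hnear, hgd', hball] with z hz hz1 hz2
    obtain ⟨hξB, hξt, hξtr⟩ := hξ z hz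
    have hsm : ∀ s ∈ Icc a t, ‖ξ z s - x s‖ < min ρ₁ ρ₂ := fun s hs => by
      have := hest z hz s hs
      linarith
    have hLξ := hξtr.intervalIntegrable (H := L) hU hL.cont hat
    have hLx := hxt.intervalIntegrable (H := L) hU hL.cont hat
    have hΔint := hLξ.sub hLx
    have hΔeq : ∀ s ∈ Icc a t, ∀ s' ∈ Icc a t,
        (∫ τ in a..s', (L (ξ z τ) (u τ) - L (x τ) (u τ))) -
        (∫ τ in a..s, (L (ξ z τ) (u τ) - L (x τ) (u τ))) =
        ∫ τ in s..s', (L (ξ z τ) (u τ) - L (x τ) (u τ)) := fun s hs s' hs' =>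
      integral_sub_eq_integral_of_mem_Icc hΔint (left_mem_Icc.2 hat) hs hs'
    have hpeq' : ∀ s ∈ Icc a t, ∀ s' ∈ Icc a t, p s' - p s = _ :=
      fun s hs s' hs' => hpeq s (hsub hs) s' (hsub hs')
    have hpint' := hpint.mono_set (c := a) (d := t) (by
      rw [uIcc_of_le hab, uIcc_of_le hat]; exact hsub)
    have hpL : LipschitzOnWith (CL + P.toNNReal * C) p (Icc a t) := by
      refine lipschitzOnWith_of_sub_eq_integral (fun s hs => ?_) hpeq'
      refine (norm_sub_le _ _).trans ?_
      push_cast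
      rw [Real.coe_toNNReal _ hP0]
      refine add_le_add (hCL _ (huK s (hsub hs)) _ (hxB' s (hsub hs))).2
        ((ContinuousLinearMap.opNorm_comp_le _ _).trans ?_)
      exact mul_le_mul (hP s (hsub hs)) (hC _ (huK s (hsub hs)) _ (hxB' s (hsub hs))).2
        (norm_nonneg _) hP0
    obtain ⟨C₁, hC₁⟩ := hξtr.lipschitz hU hF.cont
    obtain ⟨C₂, hC₂⟩ := hxt.lipschitz hU hF.cont
    have hδL := hC₁.sub hC₂
    have hΦ₁ := lipschitzOnWith_clm_apply hpL hδL (B := P.toNNReal)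
      (B' := (2 * ‖z - x t‖).toNNReal)
      (fun s hs => (hP s (hsub hs)).trans (Real.le_coe_toNNReal _))
      (fun s hs => (hest z hz s hs).trans (Real.le_coe_toNNReal _))
    obtain ⟨C₃, hC₃⟩ := hξtr.exists_bound hU hL.cont
    obtain ⟨C₄, hC₄⟩ := hxt.exists_bound hU hL.cont
    have hΦ₂ : LipschitzOnWith (C₃ + C₄)
        (fun s => ∫ τ in a..s, (L (ξ z τ) (u τ) - L (x τ) (u τ))) (Icc a t) :=
      lipschitzOnWith_of_sub_eq_integral (fun s hs => (norm_sub_le _ _).trans (by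
        push_cast; exact add_le_add (hC₃ s hs) (hC₄ s hs))) hΔeq
    -- In the derivative of `p(s)(ξ_z(s) - x(s)) - ∫ₐˢ (L(ξ_z, u) - L(x, u))` the linear terms
    -- cancel by the adjoint equation. Only Taylor remainders are left, so the function varies by a
    -- small multiple of `‖z - x t‖`.
    have hΦ := abs_sub_le_of_lipschitzOn_of_ae_deriv_le hat (hΦ₁.sub hΦ₂)
      (C := (P + 1) * κ₂ * (2 * ‖z - x t‖))
      (d := fun s => ((fderiv ℝ (fun q => L q (u s)) (x s) -
          (p s).comp (fderiv ℝ (fun q => F q (u s)) (x s))) (ξ z s - x s) +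
          p s (F (ξ z s) (u s) - F (x s) (u s))) - (L (ξ z s) (u s) - L (x s) (u s))) (by
        filter_upwards [ae_hasDerivAt_of_sub_eq_integral hpint' hpeq',
          ae_hasDerivAt_of_sub_eq_integral hΔint hΔeq, hξtr.ae_hasDerivAt hU hF.cont hat,
          hxt.ae_hasDerivAt hU hF.cont hat] with s i1 i2 i3 i4 hs
        refine ⟨((i1 hs).clm_apply ((i3 hs).sub (i4 hs))).sub (i2 hs), ?_⟩
        have j1 := hFd _ (huK s (hsub hs)) _ (hxB' s (hsub hs)) _ (hξB s)
          ((hsm s hs).trans_le (min_le_left _ _))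
        have j2 := hLd _ (huK s (hsub hs)) _ (hxB' s (hsub hs)) _ (hξB s)
          ((hsm s hs).trans_le (min_le_right _ _))
        have j3 := hest z hz s hs
        have e : ((fderiv ℝ (fun q => L q (u s)) (x s) -
          (p s).comp (fderiv ℝ (fun q => F q (u s)) (x s))) (ξ z s - x s) +
          p s (F (ξ z s) (u s) - F (x s) (u s))) - (L (ξ z s) (u s) - L (x s) (u s)) =
          p s (F (ξ z s) (u s) - F (x s) (u s) -
            fderiv ℝ (fun q => F q (u s)) (x s) (ξ z s - x s)) -
          (L (ξ z s) (u s) - L (x s) (u s) -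
            fderiv ℝ (fun q => L q (u s)) (x s) (ξ z s - x s)) := by
          simp only [map_sub, sub_apply, ContinuousLinearMap.comp_apply]
          ring
        simp only [e]
        refine (abs_sub _ _).trans ?_
        have j4 := (p s).le_opNorm (F (ξ z s) (u s) - F (x s) (u s) -
            fderiv ℝ (fun q => F q (u s)) (x s) (ξ z s - x s))
        have j5 : ‖p s‖ * ‖F (ξ z s) (u s) - F (x s) (u s) -
            fderiv ℝ (fun q => F q (u s)) (x s) (ξ z s - x s)‖ ≤ P * (κ₂ * ‖ξ z s - x s‖) :=
          mul_le_mul (hP s (hsub hs)) j1 (norm_nonneg _) hP0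
        rw [Real.norm_eq_abs] at j2 j4
        calc _ ≤ P * (κ₂ * ‖ξ z s - x s‖) + κ₂ * ‖ξ z s - x s‖ := add_le_add (j4.trans j5) j2
          _ = (P + 1) * κ₂ * ‖ξ z s - x s‖ := by ring
          _ ≤ _ := by gcongr)
    have hfin : (P + 1) * κ₂ * (2 * ‖z - x t‖) * (t - a) ≤ κ / 2 * ‖z - x t‖ := by
      have : (P + 1) * κ₂ * (2 * (b - a + 1)) = κ / 2 := by
        rw [hκ₂]; field_simp; ring
      rw [← this]
      have h3 : t - a ≤ b - a + 1 := by linarith [ht.2]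
      calc (P + 1) * κ₂ * (2 * ‖z - x t‖) * (t - a)
          ≤ (P + 1) * κ₂ * (2 * ‖z - x t‖) * (b - a + 1) := by gcongr
        _ = _ := by ring
    have hgz : ‖g (ξ z a) - g (x a) - (-p₀) (ξ z a - x a)‖ ≤ κ / 2 * ‖z - x t‖ := by
      refine hz1.trans ?_
      have := hest z hz a (left_mem_Icc.2 hat)
      calc κ / 4 * ‖ξ z a - x a‖ ≤ κ / 4 * (2 * ‖z - x t‖) := by gcongr
        _ = _ := by ring
    simp only [intervalIntegral.integral_same, sub_zero, hpa, hξt] at hΦ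
    rw [intervalIntegral.integral_sub hLξ hLx] at hΦ
    rw [hg'x]
    have e : g (ξ z a) - (∫ τ in a..t, L (ξ z τ) (u τ)) - (g (x a) - ∫ τ in a..t, L (x τ) (u τ)) -
        (-p t) (z - x t) = (g (ξ z a) - g (x a) - (-p₀) (ξ z a - x a)) +
        (p t (z - x t) - ((∫ τ in a..t, L (ξ z τ) (u τ)) - ∫ τ in a..t, L (x τ) (u τ)) -
          p₀ (ξ z a - x a)) := by
      simp only [neg_apply]
      ring
    rw [e]
    refine (norm_add_le _ _).trans ?_
    rw [← Real.norm_eq_abs] at hΦ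
    linarith
  -- The competitor from `z` is prolonged backwards by `ξ z`. The resulting starting point `ξ z a`
  -- is close to `x a`, where the bound by `g` is valid.
  · have hfar := htend.eventually hgR
    filter_upwards [hnear, hfar] with z hz hz1 c' hc'
    obtain ⟨-, hξt, hξtr⟩ := hξ z hz
    rw [← hξt] at hc'
    have := hz1 _ (hR a t (ξ z) u c' le_rfl hat ht.2 hξtr hc')
    linarith
  · simp only [hg'x]
    rw [hgx, ← intervalIntegral.integral_add_adjacent_intervals
      (hLint.mono_set (c := a) (d := t) (by rw [uIcc_of_le hab, uIcc_of_le hat]; exact hsub))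
      (hLint.mono_set (c := t) (d := b) (by
        rw [uIcc_of_le hab, uIcc_of_le ht.2]; exact Icc_subset_Icc_left hat))]
    ring

theorem tendsto_average_of_tendsto {V : Type*} [NormedAddCommGroup V] [NormedSpace ℝ V]
    [CompleteSpace V] {H : Q → V} {Ω : Set Q} (hH : ContinuousOn H Ω) (hΩ : IsOpen Ω)
    {τ : ℝ} {x : Q} (hx : x ∈ Ω)
    {ξ : ℝ → ℝ → Q}
    (hξ : ∀ ρ > 0, ∀ᶠ η in 𝓝[>] (0 : ℝ), ContinuousOn (ξ η) (Icc τ (τ + η)) ∧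
      ∀ s ∈ Icc τ (τ + η), ξ η s ∈ Ω ∧ ‖ξ η s - x‖ < ρ) :
    Filter.Tendsto (fun η : ℝ => η⁻¹ • ∫ s in τ..τ + η, H (ξ η s)) (𝓝[>] 0) (𝓝 (H x)) := by
  rw [Metric.tendsto_nhds]
  intro κ hκ
  have hc : ContinuousAt H x := hH.continuousAt (hΩ.mem_nhds hx)
  obtain ⟨ρ, hρ, hρH⟩ := Metric.continuousAt_iff.1 hc (κ / 2) (half_pos hκ)
  filter_upwards [hξ ρ hρ, self_mem_nhdsWithin] with η hη hη0
  have hη0' : (0 : ℝ) < η := hη0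
  have hle : τ ≤ τ + η := by linarith
  have hint : IntervalIntegrable (fun s => H (ξ η s)) volume τ (τ + η) := by
    refine ContinuousOn.intervalIntegrable ?_
    rw [uIcc_of_le hle]
    exact hH.comp hη.1 fun s hs => (hη.2 s hs).1
  have hb := intervalIntegral.norm_integral_le_of_norm_le_const (a := τ) (b := τ + η)
    (f := fun s => H (ξ η s) - H x) (C := κ / 2) (fun s hs => by
      rw [uIoc_of_le hle] at hs
      rw [← dist_eq_norm]
      refine (hρH ?_).le
      rw [dist_eq_norm]
      exact (hη.2 s (Ioc_subset_Icc_self hs)).2)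
  rw [intervalIntegral.integral_sub hint (by simp), intervalIntegral.integral_const,
    add_sub_cancel_left, abs_of_pos hη0'] at hb
  rw [dist_eq_norm]
  have e : η⁻¹ • (∫ s in τ..τ + η, H (ξ η s)) - H x =
      η⁻¹ • ((∫ s in τ..τ + η, H (ξ η s)) - η • H x) := by
    rw [smul_sub, inv_smul_smul₀ hη0'.ne']
  rw [e, norm_smul, norm_inv, Real.norm_of_nonneg hη0'.le, inv_mul_lt_iff₀ hη0']
  nlinarith

/-- A needle variation with the end kept fixed: on `[τ, τ + η]` use the constant control `v`, run
backwards from `x (τ + η)`, and afterwards keep `u`. The starting point moves by `η (F(x, u) - F(x,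
v))` to first order, and the lower bound at time `τ` compares this displacement with the change of
action. -/
theorem ae_maximality (hΩ : IsOpen Ω) (hU : IsClosed U) (hF : IsC1Family Ω U F)
    (hL : IsC1Family Ω U L) {q₀ : Q} {r : ℝ} (hr : 0 < r)
    (hB : Metric.closedBall q₀ r ⊆ Ω)
    {a b : ℝ} (hab : a ≤ b)
    {x : ℝ → Q} {u : ℝ → W} (hx : IsLocalTrajectory Ω U F a b x u)
    (hxB : ∀ t ∈ Icc a b, x t ∈ Metric.ball q₀ (r / 2))
    {R : ℝ → Q → ℝ → Prop} (hR : IsBackwardStable Ω U F L a b R) {p : ℝ → Q →L[ℝ] ℝ} {c : ℝ}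
    (hRx : R b (x b) c)
    (hg : ∀ t ∈ Icc a b, ∃ g, TouchesBelow (R t) g (x t) (p t)
      (c + ∫ τ in t..b, L (x τ) (u τ))) :
    ∀ᵐ t, t ∈ Icc a b → ∀ v ∈ U,
      p t (F (x t) v) - L (x t) v ≤ p t (F (x t) (u t)) - L (x t) (u t) := by
  have hLint := hx.intervalIntegrable (H := L) hU hL.cont hab
  have hb' : ∀ᵐ x : ℝ, x ≠ b := by simp [ae_iff, measure_singleton]
  have ha' : ∀ᵐ x : ℝ, x ≠ a := by simp [ae_iff, measure_singleton]
  -- The exceptional null set does not depend on `v`: only `x` and its own action need to be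
  -- differentiable at `τ`, because averages along the needle converge at every time.
  filter_upwards [hx.ae_hasDerivAt hU hF.cont hab, hLint.ae_hasDerivAt_integral, ha', hb']
    with τ hdx hdL hτa hτb hτ v hv
  replace hdx := hdx hτ
  replace hdL := hdL (uIcc_of_le hab ▸ hτ) a (by simp)
  have hτb : τ < b := lt_of_le_of_ne hτ.2 hτb
  have haτ : a ≤ τ := hτ.1
  obtain ⟨g, hgd, hgR, hgx⟩ := hg τ hτ
  obtain ⟨C, hC⟩ := hF.exists_bound (isCompact_closedBall q₀ r) (isCompact_singleton (x := v)) hB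
    (singleton_subset_iff.2 hv)
  -- smallness of the length of the needle
  have hsmall : ∀ᶠ η in 𝓝[>] (0 : ℝ), 0 < η ∧ τ + η ≤ b ∧ (C : ℝ) * η < 1 ∧ (C : ℝ) * η ≤ r / 2 := by
    have h1 : ∀ᶠ η in 𝓝[>] (0 : ℝ), η ≤ b - τ := nhdsWithin_le_nhds (Iic_mem_nhds (by linarith))
    have hc0 : Filter.Tendsto (fun η : ℝ => (C : ℝ) * η) (𝓝[>] 0) (𝓝 0) := by
      have : Continuous fun η : ℝ => (C : ℝ) * η := by fun_prop
      simpa using (this.tendsto 0).mono_left nhdsWithin_le_nhds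
    filter_upwards [h1, self_mem_nhdsWithin, hc0.eventually (gt_mem_nhds one_pos),
      hc0.eventually (ge_mem_nhds (half_pos hr))] with η h1 h2 h3 h4
    exact ⟨h2, by linarith, h3, h4⟩
  have hex : ∀ η : ℝ, ∃ ξ : ℝ → Q, (0 < η ∧ τ + η ≤ b ∧ (C : ℝ) * η < 1 ∧ (C : ℝ) * η ≤ r / 2) →
      Continuous ξ ∧ (∀ s, ξ s ∈ Metric.closedBall q₀ r) ∧ ξ (τ + η) = x (τ + η) ∧
        IsLocalTrajectory Ω U F τ (τ + η) ξ (fun _ => v) := by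
    intro η
    by_cases hη : 0 < η ∧ τ + η ≤ b ∧ (C : ℝ) * η < 1 ∧ (C : ℝ) * η ≤ r / 2
    · obtain ⟨ξ, h⟩ := exists_local_trajectory hF hB isCompact_singleton
        (singleton_subset_iff.2 hv) hC (a := τ) (b := τ + η) (w := fun _ => v)
        (by rw [add_sub_cancel_left]; exact hη.2.2.1)
        (by rw [add_sub_cancel_left]; exact hη.2.2.2) aemeasurable_const (fun _ _ => rfl)
        (right_mem_Icc.2 (by linarith [hη.1]))
        (Metric.ball_subset_closedBall (hxB (τ + η) ⟨by linarith [hη.1], hη.2.1⟩))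
      exact ⟨ξ, fun _ => h⟩
    · exact ⟨0, fun h => absurd h hη⟩
  choose ξ hξ using hex
  have hxcont : Filter.Tendsto (fun η => x (τ + η)) (𝓝[>] 0) (𝓝 (x τ)) := by
    have h1 : Filter.Tendsto (fun η : ℝ => τ + η) (𝓝[>] 0) (𝓝 τ) := by
      have : Continuous fun η : ℝ => τ + η := by fun_prop
      simpa using (this.tendsto 0).mono_left nhdsWithin_le_nhds
    exact hdx.continuousAt.tendsto.comp h1
  have hξρ : ∀ ρ > 0, ∀ᶠ η in 𝓝[>] (0 : ℝ), ContinuousOn (ξ η) (Icc τ (τ + η)) ∧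
      ∀ s ∈ Icc τ (τ + η), ξ η s ∈ Ω ∧ ‖ξ η s - x τ‖ < ρ := by
    intro ρ hρ
    have hc0 : Filter.Tendsto (fun η : ℝ => (C : ℝ) * η) (𝓝[>] 0) (𝓝 0) := by
      have : Continuous fun η : ℝ => (C : ℝ) * η := by fun_prop
      simpa using (this.tendsto 0).mono_left nhdsWithin_le_nhds
    filter_upwards [hsmall, hc0.eventually (gt_mem_nhds (half_pos hρ)),
      Metric.tendsto_nhds.1 hxcont (ρ / 2) (half_pos hρ)] with η hη h1 h2
    obtain ⟨hξc, hξB, hξe, hξt⟩ := hξ η hη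
    refine ⟨hξc.continuousOn, fun s hs => ⟨hB (hξB s), ?_⟩⟩
    have hle : τ ≤ τ + η := by linarith [hη.1]
    have h3 := hξt.eq (τ + η) (right_mem_Icc.2 hle) s hs
    have h4 := intervalIntegral.norm_integral_le_of_norm_le_const (a := τ + η) (b := s)
      (f := fun y => F (ξ η y) v) (C := C) (fun y _ => (hC v rfl _ (hξB y)).1)
    rw [← h3, hξe] at h4
    have h5 : |s - (τ + η)| ≤ η := by
      rw [abs_le]; constructor <;> linarith [hs.1, hs.2, hη.1]
    have h6 : (C : ℝ) * |s - (τ + η)| ≤ C * η := by gcongr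
    rw [dist_eq_norm] at h2
    calc ‖ξ η s - x τ‖ = ‖(ξ η s - x (τ + η)) + (x (τ + η) - x τ)‖ := by congr 1; abel
      _ ≤ ‖ξ η s - x (τ + η)‖ + ‖x (τ + η) - x τ‖ := norm_add_le _ _
      _ < ρ := by linarith
  have hFv : ContinuousOn (fun q => F q v) Ω :=
    fun q hq => (hF.diff v hv q hq).continuousAt.continuousWithinAt
  have hLv : ContinuousOn (fun q => L q v) Ω :=
    fun q hq => (hL.diff v hv q hq).continuousAt.continuousWithinAt
  have hFavg := tendsto_average_of_tendsto hFv hΩ (hx.mem τ hτ) hξρ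
  have hLavg := tendsto_average_of_tendsto hLv hΩ (hx.mem τ hτ) hξρ
  have hxslope : Filter.Tendsto (fun η : ℝ => η⁻¹ • (x (τ + η) - x τ)) (𝓝[>] 0)
      (𝓝 (F (x τ) (u τ))) := hdx.tendsto_slope_zero_right
  have hLslope : Filter.Tendsto (fun η : ℝ => η⁻¹ • ((∫ s in a..τ + η, L (x s) (u s)) -
      ∫ s in a..τ, L (x s) (u s))) (𝓝[>] 0) (𝓝 (L (x τ) (u τ))) := hdL.tendsto_slope_zero_right
  have hζ : Filter.Tendsto (fun η : ℝ => η⁻¹ • (ξ η τ - x τ)) (𝓝[>] 0)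
      (𝓝 (F (x τ) (u τ) - F (x τ) v)) := by
    refine (hxslope.sub hFavg).congr' ?_
    filter_upwards [hsmall] with η hη
    obtain ⟨hξc, hξB, hξe, hξt⟩ := hξ η hη
    have hle : τ ≤ τ + η := by linarith [hη.1]
    have := hξt.eq τ (left_mem_Icc.2 hle) (τ + η) (right_mem_Icc.2 hle)
    rw [← this, hξe, ← smul_sub]
    congr 1; abel
  have hζ0 : Filter.Tendsto (fun η : ℝ => ξ η τ) (𝓝[>] 0) (𝓝 (x τ)) := by
    rw [Metric.tendsto_nhds]
    intro ρ hρ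
    filter_upwards [hξρ ρ hρ, hsmall] with η hη hs
    rw [dist_eq_norm]
    exact (hη.2 τ (left_mem_Icc.2 (by linarith [hs.1]))).2
  have hlim : Filter.Tendsto (fun η : ℝ => η⁻¹ • (g (ξ η τ) - g (x τ))) (𝓝[>] 0)
      (𝓝 ((-p τ) (F (x τ) (u τ) - F (x τ) v))) := by
    have h0 : Filter.Tendsto (fun η : ℝ => ξ η τ - x τ) (𝓝[>] 0) (𝓝 0) := by
      simpa using hζ0.sub_const (x τ)
    have := hgd.hasFDerivWithinAt (s := univ) |>.lim h0 (Filter.Eventually.of_forall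
      fun _ => mem_univ _) hζ
    simpa only [add_sub_cancel] using this
  -- The inequality for the needle of length `η` is divided by `η` before passing to the limit. The
  -- common cost after `τ + η` has cancelled.
  have hle := le_of_tendsto_of_tendsto hlim (hLavg.sub hLslope) (by
    filter_upwards [hsmall, hζ0.eventually hgR] with η hη hgη
    obtain ⟨hξc, hξB, hξe, hξt⟩ := hξ η hη
    have hle : τ ≤ τ + η := by linarith [hη.1]
    have hR1 := hR (τ + η) b x u c (by linarith) hη.2.1 le_rfl (hx.mono (by linarith) le_rfl) hRx
    rw [← hξe] at hR1
    have hR2 := hR τ (τ + η) (ξ η) (fun _ => v) _ haτ hle hη.2.1 hξt hR1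
    have h1 := hgη _ hR2
    have h2 := integral_sub_eq_integral_of_mem_Icc hLint (left_mem_Icc.2 hab) hτ
      (show τ + η ∈ Icc a b from ⟨by linarith, hη.2.1⟩)
    have h3 := intervalIntegral.integral_add_adjacent_intervals
      (hLint.mono_set (c := τ) (d := τ + η) (by
        rw [uIcc_of_le hab, uIcc_of_le hle]; exact Icc_subset_Icc haτ hη.2.1))
      (hLint.mono_set (c := τ + η) (d := b) (by
        rw [uIcc_of_le hab, uIcc_of_le hη.2.1]; exact Icc_subset_Icc_left (by linarith)))
    simp only [smul_eq_mul, ← mul_sub]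
    have h4 : 0 ≤ η⁻¹ := inv_nonneg.2 hη.1.le
    refine mul_le_mul_of_nonneg_left ?_ h4
    rw [hgx, h2]
    linarith)
  simp only [neg_apply, map_sub] at hle
  linarith

/-! ### Hamiltonian vector fields in coordinates and the maximality condition -/

/-- The map `w ↦ ω(w, ·)` given by the canonical symplectic form on `Q × Q*`. -/
def symplecticMap (Q : Type*) [NormedAddCommGroup Q] [NormedSpace ℝ Q] :
    (Q × (Q →L[ℝ] ℝ)) →ₗ[ℝ] ((Q × (Q →L[ℝ] ℝ)) →L[ℝ] ℝ) where
  toFun w := (ContinuousLinearMap.apply ℝ ℝ w.1).comp (ContinuousLinearMap.snd ℝ _ _) -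
    w.2.comp (ContinuousLinearMap.fst ℝ _ _)
  map_add' w w' := by
    ext ξ <;> (simp; try ring)
  map_smul' c w := by
    ext ξ <;> simp

theorem symplecticMap_apply (w ξ : Q × (Q →L[ℝ] ℝ)) :
    symplecticMap Q w ξ = ξ.2 w.1 - w.2 ξ.1 := rfl

theorem injective_symplecticMap : Function.Injective (symplecticMap Q) := by
  rw [injective_iff_map_eq_zero]
  intro w hw
  have h1 : ∀ ξ : Q × (Q →L[ℝ] ℝ), ξ.2 w.1 - w.2 ξ.1 = 0 := fun ξ => by
    rw [← symplecticMap_apply, hw]; rfl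
  refine Prod.ext ?_ ?_
  · by_contra hne
    obtain ⟨f, -, hf⟩ := exists_dual_vector ℝ w.1 (norm_ne_zero_iff.2 hne)
    have := h1 (0, f)
    simp only [map_zero, sub_zero] at this
    rw [this] at hf
    exact hne (norm_eq_zero.1 (by simpa using hf.symm))
  · ext q
    have := h1 (q, 0)
    simpa using this

theorem exists_continuousLinearMap_leftInverse {V V' : Type*} [NormedAddCommGroup V]
    [NormedSpace ℝ V] [FiniteDimensional ℝ V] [NormedAddCommGroup V'] [NormedSpace ℝ V']
    [FiniteDimensional ℝ V'] (f : V →ₗ[ℝ] V') (hf : Function.Injective f) :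
    ∃ G : V' →L[ℝ] V, ∀ w, G (f w) = w := by
  obtain ⟨G, hG⟩ := LinearMap.exists_leftInverse_of_injective f (LinearMap.ker_eq_bot.2 hf)
  exact ⟨LinearMap.toContinuousLinearMap G, fun w => LinearMap.congr_fun hG w⟩

/-- Nondegeneracy is needed only in this form: a solution `w` of `ω(w, ·) = dH` is always at hand
when the Hamiltonian field is evaluated, and a continuous linear left inverse makes that field `C¹`
for `H` of class `C²`. -/
theorem exists_symplecticMap_leftInverse [FiniteDimensional ℝ Q] :
    ∃ G : ((Q × (Q →L[ℝ] ℝ)) →L[ℝ] ℝ) →L[ℝ] (Q × (Q →L[ℝ] ℝ)),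
      ∀ w, G (symplecticMap Q w) = w :=
  exists_continuousLinearMap_leftInverse (V := Q × (Q →L[ℝ] ℝ))
    (V' := (Q × (Q →L[ℝ] ℝ)) →L[ℝ] ℝ) (symplecticMap Q) injective_symplecticMap

/-- The Hamiltonian vector field of `H` on `Q × Q*`. -/
def hamiltonianField [FiniteDimensional ℝ Q] (H : Q × (Q →L[ℝ] ℝ) → ℝ) (ζ : Q × (Q →L[ℝ] ℝ)) :
    Q × (Q →L[ℝ] ℝ) :=
  (exists_symplecticMap_leftInverse (Q := Q)).choose (fderiv ℝ H ζ)

theorem hamiltonianField_eq [FiniteDimensional ℝ Q] {H : Q × (Q →L[ℝ] ℝ) → ℝ}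
    {ζ w : Q × (Q →L[ℝ] ℝ)} (h : ∀ ξ, fderiv ℝ H ζ ξ = ξ.2 w.1 - w.2 ξ.1) :
    hamiltonianField H ζ = w := by
  have e : fderiv ℝ H ζ = symplecticMap Q w := ContinuousLinearMap.ext h
  rw [hamiltonianField, e]
  exact (exists_symplecticMap_leftInverse (Q := Q)).choose_spec w

theorem contDiffOn_hamiltonianField [FiniteDimensional ℝ Q] {H : Q × (Q →L[ℝ] ℝ) → ℝ}
    {S : Set (Q × (Q →L[ℝ] ℝ))} (hS : IsOpen S) (hH : ContDiffOn ℝ 2 H S) :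
    ContDiffOn ℝ 1 (hamiltonianField H) S :=
  (ContinuousLinearMap.contDiff _).comp_contDiffOn
    (hH.fderiv_of_isOpen hS (m := 1) (by norm_num))

theorem hasDerivWithinAt_of_sub_eq_integral {V : Type*} [NormedAddCommGroup V] [NormedSpace ℝ V]
    [CompleteSpace V] {y f : ℝ → V} {a b : ℝ} (hab : a ≤ b) (hf : ContinuousOn f (Icc a b))
    (hy : ∀ s ∈ Icc a b, ∀ t ∈ Icc a b, y t - y s = ∫ τ in s..t, f τ) {t : ℝ}
    (ht : t ∈ Icc a b) : HasDerivWithinAt y (f t) (Icc a b) t := by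
  -- The constant continuation makes the integrand continuous on `ℝ`, so the fundamental theorem of
  -- calculus also covers the end points.
  have hc : Continuous (IccExtend hab ((Icc a b).domRestrict f)) :=
    (continuousOn_iff_continuous_domRestrict.1 hf).Icc_extend'
  have he : ∀ s ∈ Icc a b, IccExtend hab ((Icc a b).domRestrict f) s = f s := fun s hs => by
    rw [IccExtend_of_mem _ _ hs]; rfl
  have hd := (hc.integral_hasStrictDerivAt a t).hasDerivAt
  rw [he t ht] at hd
  refine (hd.const_add (y a)).hasDerivWithinAt.congr (fun s hs => ?_) ?_
  · rw [← sub_eq_iff_eq_add', hy a (left_mem_Icc.2 hab) s hs]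
    refine intervalIntegral.integral_congr fun τ hτ => ?_
    rw [uIcc_of_le hs.1] at hτ
    exact (he τ ⟨hτ.1, hτ.2.trans hs.2⟩).symm
  · rw [← sub_eq_iff_eq_add', hy a (left_mem_Icc.2 hab) t ht]
    refine intervalIntegral.integral_congr fun τ hτ => ?_
    rw [uIcc_of_le ht.1] at hτ
    exact (he τ ⟨hτ.1, hτ.2.trans ht.2⟩).symm

/-- An extremal with the maximality property is a trajectory of the Hamiltonian vector field of the
maximized Hamiltonian. -/
theorem hasDerivWithinAt_of_maximality [FiniteDimensional ℝ Q] (hΩ : IsOpen Ω) (hU : IsClosed U)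
    (hF : IsC1Family Ω U F) (hL : IsC1Family Ω U L) {H : Q × (Q →L[ℝ] ℝ) → ℝ}
    (hH : ContDiffOn ℝ 2 H (Ω ×ˢ univ))
    (hHle : ∀ q ∈ Ω, ∀ p, ∀ v ∈ U, p (F q v) - L q v ≤ H (q, p))
    (hHex : ∀ q ∈ Ω, ∀ p, ∃ v ∈ U, H (q, p) = p (F q v) - L q v)
    {a b : ℝ} (hab : a ≤ b) {x : ℝ → Q} {u : ℝ → W} (hx : IsLocalTrajectory Ω U F a b x u)
    {p : ℝ → Q →L[ℝ] ℝ} (hp : Continuous p)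
    (hpint : IntervalIntegrable (fun s => fderiv ℝ (fun q => L q (u s)) (x s) -
        (p s).comp (fderiv ℝ (fun q => F q (u s)) (x s))) volume a b)
    (hpeq : ∀ s ∈ Icc a b, ∀ t ∈ Icc a b, p t - p s = ∫ τ in s..t,
        (fderiv ℝ (fun q => L q (u τ)) (x τ) -
          (p τ).comp (fderiv ℝ (fun q => F q (u τ)) (x τ))))
    (hmax : ∀ᵐ t, t ∈ Icc a b → ∀ v ∈ U,
      p t (F (x t) v) - L (x t) v ≤ p t (F (x t) (u t)) - L (x t) (u t)) {t : ℝ}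
    (ht : t ∈ Icc a b) :
    HasDerivWithinAt (fun s => (x s, p s)) (hamiltonianField H (x t, p t)) (Icc a b) t := by
  have hS : IsOpen (Ω ×ˢ (univ : Set (Q →L[ℝ] ℝ))) := hΩ.prod isOpen_univ
  have hHd : ∀ q ∈ Ω, ∀ p, HasFDerivAt H (fderiv ℝ H (q, p)) (q, p) := fun q hq p =>
    ((hH.contDiffAt (hS.mem_nhds ⟨hq, mem_univ _⟩)).differentiableAt (by norm_num)).hasFDerivAt
  have hfield : ContinuousOn (fun s => hamiltonianField H (x s, p s)) (Icc a b) :=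
    (contDiffOn_hamiltonianField hS hH).continuousOn.comp (hx.cont.prodMk hp.continuousOn)
      fun s hs => ⟨hx.mem s hs, mem_univ _⟩
  have hae : ∀ᵐ t, t ∈ Icc a b → hamiltonianField H (x t, p t) = (F (x t) (u t),
      fderiv ℝ (fun q => L q (u t)) (x t) -
        (p t).comp (fderiv ℝ (fun q => F q (u t)) (x t))) := by
    filter_upwards [hmax] with t hm ht
    refine hamiltonianField_eq fun ξ => ?_
    have hu := hx.memU t ht
    have hxt := hx.mem t ht
    have d1 : HasFDerivAt (fun ζ : Q × (Q →L[ℝ] ℝ) => F ζ.1 (u t))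
        ((fderiv ℝ (fun q => F q (u t)) (x t)).comp (ContinuousLinearMap.fst ℝ _ _)) (x t, p t) :=
      HasFDerivAt.comp (g := fun q => F q (u t)) (x t, p t) (hF.diff _ hu _ hxt).hasFDerivAt
        hasFDerivAt_fst
    have d2 : HasFDerivAt (fun ζ : Q × (Q →L[ℝ] ℝ) => L ζ.1 (u t))
        ((fderiv ℝ (fun q => L q (u t)) (x t)).comp (ContinuousLinearMap.fst ℝ _ _)) (x t, p t) :=
      HasFDerivAt.comp (g := fun q => L q (u t)) (x t, p t) (hL.diff _ hu _ hxt).hasFDerivAt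
        hasFDerivAt_fst
    have d3 := ((hHd _ hxt (p t)).sub (((hasFDerivAt_snd (p := (x t, p t))).clm_apply d1).sub d2))
    -- With the control frozen at `u t`, this difference is nonnegative near `(x t, p t)` and, by
    -- maximality, minimal there. Its differential vanishes, which computes `dH` without any
    -- regularity of the maximizing control.
    have hmin : IsLocalMin (H - ((fun ζ : Q × (Q →L[ℝ] ℝ) => ζ.2 (F ζ.1 (u t))) -
        fun ζ => L ζ.1 (u t))) (x t, p t) := by
      filter_upwards [hS.mem_nhds (show (x t, p t) ∈ Ω ×ˢ (univ : Set (Q →L[ℝ] ℝ)) from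
        ⟨hxt, mem_univ _⟩)] with ζ hζ
      obtain ⟨v, hv, e⟩ := hHex _ hxt (p t)
      have h1 := hm ht v hv
      have h2 := hHle ζ.1 hζ.1 ζ.2 _ hu
      simp only [Pi.sub_apply]
      rw [e]
      have h3 : H ζ = H (ζ.1, ζ.2) := rfl
      linarith
    have h0 := hmin.hasFDerivAt_eq_zero d3
    have h1 := DFunLike.congr_fun h0 ξ
    simp only [sub_apply, add_apply, ContinuousLinearMap.comp_apply,
      ContinuousLinearMap.flip_apply, ContinuousLinearMap.coe_fst',
      ContinuousLinearMap.coe_snd', zero_apply] at h1 ⊢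
    linarith
  -- The velocity is known only at a.e. time. The integral equation together with the continuity of
  -- the Hamiltonian field along the curve gives the derivative at every time.
  refine hasDerivWithinAt_of_sub_eq_integral hab hfield (fun s hs t ht => ?_) ht
  have hFint := hx.intervalIntegrable (H := F) hU hF.cont hab
  have hsub : ∀ {V : Type _} [NormedAddCommGroup V] [NormedSpace ℝ V] {f : ℝ → V},
      IntervalIntegrable f volume a b → IntervalIntegrable f volume s t := fun hf =>
    hf.mono_set (by rw [uIcc_of_le hab]; exact uIcc_subset_Icc hs ht)
  have e : ∫ τ in s..t, hamiltonianField H (x τ, p τ) = ∫ τ in s..t, (F (x τ) (u τ),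
      fderiv ℝ (fun q => L q (u τ)) (x τ) -
        (p τ).comp (fderiv ℝ (fun q => F q (u τ)) (x τ))) := by
    refine intervalIntegral.integral_congr_ae ?_
    filter_upwards [hae] with τ h hτ
    exact h (uIcc_subset_Icc hs ht (uIoc_subset_uIcc hτ))
  rw [e]
  refine Prod.ext ?_ ?_
  · rw [Prod.fst_sub, hx.eq s hs t ht]
    have := (ContinuousLinearMap.fst ℝ Q (Q →L[ℝ] ℝ)).intervalIntegral_comp_comm
      (f := fun τ => (F (x τ) (u τ), fderiv ℝ (fun q => L q (u τ)) (x τ) -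
        (p τ).comp (fderiv ℝ (fun q => F q (u τ)) (x τ))))
      ⟨(hsub hFint).1.prodMk (hsub hpint).1, (hsub hFint).2.prodMk (hsub hpint).2⟩
    simpa using this
  · rw [Prod.snd_sub, hpeq s hs t ht]
    have := (ContinuousLinearMap.snd ℝ Q (Q →L[ℝ] ℝ)).intervalIntegral_comp_comm
      (f := fun τ => (F (x τ) (u τ), fderiv ℝ (fun q => L q (u τ)) (x τ) -
        (p τ).comp (fderiv ℝ (fun q => F q (u τ)) (x τ))))
      ⟨(hsub hFint).1.prodMk (hsub hpint).1, (hsub hFint).2.prodMk (hsub hpint).2⟩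
    simpa using this

/-- Local uniqueness to the right for a locally Lipschitz vector field. -/
theorem exists_eqOn_Icc_of_hasDerivWithinAt {Y : Type*} [NormedAddCommGroup Y] [NormedSpace ℝ Y]
    {v : Y → Y} {y z : ℝ → Y} {t b : ℝ} (htb : t < b) (hv : ContDiffAt ℝ 1 v (y t))
    (hy : ∀ s ∈ Ico t b, HasDerivWithinAt y (v (y s)) (Ici s) s)
    (hz : ∀ s ∈ Ico t b, HasDerivWithinAt z (v (z s)) (Ici s) s)
    (hyc : ContinuousOn y (Icc t b)) (hzc : ContinuousOn z (Icc t b)) (h : y t = z t) :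
    ∃ c, t < c ∧ c ≤ b ∧ ∀ s ∈ Icc t c, y s = z s := by
  obtain ⟨K, S, hS, hK⟩ := hv.exists_lipschitzOnWith
  have h1 : ∀ᶠ s in 𝓝[Icc t b] t, y s ∈ S := hyc t (left_mem_Icc.2 htb.le) hS
  have h2 : ∀ᶠ s in 𝓝[Icc t b] t, z s ∈ S := hzc t (left_mem_Icc.2 htb.le) (h ▸ hS)
  rw [nhdsWithin_Icc_eq_nhdsGE htb] at h1 h2
  obtain ⟨c, hc, hcS⟩ := mem_nhdsGE_iff_exists_Icc_subset.1 (h1.and h2)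
  have hc' : t < c := hc
  have hm : min c b ≤ b := min_le_right _ _
  refine ⟨min c b, lt_min hc' htb, hm, ?_⟩
  have hsub : Icc t (min c b) ⊆ Icc t b := Icc_subset_Icc_right hm
  exact ODE_solution_unique_of_mem_Icc_right (v := fun _ => v) (s := fun _ => S) (K := K)
    (fun _ _ => hK) (hyc.mono hsub)
    (fun s hs => hy s ⟨hs.1, hs.2.trans_le hm⟩)
    (fun s hs => (hcS ⟨hs.1, (hs.2.trans_le (min_le_left _ _)).le⟩).1)
    (hzc.mono hsub) (fun s hs => hz s ⟨hs.1, hs.2.trans_le hm⟩)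
    (fun s hs => (hcS ⟨hs.1, (hs.2.trans_le (min_le_left _ _)).le⟩).2) h

end MaximumPrinciple

/-! ### Control systems in charts -/

section Charts

variable {n m : ℕ} {M : Type*} [TopologicalSpace M] [ChartedSpace (E n) M]
  [IsManifold (𝓡 n) ∞ M] {U : Set (E m)} {F : (x : M) → E m → TangentSpace (𝓡 n) x}
  {L : M → E m → ℝ}

theorem localRep_apply (F : (x : M) → E m → TangentSpace (𝓡 n) x) {x₀ x : M}
    (hx : x ∈ (chartAt (E n) x₀).source) (w : E m) :
    localRep F x₀ (extChartAt (𝓡 n) x₀ x) w =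
      (trivializationAt (E n) (TangentSpace (𝓡 n)) x₀).continuousLinearMapAt ℝ x (F x w) := by
  have h : (extChartAt (𝓡 n) x₀).symm (extChartAt (𝓡 n) x₀ x) = x :=
    (extChartAt (𝓡 n) x₀).left_inv (by rwa [extChartAt_source])
  rw [localRep, h]
  rw [Bundle.Trivialization.continuousLinearMapAt_apply, Bundle.Trivialization.linearMapAt_apply,
    if_pos (by simpa using hx)]

theorem isC1Family_localRep (hF : IsControlSystem U F) (x₀ : M) :
    IsC1Family (extChartAt (𝓡 n) x₀).target U (localRep F x₀) where
  cont := (hF.lipschitz x₀).continuousOn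
  diff w hw q hq := by
    have h1 : ContMDiffOn (𝓡 n) 𝓘(ℝ, E n) ∞ (fun x : M =>
        (trivializationAt (E n) (TangentSpace (𝓡 n) : M → Type) x₀ ⟨x, F x w⟩).2)
        (chartAt (E n) x₀).source := by
      have := (Bundle.Trivialization.contMDiffOn_section_baseSet_iff (IB := 𝓡 n) (n := ∞)
        (trivializationAt (E n) (TangentSpace (𝓡 n) : M → Type) x₀) (s := fun x => F x w)).1
        (hF.smooth w hw).contMDiffOn
      simpa using this
    have h2 : ContMDiffOn 𝓘(ℝ, E n) 𝓘(ℝ, E n) ∞ (fun q => localRep F x₀ q w)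
        (extChartAt (𝓡 n) x₀).target :=
      h1.comp (contMDiffOn_extChartAt_symm x₀) fun q hq => by
        have := (extChartAt (𝓡 n) x₀).map_target hq
        rwa [extChartAt_source] at this
    exact ((h2.contDiffOn.contDiffAt ((isOpen_extChartAt_target x₀).mem_nhds hq)).differentiableAt
      (by simp))
  cont_fderiv := hF.continuous_deriv x₀

/-- Since `U` is arbitrary, derivatives within `Ω ×ˢ U` need not be unique. Their restriction to the
first factor is, because every slice `Ω` is open; so the partial derivative inherits continuity from
any local choice of derivative. -/
theorem isC1Family_of_contDiffOn {Q W V : Type*} [NormedAddCommGroup Q] [NormedSpace ℝ Q]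
    [NormedAddCommGroup W] [NormedSpace ℝ W] [NormedAddCommGroup V] [NormedSpace ℝ V]
    {Ω : Set Q} {U : Set W} {G : Q → W → V} (hΩ : IsOpen Ω)
    (hG : ContDiffOn ℝ 1 (fun p : Q × W => G p.1 p.2) (Ω ×ˢ U)) : IsC1Family Ω U G := by
  have key : ∀ z ∈ Ω ×ˢ U, ∃ f' : Q × W → Q × W →L[ℝ] V, ContinuousWithinAt f' (Ω ×ˢ U) z ∧
      ∀ᶠ y in 𝓝[Ω ×ˢ U] z, HasFDerivAt (fun q => G q y.2)
        ((f' y).comp (ContinuousLinearMap.inl ℝ Q W)) y.1 := by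
    intro z hz
    obtain ⟨u, hu, hus, -, f', hf', hcont⟩ :=
      (contDiffWithinAt_succ_iff_hasFDerivWithinAt' (n := 0) (by simp)).1 (hG z hz)
    rw [insert_eq_of_mem hz] at hu hus
    refine ⟨f', hcont.continuousWithinAt, ?_⟩
    filter_upwards [eventually_mem_nhdsWithin, eventually_eventually_nhdsWithin.2 hu] with y hy hyu
    have hy' : y ∈ u := mem_of_mem_nhdsWithin hy hyu
    have h1 : HasFDerivWithinAt (fun q => G q y.2)
        ((f' y).comp (ContinuousLinearMap.inl ℝ Q W)) {q | (q, y.2) ∈ Ω ×ˢ U} y.1 :=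
      HasFDerivWithinAt.comp (g := fun p : Q × W => G p.1 p.2) (f := fun q : Q => (q, y.2))
        (t := Ω ×ˢ U) y.1 (hf' y hy') (hasFDerivAt_prodMk_left y.1 y.2).hasFDerivWithinAt
        (fun q hq => hq)
    refine h1.hasFDerivAt ?_
    filter_upwards [hΩ.mem_nhds hy.1] with q hq using ⟨hq, hy.2⟩
  refine ⟨hG.continuousOn, fun w hw q hq => ?_, fun z hz => ?_⟩
  · obtain ⟨f', -, h⟩ := key (q, w) ⟨hq, hw⟩
    exact (h.self_of_nhdsWithin ⟨hq, hw⟩).differentiableAt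
  · obtain ⟨f', hf', h⟩ := key z hz
    have h2 : ContinuousWithinAt (fun y => (f' y).comp (ContinuousLinearMap.inl ℝ Q W))
        (Ω ×ˢ U) z := hf'.clm_comp continuousWithinAt_const
    refine h2.congr_of_eventuallyEq (h.mono fun y hy => hy.fderiv) ?_
    exact (h.self_of_nhdsWithin hz).fderiv

theorem isC1Family_lagrangian (hL : IsSmoothLagrangian n U L) (x₀ : M) :
    IsC1Family (extChartAt (𝓡 n) x₀).target U
      (fun q w => L ((extChartAt (𝓡 n) x₀).symm q) w) := by
  refine isC1Family_of_contDiffOn (isOpen_extChartAt_target x₀) ?_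
  have h1 : ContMDiffOn (𝓘(ℝ, E n).prod (𝓡 m)) ((𝓡 n).prod (𝓡 m)) ∞
      (fun p : E n × E m => ((extChartAt (𝓡 n) x₀).symm p.1, p.2))
      ((extChartAt (𝓡 n) x₀).target ×ˢ U) :=
    ((contMDiffOn_extChartAt_symm x₀).comp contMDiffOn_fst fun p hp => hp.1).prodMk contMDiffOn_snd
  have h2 := hL.comp h1 (fun p hp => ⟨mem_univ _, hp.2⟩)
  rw [← modelWithCornersSelf_prod, chartedSpaceSelf_prod] at h2
  exact (contMDiffOn_iff_contDiffOn.1 h2).of_le (by simp)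

end Charts

/-! ### Admissible pairs on subintervals -/

section Admissible

variable {n m : ℕ} {M : Type*} [TopologicalSpace M] [ChartedSpace (E n) M]

/-- The curve `x` is Lipschitz on `T` near `t₀`, in the chart around `x t₀`. -/
def IsChartLipschitzAt (n : ℕ) {M : Type*} [TopologicalSpace M] [ChartedSpace (E n) M]
    (x : ℝ → M) (T : Set ℝ) (t₀ : ℝ) : Prop :=
  ∃ K : ℝ≥0, ∃ S ∈ 𝓝[T] t₀, MapsTo x S (chartAt (E n) (x t₀)).source ∧
    LipschitzOnWith K (fun t => extChartAt (𝓡 n) (x t₀) (x t)) S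

theorem IsChartLipschitzAt.congr {x x' : ℝ → M} {T T' : Set ℝ} {t₀ : ℝ}
    (h : IsChartLipschitzAt n x T t₀) (ht₀ : t₀ ∈ T) (hT : T ∈ 𝓝[T'] t₀) (hx : EqOn x' x T) :
    IsChartLipschitzAt n x' T' t₀ := by
  obtain ⟨K, S, hS, hm, hl⟩ := h
  refine ⟨K, S ∩ T, Filter.inter_mem ?_ hT, ?_, ?_⟩
  · exact nhdsWithin_le_of_mem hT hS
  · intro t ht
    rw [hx ht.2, hx ht₀]
    exact hm ht.1
  · rw [hx ht₀]
    intro s hs t ht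
    simp only [hx hs.2, hx ht.2]
    exact hl hs.1 ht.1

theorem IsChartLipschitzAt.union {x : ℝ → M} {a b c : ℝ} (hab : a ≤ b) (hbc : b ≤ c)
    (h : IsChartLipschitzAt n x (Icc a b) b) (h' : IsChartLipschitzAt n x (Icc b c) b) :
    IsChartLipschitzAt n x (Icc a c) b := by
  obtain ⟨K, S, hS, hm, hl⟩ := h
  obtain ⟨K', S', hS', hm', hl'⟩ := h'
  have hbS : b ∈ S := mem_of_mem_nhdsWithin (right_mem_Icc.2 hab) hS
  have hbS' : b ∈ S' := mem_of_mem_nhdsWithin (left_mem_Icc.2 hbc) hS'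
  have hl1 : LipschitzOnWith (max K K') (fun t => extChartAt (𝓡 n) (x b) (x t)) (S ∩ Iic b) :=
    (hl.mono inter_subset_left).weaken (le_max_left _ _)
  have hl2 : LipschitzOnWith (max K K') (fun t => extChartAt (𝓡 n) (x b) (x t)) (S' ∩ Ici b) :=
    (hl'.mono inter_subset_left).weaken (le_max_right _ _)
  refine ⟨max K K', (S ∩ Iic b) ∪ (S' ∩ Ici b), ?_, ?_, ?_⟩
  · rw [← Icc_union_Icc_eq_Icc hab hbc, nhdsWithin_union]
    refine Filter.mem_sup.2 ⟨?_, ?_⟩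
    · filter_upwards [hS, self_mem_nhdsWithin] with t h1 h2 using Or.inl ⟨h1, h2.2⟩
    · filter_upwards [hS', self_mem_nhdsWithin] with t h1 h2 using Or.inr ⟨h1, h2.1⟩
  · rintro t (ht | ht)
    · exact hm ht.1
    · exact hm' ht.1
  -- For points on opposite sides of `b`, the triangle inequality through `b` loses nothing, as `|s
  -- - t| = |s - b| + |b - t|`.
  · have key : ∀ s ∈ S ∩ Iic b, ∀ t ∈ S' ∩ Ici b,
        dist (extChartAt (𝓡 n) (x b) (x s)) (extChartAt (𝓡 n) (x b) (x t)) ≤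
          (max K K' : ℝ≥0) * dist s t := by
      intro s hs t ht
      have h1 := hl1.dist_le_mul s hs b ⟨hbS, self_mem_Iic⟩
      have h2 := hl2.dist_le_mul b ⟨hbS', self_mem_Ici⟩ t ht
      have h3 := dist_triangle (extChartAt (𝓡 n) (x b) (x s)) (extChartAt (𝓡 n) (x b) (x b))
        (extChartAt (𝓡 n) (x b) (x t))
      have h4 : dist s t = dist s b + dist b t := by
        have hsb : s ≤ b := hs.2
        have hbt : b ≤ t := ht.2
        rw [Real.dist_eq, Real.dist_eq, Real.dist_eq, abs_of_nonpos (by linarith),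
          abs_of_nonpos (by linarith), abs_of_nonpos (by linarith)]
        ring
      rw [h4, mul_add]
      linarith
    refine LipschitzOnWith.of_dist_le_mul ?_
    rintro s (hs | hs) t (ht | ht)
    · exact hl1.dist_le_mul s hs t ht
    · exact key s hs t ht
    · rw [dist_comm, dist_comm s]
      exact key t ht s hs
    · exact hl2.dist_le_mul s hs t ht

variable [IsManifold (𝓡 n) ∞ M] {U : Set (E m)} {F : (x : M) → E m → TangentSpace (𝓡 n) x}
  {L : M → E m → ℝ}

/-- `(x, u)` is an admissible pair on the interval `[a, b]`. -/
structure IsAdmissibleOn (U : Set (E m)) (F : (x : M) → E m → TangentSpace (𝓡 n) x) (a b : ℝ)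
    (x : ℝ → M) (u : ℝ → E m) : Prop where
  meas : AEMeasurable u (volume.restrict (Icc a b))
  bdd : Bornology.IsBounded (u '' Icc a b)
  mem : ∀ t ∈ Icc a b, u t ∈ U
  cont : ContinuousOn x (Icc a b)
  lip : ∀ t₀ ∈ Icc a b, IsChartLipschitzAt n x (Icc a b) t₀
  ode : ∀ᵐ t, t ∈ Icc a b →
    HasMFDerivAt 𝓘(ℝ, ℝ) (𝓡 n) x t ((1 : ℝ →L[ℝ] ℝ).smulRight (F (x t) (u t)))

theorem isAdmissibleOn_zero_one_iff {x : ℝ → M} {u : ℝ → E m} :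
    IsAdmissibleOn U F 0 1 x u ↔ IsAdmissiblePair U F x u := by
  constructor
  · intro h
    exact ⟨h.meas, h.bdd, h.mem, ⟨h.cont, h.lip⟩, (ae_restrict_iff' measurableSet_Icc).2 h.ode⟩
  · intro h
    exact ⟨h.measurable, h.bounded, h.mem, h.lipschitz.1, h.lipschitz.2,
      (ae_restrict_iff' measurableSet_Icc).1 h.ode⟩

theorem IsAdmissibleOn.mono {a b a' b' : ℝ} {x : ℝ → M} {u : ℝ → E m}
    (h : IsAdmissibleOn U F a b x u) (ha : a ≤ a') (hb : b' ≤ b) :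
    IsAdmissibleOn U F a' b' x u := by
  have hs : Icc a' b' ⊆ Icc a b := Icc_subset_Icc ha hb
  refine ⟨h.meas.mono_measure (Measure.restrict_mono hs le_rfl), h.bdd.subset (image_mono hs),
    fun t ht => h.mem t (hs ht), h.cont.mono hs, fun t₀ ht₀ => ?_, ?_⟩
  · obtain ⟨K, S, hS, hm, hl⟩ := h.lip t₀ (hs ht₀)
    exact ⟨K, S, nhdsWithin_mono _ hs hS, hm, hl⟩
  · filter_upwards [h.ode] with t h1 h2 using h1 (hs h2)

/-- The two velocities live in tangent spaces at points that are only propositionally equal, so they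
are compared in the model space `E n`. -/
theorem hasMFDerivAt_congr_pair {x x' : ℝ → M} {u u' : ℝ → E m} {t : ℝ} (hx : x' =ᶠ[𝓝 t] x)
    (hu : u' t = u t)
    (h : HasMFDerivAt 𝓘(ℝ, ℝ) (𝓡 n) x t ((1 : ℝ →L[ℝ] ℝ).smulRight (F (x t) (u t)))) :
    HasMFDerivAt 𝓘(ℝ, ℝ) (𝓡 n) x' t ((1 : ℝ →L[ℝ] ℝ).smulRight (F (x' t) (u' t))) := by
  have h1 := h.congr_of_eventuallyEq hx
  have h2 : ((1 : ℝ →L[ℝ] ℝ).smulRight (show E n from F (x' t) (u' t))) =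
      ((1 : ℝ →L[ℝ] ℝ).smulRight (show E n from F (x t) (u t))) := by
    have : ∀ y, y = x t → (show E n from F y (u' t)) = (show E n from F (x t) (u t)) := by
      rintro _ rfl; rw [hu]
    rw [this _ hx.eq_of_nhds]
  exact h1.congr_mfderiv h2.symm

/-- Concatenation of admissible pairs. -/
theorem IsAdmissibleOn.concat {a b c : ℝ} (hab : a ≤ b) (hbc : b ≤ c) {x x' : ℝ → M}
    {u u' : ℝ → E m} (h : IsAdmissibleOn U F a b x u) (h' : IsAdmissibleOn U F b c x' u')
    (hb : x b = x' b) :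
    IsAdmissibleOn U F a c (fun t => if t ≤ b then x t else x' t)
      (fun t => if t ≤ b then u t else u' t) := by
  have hunion : Icc a b ∪ Icc b c = Icc a c := Icc_union_Icc_eq_Icc hab hbc
  have e1 : EqOn (fun t => if t ≤ b then x t else x' t) x (Icc a b) := fun t ht => if_pos ht.2
  have e2 : EqOn (fun t => if t ≤ b then x t else x' t) x' (Icc b c) := fun t ht => by
    rcases ht.1.eq_or_lt with rfl | h
    · simp [hb]
    · exact if_neg (not_le.2 h)
  have hbne : ∀ᵐ t : ℝ, t ≠ b := by simp [ae_iff, measure_singleton]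
  refine ⟨?_, ?_, ?_, ?_, ?_, ?_⟩
  · have h1 : AEMeasurable (fun t => if t ≤ b then u t else u' t) (volume.restrict (Icc a b)) :=
      h.meas.congr ((ae_restrict_iff' measurableSet_Icc).2
        (Filter.Eventually.of_forall fun t ht => (if_pos ht.2).symm))
    have h2 : AEMeasurable (fun t => if t ≤ b then u t else u' t) (volume.restrict (Icc b c)) := by
      refine h'.meas.congr ((ae_restrict_iff' measurableSet_Icc).2 ?_)
      filter_upwards [hbne] with t hne ht
      exact (if_neg (not_le.2 (lt_of_le_of_ne ht.1 (Ne.symm hne)))).symm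
    rw [← hunion]
    exact aemeasurable_union_iff.2 ⟨h1, h2⟩
  · refine (h.bdd.union h'.bdd).subset ?_
    rintro _ ⟨t, ht, rfl⟩
    by_cases htb : t ≤ b
    · exact Or.inl ⟨t, ⟨ht.1, htb⟩, (if_pos htb).symm⟩
    · exact Or.inr ⟨t, ⟨(not_le.1 htb).le, ht.2⟩, (if_neg htb).symm⟩
  · intro t ht
    by_cases htb : t ≤ b
    · simp only [if_pos htb]; exact h.mem t ⟨ht.1, htb⟩
    · simp only [if_neg htb]; exact h'.mem t ⟨(not_le.1 htb).le, ht.2⟩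
  · rw [← hunion]
    exact (h.cont.congr e1).union_of_isClosed (h'.cont.congr e2) isClosed_Icc isClosed_Icc
  · intro t₀ ht₀
    rcases lt_trichotomy t₀ b with hlt | rfl | hgt
    · refine (h.lip t₀ ⟨ht₀.1, hlt.le⟩).congr ⟨ht₀.1, hlt.le⟩ ?_ e1
      filter_upwards [self_mem_nhdsWithin, nhdsWithin_le_nhds (Iio_mem_nhds hlt)] with t h1 h2
      exact ⟨h1.1, le_of_lt h2⟩
    · exact IsChartLipschitzAt.union hab hbc
        ((h.lip t₀ ⟨hab, le_rfl⟩).congr ⟨hab, le_rfl⟩ self_mem_nhdsWithin e1)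
        ((h'.lip t₀ ⟨le_rfl, hbc⟩).congr ⟨le_rfl, hbc⟩ self_mem_nhdsWithin e2)
    · refine (h'.lip t₀ ⟨hgt.le, ht₀.2⟩).congr ⟨hgt.le, ht₀.2⟩ ?_ e2
      filter_upwards [self_mem_nhdsWithin, nhdsWithin_le_nhds (Ioi_mem_nhds hgt)] with t h1 h2
      exact ⟨le_of_lt h2, h1.2⟩
  · filter_upwards [h.ode, h'.ode, hbne] with t h1 h2 h3 ht
    rcases lt_or_gt_of_ne h3 with hlt | hgt
    · refine hasMFDerivAt_congr_pair (u' := fun t => if t ≤ b then u t else u' t) ?_ ?_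
        (h1 ⟨ht.1, hlt.le⟩)
      · filter_upwards [Iio_mem_nhds hlt] with s hs using if_pos (le_of_lt hs)
      · exact if_pos hlt.le
    · refine hasMFDerivAt_congr_pair (u' := fun t => if t ≤ b then u t else u' t) ?_ ?_
        (h2 ⟨hgt.le, ht.2⟩)
      · filter_upwards [Ioi_mem_nhds hgt] with s hs using if_neg (not_le.2 hs)
      · exact if_neg (not_le.2 hgt)

/-! ### Passing between admissible pairs and trajectories in a chart -/

/-- Transition maps are `C¹`, hence locally Lipschitz; the neighbourhood is shrunk so that the curve
stays where this holds. -/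
theorem exists_lipschitzOnWith_of_chart_change {x₀ x₁ : M} {y : ℝ → E n} {T S : Set ℝ} {t₀ : ℝ}
    {K : ℝ≥0} (ht₀ : t₀ ∈ T) (hS : S ∈ 𝓝[T] t₀) (hy : LipschitzOnWith K y S)
    (hy₁ : y t₀ ∈ (extChartAt (𝓡 n) x₁).target)
    (hy₀ : (extChartAt (𝓡 n) x₁).symm (y t₀) ∈ (chartAt (E n) x₀).source) :
    ∃ K' : ℝ≥0, ∃ S' ∈ 𝓝[T] t₀, S' ⊆ S ∧
      (∀ t ∈ S', (extChartAt (𝓡 n) x₁).symm (y t) ∈ (chartAt (E n) x₀).source) ∧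
      LipschitzOnWith K' (fun t => extChartAt (𝓡 n) x₀ ((extChartAt (𝓡 n) x₁).symm (y t))) S' := by
  have hsrc : y t₀ ∈ ((extChartAt (𝓡 n) x₁).symm.trans (extChartAt (𝓡 n) x₀)).source := by
    rw [PartialEquiv.trans_source]
    refine ⟨hy₁, ?_⟩
    rw [mem_preimage, extChartAt_source]
    exact hy₀
  have hcd : ContDiffAt ℝ 1 ((extChartAt (𝓡 n) x₀) ∘ (extChartAt (𝓡 n) x₁).symm) (y t₀) := by
    have := contDiffWithinAt_ext_coord_change (I := 𝓡 n) (n := ∞) x₀ x₁ hsrc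
    rw [ModelWithCorners.range_eq_univ, contDiffWithinAt_univ] at this
    exact this.of_le (by simp)
  obtain ⟨K', B, hB, hK'⟩ := hcd.exists_lipschitzOnWith
  have hcy : ContinuousWithinAt y T t₀ :=
    (hy.continuousOn.continuousWithinAt (mem_of_mem_nhdsWithin ht₀ hS)).mono_of_mem_nhdsWithin hS
  have hsrcn : ∀ᶠ q in 𝓝 (y t₀), (extChartAt (𝓡 n) x₁).symm q ∈ (chartAt (E n) x₀).source :=
    (continuousAt_extChartAt_symm'' hy₁).eventually_mem ((chartAt (E n) x₀).open_source.mem_nhds hy₀)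
  refine ⟨K' * K, {t | t ∈ S ∧ y t ∈ B ∧
    (extChartAt (𝓡 n) x₁).symm (y t) ∈ (chartAt (E n) x₀).source}, ?_, fun t ht => ht.1,
    fun t ht => ht.2.2, ?_⟩
  · filter_upwards [hS, hcy.eventually hB, hcy.eventually hsrcn] with t h1 h2 h3 using ⟨h1, h2, h3⟩
  · exact hK'.comp (hy.mono fun t ht => ht.1) fun t ht => ht.2.1

theorem hasDerivAt_extChartAt_comp {x : ℝ → M} {t : ℝ} {x₀ : M} {w : E m}
    (hx : x t ∈ (chartAt (E n) x₀).source)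
    (h : HasMFDerivAt 𝓘(ℝ, ℝ) (𝓡 n) x t ((1 : ℝ →L[ℝ] ℝ).smulRight (F (x t) w))) :
    HasDerivAt (fun s => extChartAt (𝓡 n) x₀ (x s))
      (localRep F x₀ (extChartAt (𝓡 n) x₀ (x t)) w) t := by
  have h1 := hasMFDerivAt_iff_hasFDerivAt.1
    (HasMFDerivAt.comp t (mdifferentiableAt_extChartAt (I := 𝓡 n) hx).hasMFDerivAt h)
  have h2 := HasFDerivAt.hasDerivAt (f := fun s => extChartAt (𝓡 n) x₀ (x s)) h1
  rw [localRep_apply F hx, TangentBundle.continuousLinearMapAt_trivializationAt hx]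
  have h3 : (mfderiv (𝓡 n) 𝓘(ℝ, E n) (extChartAt (𝓡 n) x₀) (x t)) ((1 : ℝ) • F (x t) w) =
      (mfderiv (𝓡 n) 𝓘(ℝ, E n) (extChartAt (𝓡 n) x₀) (x t)) (F (x t) w) := by rw [one_smul]
  exact h2.congr_deriv h3

theorem hasMFDerivAt_extChartAt_symm {x₀ : M} {q : E n} (hq : q ∈ (extChartAt (𝓡 n) x₀).target) :
    HasMFDerivAt 𝓘(ℝ, E n) (𝓡 n) (extChartAt (𝓡 n) x₀).symm q
      (mfderivWithin 𝓘(ℝ, E n) (𝓡 n) (extChartAt (𝓡 n) x₀).symm (range (𝓡 n)) q) := by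
  have := (mdifferentiableWithinAt_extChartAt_symm (I := 𝓡 n) hq).hasMFDerivWithinAt
  rw [← hasMFDerivWithinAt_univ, ← ModelWithCorners.range_eq_univ (𝓡 n)]
  exact this

theorem hasMFDerivAt_extChartAt_symm_comp {ξ : ℝ → E n} {t : ℝ} {x₀ : M} {w : E m}
    (hξ : ξ t ∈ (extChartAt (𝓡 n) x₀).target)
    (h : HasDerivAt ξ (localRep F x₀ (ξ t) w) t) :
    HasMFDerivAt 𝓘(ℝ, ℝ) (𝓡 n) (fun s => (extChartAt (𝓡 n) x₀).symm (ξ s)) t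
      ((1 : ℝ →L[ℝ] ℝ).smulRight (F ((extChartAt (𝓡 n) x₀).symm (ξ t)) w)) := by
  set y := (extChartAt (𝓡 n) x₀).symm (ξ t) with hy
  have hysrc : y ∈ (chartAt (E n) x₀).source := by
    have := (extChartAt (𝓡 n) x₀).map_target hξ
    rwa [extChartAt_source] at this
  have hyξ : extChartAt (𝓡 n) x₀ y = ξ t := (extChartAt (𝓡 n) x₀).right_inv hξ
  have h1 := hasMFDerivAt_extChartAt_symm hξ
  have h2 : HasMFDerivAt 𝓘(ℝ, ℝ) 𝓘(ℝ, E n) ξ t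
      ((1 : ℝ →L[ℝ] ℝ).smulRight (localRep F x₀ (ξ t) w)) :=
    hasMFDerivAt_iff_hasFDerivAt.2 h.hasFDerivAt
  have h3 := HasMFDerivAt.comp t h1 h2
  refine h3.congr_mfderiv ?_
  have h4 := TangentBundle.symmL_trivializationAt (I := 𝓡 n) hysrc
  rw [hyξ] at h4
  have h5 : (trivializationAt (E n) (TangentSpace (𝓡 n)) x₀).symmL ℝ y
      (localRep F x₀ (ξ t) w) = F y w := by
    rw [← hyξ, localRep_apply F hysrc]
    exact Bundle.Trivialization.symmL_continuousLinearMapAt _ (by simpa using hysrc) _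
  rw [← h4]
  have h6 : ∀ c : ℝ, (trivializationAt (E n) (TangentSpace (𝓡 n)) x₀).symmL ℝ y
      (c • localRep F x₀ (ξ t) w) = c • F y w := fun c => by rw [map_smul, h5]
  exact ContinuousLinearMap.ext fun c => h6 c

/-- The Lipschitz estimates refer to a chart that depends on the time. They are moved to the fixed
chart around `x₀` and made uniform by compactness; a Lipschitz curve is then the integral of its
a.e. velocity. -/
theorem IsAdmissibleOn.isLocalTrajectory (hF : IsControlSystem U F) {a b : ℝ} (hab : a ≤ b)
    {x : ℝ → M} {u : ℝ → E m} (h : IsAdmissibleOn U F a b x u) {x₀ : M}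
    (hx : ∀ t ∈ Icc a b, x t ∈ (chartAt (E n) x₀).source) :
    IsLocalTrajectory (extChartAt (𝓡 n) x₀).target U (localRep F x₀) a b
      (fun t => extChartAt (𝓡 n) x₀ (x t)) u := by
  have hFc := isC1Family_localRep hF x₀
  have hcont : ContinuousOn (fun t => extChartAt (𝓡 n) x₀ (x t)) (Icc a b) := by
    refine (continuousOn_extChartAt x₀).comp h.cont fun t ht => ?_
    rw [extChartAt_source]; exact hx t ht
  have hmem : ∀ t ∈ Icc a b, extChartAt (𝓡 n) x₀ (x t) ∈ (extChartAt (𝓡 n) x₀).target :=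
    fun t ht => (extChartAt (𝓡 n) x₀).map_source (by rw [extChartAt_source]; exact hx t ht)
  have hlip : LocallyLipschitzOn (Icc a b) (fun t => extChartAt (𝓡 n) x₀ (x t)) := by
    intro t₀ ht₀
    obtain ⟨K, S, hS, hm, hl⟩ := h.lip t₀ ht₀
    obtain ⟨K', S', hS', hSS, hm', hl'⟩ := exists_lipschitzOnWith_of_chart_change (x₀ := x₀)
      (x₁ := x t₀) ht₀ hS hl (mem_extChartAt_target _) (by
        rw [extChartAt_to_inv]; exact hx t₀ ht₀)
    refine ⟨K', S', hS', fun s hs t ht => ?_⟩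
    have := hl' hs ht
    have hinv : ∀ r ∈ S', (extChartAt (𝓡 n) (x t₀)).symm (extChartAt (𝓡 n) (x t₀) (x r)) = x r :=
      fun r hr => (extChartAt (𝓡 n) (x t₀)).left_inv (by
        rw [extChartAt_source]; exact hm (hSS hr))
    simp only [hinv s hs, hinv t ht] at this
    exact this
  obtain ⟨K, hK⟩ := hlip.exists_lipschitzOnWith_of_compact isCompact_Icc
  have hKc : IsCompact (closure (u '' Icc a b)) := h.bdd.isCompact_closure
  have hKU : closure (u '' Icc a b) ⊆ U :=
    closure_minimal (by rintro _ ⟨t, ht, rfl⟩; exact h.mem t ht) hF.isClosed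
  have hA : IsCompact ((fun t => extChartAt (𝓡 n) x₀ (x t)) '' Icc a b) :=
    isCompact_Icc.image_of_continuousOn hcont
  have hAΩ : (fun t => extChartAt (𝓡 n) x₀ (x t)) '' Icc a b ⊆ (extChartAt (𝓡 n) x₀).target := by
    rintro _ ⟨t, ht, rfl⟩; exact hmem t ht
  obtain ⟨C, hC⟩ := hFc.exists_bound hA hKc hAΩ hKU
  refine ⟨hcont, hmem, h.meas, h.bdd, h.mem, fun s hs t ht => ?_⟩
  refine sub_eq_integral_of_lipschitzOn (C := C) hK ?_ (fun τ hτ => (hC _ (subset_closure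
    (mem_image_of_mem _ hτ)) _ (mem_image_of_mem _ hτ)).1) ?_ hs ht
  · exact intervalIntegrable_of_continuousOn_prod (H := fun p => localRep F x₀ p.1 p.2) hA hKc
      (hFc.cont.mono (prod_mono hAΩ hKU)) hab hcont (fun τ hτ => mem_image_of_mem _ hτ) h.meas
      fun τ hτ => subset_closure (mem_image_of_mem _ hτ)
  · filter_upwards [h.ode] with τ h1 hτ
    exact hasDerivAt_extChartAt_comp (hx τ hτ) (h1 hτ)

theorem IsLocalTrajectory.isAdmissibleOn (hF : IsControlSystem U F) {a b : ℝ} (hab : a ≤ b)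
    {x₀ : M} {ξ : ℝ → E n} {w : ℝ → E m}
    (h : IsLocalTrajectory (extChartAt (𝓡 n) x₀).target U (localRep F x₀) a b ξ w) :
    IsAdmissibleOn U F a b (fun t => (extChartAt (𝓡 n) x₀).symm (ξ t)) w := by
  have hFc := isC1Family_localRep hF x₀
  obtain ⟨K, hK⟩ := h.lipschitz hF.isClosed hFc.cont
  refine ⟨h.meas, h.bdd, h.memU, (continuousOn_extChartAt_symm x₀).comp h.cont h.mem,
    fun t₀ ht₀ => ?_, ?_⟩
  · obtain ⟨K', S', hS', -, hm', hl'⟩ := exists_lipschitzOnWith_of_chart_change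
      (x₀ := (extChartAt (𝓡 n) x₀).symm (ξ t₀)) (x₁ := x₀) ht₀ self_mem_nhdsWithin hK
      (h.mem t₀ ht₀) (mem_chart_source _ _)
    exact ⟨K', S', hS', hm', hl'⟩
  · filter_upwards [h.ae_hasDerivAt hF.isClosed hFc.cont hab] with t h1 ht
    exact hasMFDerivAt_extChartAt_symm_comp (h.mem t ht) (h1 ht)

end Admissible

/-! ### Canonical charts of the cotangent bundle -/

section CotangentCharts

variable {n m : ℕ} {M : Type*} [TopologicalSpace M] [ChartedSpace (E n) M]
  [IsManifold (𝓡 n) ∞ M] {U : Set (E m)} {F : (x : M) → E m → TangentSpace (𝓡 n) x}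
  {L : M → E m → ℝ}

/-- The coordinates `p` of a covector in the chart around `x₀`. -/
def covectorCoord (x₀ : M) (z : Cotangent n M) : E n →L[ℝ] ℝ :=
  (z.2 : TangentSpace (𝓡 n) z.1 →L[ℝ] ℝ).comp
    ((trivializationAt (E n) (TangentSpace (𝓡 n)) x₀).symmL ℝ z.1)

theorem extChartAt_cotangent_apply (z₀ z : Cotangent n M) :
    extChartAt (cotangentModel n) z₀ z =
      (extChartAt (𝓡 n) z₀.proj z.proj, covectorCoord z₀.proj z) := by
  have h : ContinuousLinearMap.inCoordinates (E n) (TangentSpace (𝓡 n) : M → Type) ℝ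
      (Bundle.Trivial M ℝ) z₀.proj z.proj z₀.proj z.proj z.2 = covectorCoord z₀.proj z := by
    ext v
    simp [ContinuousLinearMap.inCoordinates, covectorCoord]
  rw [FiberBundle.extChartAt, ← h]
  rfl

theorem mem_extChartAt_cotangent_source {z₀ z : Cotangent n M} :
    z ∈ (extChartAt (cotangentModel n) z₀).source ↔
      z.proj ∈ (chartAt (E n) z₀.proj).source := by
  rw [FiberBundle.extChartAt]
  simp only [PartialEquiv.trans_source, mem_inter_iff, mem_preimage]
  constructor
  · rintro ⟨h1, -⟩
    simpa [Bundle.Trivialization.mem_source] using h1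
  · intro h
    refine ⟨by simpa [Bundle.Trivialization.mem_source] using h, ?_⟩
    show _ ∈ (extChartAt (𝓡 n) z₀.proj).source ×ˢ univ
    refine ⟨?_, mem_univ _⟩
    rw [extChartAt_source]
    exact h

theorem extChartAt_cotangent_target (z₀ : Cotangent n M) :
    (extChartAt (cotangentModel n) z₀).target =
      (extChartAt (𝓡 n) z₀.proj).target ×ˢ (univ : Set (E n →L[ℝ] ℝ)) := by
  rw [FiberBundle.extChartAt_target]
  congr 1
  rw [inter_eq_left]
  intro q hq
  have := (extChartAt (𝓡 n) z₀.proj).map_target hq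
  rw [extChartAt_source] at this
  simpa using this

theorem controlHamiltonian_eq {x₀ : M} {z : Cotangent n M}
    (hz : z.proj ∈ (chartAt (E n) x₀).source) (v : E m) :
    controlHamiltonian F L v z = covectorCoord x₀ z
      (localRep F x₀ (extChartAt (𝓡 n) x₀ z.proj) v) - L z.proj v := by
  rw [localRep_apply F hz, covectorCoord, ContinuousLinearMap.comp_apply,
    Bundle.Trivialization.symmL_continuousLinearMapAt _ (by simpa using hz)]
  rfl

theorem controlHamiltonian_extChartAt_symm {z₀ : Cotangent n M} {q : E n}
    (hq : q ∈ (extChartAt (𝓡 n) z₀.proj).target) (p : E n →L[ℝ] ℝ) (v : E m) :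
    controlHamiltonian F L v ((extChartAt (cotangentModel n) z₀).symm (q, p)) =
      p (localRep F z₀.proj q v) - L ((extChartAt (𝓡 n) z₀.proj).symm q) v := by
  have ht : (q, p) ∈ (extChartAt (cotangentModel n) z₀).target := by
    rw [extChartAt_cotangent_target]; exact ⟨hq, mem_univ _⟩
  set z := (extChartAt (cotangentModel n) z₀).symm (q, p) with hz
  have hzs : z.proj ∈ (chartAt (E n) z₀.proj).source :=
    mem_extChartAt_cotangent_source.1 ((extChartAt (cotangentModel n) z₀).map_target ht)
  have he := (extChartAt (cotangentModel n) z₀).right_inv ht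
  rw [← hz, extChartAt_cotangent_apply, Prod.mk.injEq] at he
  rw [controlHamiltonian_eq hzs, he.1, he.2, ← he.1,
    (extChartAt (𝓡 n) z₀.proj).left_inv (by rwa [extChartAt_source])]

theorem le_maxHamiltonian (hmax : IsWellDefinedMaxHamiltonian U F L) (z : Cotangent n M) {v : E m}
    (hv : v ∈ U) : controlHamiltonian F L v z ≤ maxHamiltonian U F L z := by
  obtain ⟨u, hu, h⟩ := hmax z
  exact le_csSup ⟨_, by rintro _ ⟨w, hw, rfl⟩; exact h w hw⟩ (mem_image_of_mem _ hv)

theorem exists_maxHamiltonian_eq (hmax : IsWellDefinedMaxHamiltonian U F L) (z : Cotangent n M) :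
    ∃ u ∈ U, maxHamiltonian U F L z = controlHamiltonian F L u z := by
  obtain ⟨u, hu, h⟩ := hmax z
  refine ⟨u, hu, le_antisymm (csSup_le (Set.Nonempty.image _ ⟨u, hu⟩) ?_)
    (le_maxHamiltonian hmax z hu)⟩
  rintro _ ⟨w, hw, rfl⟩; exact h w hw

theorem contDiffOn_comp_extChartAt_symm {H : Cotangent n M → ℝ}
    (hH : ContMDiff (cotangentModel n) 𝓘(ℝ, ℝ) 2 H) (z₀ : Cotangent n M) :
    ContDiffOn ℝ 2 (fun ζ => H ((extChartAt (cotangentModel n) z₀).symm ζ))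
      ((extChartAt (𝓡 n) z₀.proj).target ×ˢ univ) := by
  have : IsManifold (cotangentModel n) 2 (Cotangent n M) := by
    have : IsManifold (cotangentModel n) ∞ (Cotangent n M) := inferInstance
    exact IsManifold.of_le (m := 2) (n := ∞) (WithTop.coe_le_coe.2 (le_top (a := (2 : ℕ∞))))
  have h1 := hH.comp_contMDiffOn (contMDiffOn_extChartAt_symm (n := 2) z₀)
  rw [extChartAt_cotangent_target] at h1
  exact contMDiffOn_iff_contDiffOn.1 h1

/-- A dictionary between `-dg` and coordinates: the component `p` of `negDifferential` is minus the
derivative of the coordinate expression. The covector `z₀` serves only to name a canonical chart,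
which depends on its base point alone. -/
theorem hasFDerivAt_comp_extChartAt_symm {g : M → ℝ} {x x₀ : M}
    (hx : x ∈ (chartAt (E n) x₀).source) (hg : MDifferentiableAt (𝓡 n) 𝓘(ℝ, ℝ) g x)
    {z₀ : Cotangent n M} (hz₀ : z₀.proj = x₀) :
    HasFDerivAt (fun q => g ((extChartAt (𝓡 n) x₀).symm q))
      (-(extChartAt (cotangentModel n) z₀ (negDifferential n g x)).2) (extChartAt (𝓡 n) x₀ x) := by
  subst hz₀
  have hinv : (extChartAt (𝓡 n) z₀.proj).symm (extChartAt (𝓡 n) z₀.proj x) = x :=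
    (extChartAt (𝓡 n) z₀.proj).left_inv (by rwa [extChartAt_source])
  have hmem : extChartAt (𝓡 n) z₀.proj x ∈ (extChartAt (𝓡 n) z₀.proj).target :=
    (extChartAt (𝓡 n) z₀.proj).map_source (by rwa [extChartAt_source])
  have h1 : ∀ y, y = x → HasMFDerivAt (𝓡 n) 𝓘(ℝ, ℝ) g y
      (show E n →L[ℝ] ℝ from mfderiv (𝓡 n) 𝓘(ℝ, ℝ) g x) := by
    rintro _ rfl; exact hg.hasMFDerivAt
  have h2 := hasMFDerivAt_iff_hasFDerivAt.1
    (HasMFDerivAt.comp (extChartAt (𝓡 n) z₀.proj x) (h1 _ hinv) (hasMFDerivAt_extChartAt_symm hmem))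
  refine HasFDerivAt.congr_fderiv (f := fun q => g ((extChartAt (𝓡 n) z₀.proj).symm q)) h2 ?_
  rw [← TangentBundle.symmL_trivializationAt (I := 𝓡 n) hx, extChartAt_cotangent_apply]
  ext v
  exact (neg_neg _).symm

theorem mdifferentiableAt_comp_extChartAt {g : E n → ℝ} {x₀ x : M} {p : E n →L[ℝ] ℝ}
    (hx : x ∈ (chartAt (E n) x₀).source) (hg : HasFDerivAt g (-p) (extChartAt (𝓡 n) x₀ x))
    {z₀ : Cotangent n M} (hz₀ : z₀.proj = x₀) :
    MDifferentiableAt (𝓡 n) 𝓘(ℝ, ℝ) (fun y => g (extChartAt (𝓡 n) x₀ y)) x ∧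
      extChartAt (cotangentModel n) z₀
        (negDifferential n (fun y => g (extChartAt (𝓡 n) x₀ y)) x) =
        (extChartAt (𝓡 n) x₀ x, p) := by
  have h1 : MDifferentiableAt (𝓡 n) 𝓘(ℝ, ℝ) (fun y => g (extChartAt (𝓡 n) x₀ y)) x :=
    MDifferentiableAt.comp x hg.differentiableAt.mdifferentiableAt (mdifferentiableAt_extChartAt hx)
  have h2 := hasFDerivAt_comp_extChartAt_symm hx h1 hz₀
  refine ⟨h1, Prod.ext ?_ ?_⟩
  · rw [extChartAt_cotangent_apply, hz₀]
    rfl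
  · have h3 : HasFDerivAt g
        (-(extChartAt (cotangentModel n) z₀
          (negDifferential n (fun y => g (extChartAt (𝓡 n) x₀ y)) x)).2)
        (extChartAt (𝓡 n) x₀ x) := by
      refine h2.congr_of_eventuallyEq ?_
      filter_upwards [(isOpen_extChartAt_target x₀).mem_nhds
        ((extChartAt (𝓡 n) x₀).map_source (by rwa [extChartAt_source]))] with q hq
      rw [(extChartAt (𝓡 n) x₀).right_inv hq]
    exact neg_injective (h3.unique hg)

end CotangentCharts

/-! ### Minimizers follow the Hamiltonian flow -/

section Propagation

variable {n m : ℕ} {M : Type*} [TopologicalSpace M] [T2Space M] [SecondCountableTopology M]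
  [ChartedSpace (E n) M] [IsManifold (𝓡 n) ∞ M] [MeasurableSpace M] [BorelSpace M]
  {U : Set (E m)} {F : (x : M) → E m → TangentSpace (𝓡 n) x} {L : M → E m → ℝ}

theorem IsAdmissibleOn.intervalIntegrable (hF : IsControlSystem U F)
    (hL : IsSmoothLagrangian n U L) {a b : ℝ} (hab : a ≤ b) {x : ℝ → M} {u : ℝ → E m}
    (h : IsAdmissibleOn U F a b x u) :
    IntervalIntegrable (fun t => L (x t) (u t)) volume a b := by
  have hKU : closure (u '' Icc a b) ⊆ U :=
    closure_minimal (by rintro _ ⟨t, ht, rfl⟩; exact h.mem t ht) hF.isClosed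
  exact intervalIntegrable_of_continuousOn_prod (H := fun p : M × E m => L p.1 p.2)
    (isCompact_Icc.image_of_continuousOn h.cont) h.bdd.isCompact_closure
    (hL.continuousOn.mono (prod_mono (subset_univ _) hKU)) hab h.cont
    (fun t ht => mem_image_of_mem _ ht) h.meas fun t ht => subset_closure (mem_image_of_mem _ ht)

/-- `c` is the cost of an admissible pair on `[t, 1]` that goes from `z` to `y`. -/
def IsRemainingCost (U : Set (E m)) (F : (x : M) → E m → TangentSpace (𝓡 n) x)
    (L : M → E m → ℝ) (y : M) (t : ℝ) (z : M) (c : ℝ) : Prop :=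
  ∃ x u, IsAdmissibleOn U F t 1 x u ∧ x t = z ∧ x 1 = y ∧ c = ∫ s in t..1, L (x s) (u s)

theorem isBackwardStable_isRemainingCost (hF : IsControlSystem U F)
    (hL : IsSmoothLagrangian n U L) (y x₀ : M) {a b : ℝ} (hb : b ≤ 1) :
    IsBackwardStable (extChartAt (𝓡 n) x₀).target U (localRep F x₀)
      (fun q w => L ((extChartAt (𝓡 n) x₀).symm q) w) a b
      (fun t q c => IsRemainingCost U F L y t ((extChartAt (𝓡 n) x₀).symm q) c) := by
  rintro s t ξ w c - hst htb hξ ⟨x, u, hx, hxt, hx1, rfl⟩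
  have ht1 : t ≤ 1 := htb.trans hb
  have hs := hξ.isAdmissibleOn hF hst
  have hc := hs.concat hst ht1 hx hxt.symm
  refine ⟨_, _, hc, if_pos hst, ?_, ?_⟩
  -- When `t = 1` the second piece is a single point, and the final value is read off the first
  -- piece.
  · by_cases h1 : (1 : ℝ) ≤ t
    · have : t = 1 := le_antisymm ht1 h1
      subst this
      exact (if_pos le_rfl).trans (hxt.symm.trans hx1)
    · simp [h1, hx1]
  · have hi := hc.intervalIntegrable hF hL (hst.trans ht1)
    rw [← intervalIntegral.integral_add_adjacent_intervals (b := t)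
      (hi.mono_set (uIcc_subset_uIcc_left ⟨by simp [hst], by simp [ht1]⟩))
      (hi.mono_set (uIcc_subset_uIcc_right ⟨by simp [hst], by simp [ht1]⟩)), add_comm]
    congr 1
    · refine intervalIntegral.integral_congr fun τ hτ => ?_
      rw [uIcc_of_le hst] at hτ
      simp [hτ.2]
    · refine intervalIntegral.integral_congr_ae (Filter.Eventually.of_forall fun τ hτ => ?_)
      rw [uIoc_of_le ht1] at hτ
      simp [not_le.2 hτ.1]

/-- Nothing guarantees in advance that `γ` stays in the chart; it does so while its projection
agrees with `x`. Hence a continuous induction: agreement is a closed condition, and local uniqueness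
for the `C¹` field extends it to the right. -/
theorem IsHamiltonianTrajectory.eqOn_Icc {H : Cotangent n M → ℝ}
    (hH : ContMDiff (cotangentModel n) 𝓘(ℝ, ℝ) 2 H) {γ : ℝ → Cotangent n M}
    (hγ : IsHamiltonianTrajectory H γ) {z₀ : Cotangent n M} {a b : ℝ}
    {x : ℝ → M} (hxc : ContinuousOn x (Icc a b))
    (hx : ∀ t ∈ Icc a b, x t ∈ (chartAt (E n) z₀.proj).source)
    {p : ℝ → E n →L[ℝ] ℝ}
    (hd : ∀ t ∈ Icc a b, HasDerivWithinAt (fun s => (extChartAt (𝓡 n) z₀.proj (x s), p s))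
      (hamiltonianField (fun ζ => H ((extChartAt (cotangentModel n) z₀).symm ζ))
        (extChartAt (𝓡 n) z₀.proj (x t), p t)) (Icc a b) t)
    (hax : (γ a).proj = x a) (hap : covectorCoord z₀.proj (γ a) = p a) :
    ∀ t ∈ Icc a b, (γ t).proj = x t ∧ covectorCoord z₀.proj (γ t) = p t := by
  set φ := extChartAt (cotangentModel n) z₀ with hφ
  set ζ : ℝ → E n × (E n →L[ℝ] ℝ) := fun s => (extChartAt (𝓡 n) z₀.proj (x s), p s) with hζ
  have hproj : Continuous fun t => (γ t).proj :=
    (FiberBundle.continuous_proj (E n →L[ℝ] ℝ) _).comp hγ.1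
  have hsrc : ∀ t ∈ Icc a b, (γ t).proj = x t → γ t ∈ φ.source := fun t ht h =>
    mem_extChartAt_cotangent_source.2 (by rw [h]; exact hx t ht)
  have hζc : ContinuousOn ζ (Icc a b) := fun t ht => (hd t ht).continuousWithinAt
  have hclosed1 : IsClosed (Icc a b ∩ {t | (γ t).proj = x t}) := by
    have := (hproj.continuousOn.prodMk hxc).preimage_isClosed_of_isClosed isClosed_Icc
      (isClosed_diagonal (X := M))
    exact this
  -- Closedness is obtained in two stages, since the coordinates of `γ t` are continuous only where
  -- its base point lies in the chart; agreement of base points, closed because `M` is Hausdorff,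
  -- ensures this.
  have hclosed : IsClosed ((Icc a b ∩ {t | (γ t).proj = x t}) ∩ {t | φ (γ t) = ζ t}) := by
    have h1 : ContinuousOn (fun t => φ (γ t)) (Icc a b ∩ {t | (γ t).proj = x t}) :=
      (continuousOn_extChartAt z₀).comp hγ.1.continuousOn fun t ht => hsrc t ht.1 ht.2
    exact (h1.prodMk (hζc.mono inter_subset_left)).preimage_isClosed_of_isClosed hclosed1
      (isClosed_diagonal (X := E n × (E n →L[ℝ] ℝ)))
  have key : Icc a b ⊆ {t | (γ t).proj = x t ∧ φ (γ t) = ζ t} := by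
    refine IsClosed.Icc_subset_of_forall_exists_gt ?_ ⟨hax, ?_⟩ ?_
    · convert hclosed using 1
      ext t
      simp only [mem_inter_iff, mem_ofPred_eq]
      tauto
    · rw [hφ, extChartAt_cotangent_apply, hax, hap]
    · rintro t ⟨⟨h1, h2⟩, ht⟩ y (hy : t < y)
      have hsrct : γ t ∈ φ.source := hsrc t ⟨ht.1, ht.2.le⟩ h1
      obtain ⟨δ, hδ, hball⟩ := Metric.mem_nhds_iff.1
        (hγ.1.continuousAt.preimage_mem_nhds ((isOpen_extChartAt_source z₀).mem_nhds hsrct))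
      set b' := min (min b y) (t + δ / 2) with hb'
      have htb' : t < b' := lt_min (lt_min ht.2 hy) (by linarith)
      have hb'b : b' ≤ b := (min_le_left _ _).trans (min_le_left _ _)
      have hb'y : b' ≤ y := (min_le_left _ _).trans (min_le_right _ _)
      have hsub : Icc t b' ⊆ Icc a b := Icc_subset_Icc ht.1 hb'b
      have hγsrc : ∀ s ∈ Icc t b', γ s ∈ φ.source := fun s hs => by
        refine hball ?_
        have : b' ≤ t + δ / 2 := min_le_right _ _
        rw [Metric.mem_ball, Real.dist_eq, abs_of_nonneg (by linarith [hs.1])]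
        linarith [hs.2]
      have htarget : ∀ s ∈ Icc t b', ζ s ∈ (extChartAt (𝓡 n) z₀.proj).target ×ˢ
          (univ : Set (E n →L[ℝ] ℝ)) := fun s hs =>
        ⟨(extChartAt (𝓡 n) z₀.proj).map_source (by
          rw [extChartAt_source]; exact hx s (hsub hs)), mem_univ _⟩
      have hopen : IsOpen ((extChartAt (𝓡 n) z₀.proj).target ×ˢ (univ : Set (E n →L[ℝ] ℝ))) :=
        (isOpen_extChartAt_target _).prod isOpen_univ
      have htt : t ∈ Icc t b' := left_mem_Icc.2 htb'.le
      obtain ⟨c, htc, hcb, hc⟩ := exists_eqOn_Icc_of_hasDerivWithinAt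
        (v := hamiltonianField fun ζ => H (φ.symm ζ)) (y := ζ) (z := fun s => φ (γ s)) htb'
        ((contDiffOn_hamiltonianField hopen (contDiffOn_comp_extChartAt_symm hH z₀)).contDiffAt
          (hopen.mem_nhds (htarget t htt)))
        (fun s hs => by
          refine (hd s (hsub ⟨hs.1, hs.2.le⟩)).mono_of_mem_nhdsWithin ?_
          exact Filter.mem_of_superset (Icc_mem_nhdsGE (hs.2.trans_le hb'b))
            (Icc_subset_Icc_left (ht.1.trans hs.1)))
        (fun s hs => by
          obtain ⟨w, hw, hw'⟩ := hγ.2 z₀ s (hγsrc s ⟨hs.1, hs.2.le⟩)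
          have : hamiltonianField (fun ζ => H (φ.symm ζ)) (φ (γ s)) = w := hamiltonianField_eq hw'
          rw [this]
          exact hw.hasDerivWithinAt)
        (hζc.mono hsub)
        ((continuousOn_extChartAt z₀).comp hγ.1.continuousOn hγsrc) h2.symm
      refine ⟨c, ⟨?_, (hc c ⟨htc.le, le_rfl⟩).symm⟩, htc, hcb.trans hb'y⟩
      have hcI : c ∈ Icc t b' := ⟨htc.le, hcb⟩
      have h3 := (hc c ⟨htc.le, le_rfl⟩).symm
      simp only [hφ, extChartAt_cotangent_apply, hζ, Prod.mk.injEq] at h3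
      refine (extChartAt (𝓡 n) z₀.proj).injOn ?_ ?_ h3.1
      · rw [extChartAt_source]
        exact mem_extChartAt_cotangent_source.1 (hγsrc c hcI)
      · rw [extChartAt_source]; exact hx c (hsub hcI)
  intro t ht
  refine ⟨(key ht).1, ?_⟩
  have := (key ht).2
  simp only [hφ, extChartAt_cotangent_apply, hζ, Prod.mk.injEq] at this
  exact this.2

/-- The covector `ζ` is minus the differential, at `x t`, of a function that bounds from below
the costs of the admissible pairs on `[t, 1]` ending at `x 1`, with equality for `(x, u)`. -/
def IsCalibratedAt (U : Set (E m)) (F : (x : M) → E m → TangentSpace (𝓡 n) x)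
    (L : M → E m → ℝ) (x : ℝ → M) (u : ℝ → E m) (t : ℝ) (ζ : Cotangent n M) : Prop :=
  ∃ g : M → ℝ, MDifferentiableAt (𝓡 n) 𝓘(ℝ, ℝ) g (x t) ∧ negDifferential n g (x t) = ζ ∧
    (∀ᶠ z in 𝓝 (x t), ∀ c, IsRemainingCost U F L (x 1) t z c → g z ≤ c) ∧
    g (x t) = ∫ s in t..1, L (x s) (u s)

/-- One step in the chart around `x t₀`: the calibrating function at time `a` is propagated with its
adjoint curve, maximality makes this curve Hamiltonian, and uniqueness identifies it with `γ`. Thus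
at time `b` the calibrating covector is again `γ b`. -/
theorem IsHamiltonianTrajectory.exists_isCalibratedAt (hF : IsControlSystem U F)
    (hL : IsSmoothLagrangian n U L) (hmax : IsWellDefinedMaxHamiltonian U F L)
    (hH : ContMDiff (cotangentModel n) 𝓘(ℝ, ℝ) 2 (maxHamiltonian U F L))
    {γ : ℝ → Cotangent n M} (hγ : IsHamiltonianTrajectory (maxHamiltonian U F L) γ)
    {x : ℝ → M} {u : ℝ → E m} (hx : IsAdmissibleOn U F 0 1 x u) {t₀ : ℝ} (ht₀ : t₀ ∈ Icc 0 1) :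
    ∃ ε > 0, ∀ a b : ℝ, 0 ≤ a → a ≤ b → b ≤ 1 → |a - t₀| < ε → |b - t₀| < ε →
      IsCalibratedAt U F L x u a (γ a) → IsCalibratedAt U F L x u b (γ b) := by
  set x₀ := x t₀ with hx₀
  set φ := extChartAt (𝓡 n) x₀ with hφ
  have hFc := isC1Family_localRep hF x₀
  have hLc := isC1Family_lagrangian hL x₀
  have hopen : IsOpen φ.target := isOpen_extChartAt_target x₀
  obtain ⟨r, hr, hB⟩ := Metric.nhds_basis_closedBall.mem_iff.1
    (hopen.mem_nhds (mem_extChartAt_target (I := 𝓡 n) x₀))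
  have hK : IsCompact (closure (u '' Icc 0 1)) := hx.bdd.isCompact_closure
  have hKU : closure (u '' Icc 0 1) ⊆ U :=
    closure_minimal (by rintro _ ⟨t, ht, rfl⟩; exact hx.mem t ht) hF.isClosed
  obtain ⟨C, hC⟩ := hFc.exists_bound (isCompact_closedBall (φ x₀) r) hK hB hKU
  have hnhds : φ.source ∩ φ ⁻¹' Metric.ball (φ x₀) (r / 2) ∈ 𝓝 x₀ :=
    Filter.inter_mem (extChartAt_source_mem_nhds x₀)
      ((continuousAt_extChartAt x₀).preimage_mem_nhds (Metric.ball_mem_nhds _ (by positivity)))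
  obtain ⟨δ, hδ, hδx⟩ := Metric.mem_nhdsWithin_iff.1 ((hx.cont t₀ ht₀).preimage_mem_nhdsWithin hnhds)
  have hC0 : (0 : ℝ) ≤ C := C.2
  -- `δ` keeps `x` in the half ball. The other term gives `C (b - a) ≤ min 1 r / 2`, the smallness
  -- required for propagation.
  set ε := min δ (min 1 (r) / (4 * (C + 1))) with hε
  have hε2 : C * (2 * ε) ≤ min 1 r / 2 := by
    have h1 : ε ≤ min 1 r / (4 * (C + 1)) := min_le_right _ _
    rw [le_div_iff₀ (by positivity)] at h1
    have : 0 < ε := lt_min hδ (div_pos (lt_min one_pos hr) (by positivity))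
    nlinarith
  refine ⟨ε, lt_min hδ (div_pos (lt_min one_pos hr) (by positivity)),
    fun a b ha hab hb1 hat hbt hcal => ?_⟩
  obtain ⟨g, hgd, hgγ, hgle, hgeq⟩ := hcal
  have hsub : Icc a b ⊆ Icc 0 1 := Icc_subset_Icc ha hb1
  have hxs : ∀ t ∈ Icc a b, x t ∈ φ.source ∩ φ ⁻¹' Metric.ball (φ x₀) (r / 2) := fun t ht => by
    refine hδx ⟨?_, hsub ht⟩
    rw [Metric.mem_ball, Real.dist_eq]
    refine lt_of_lt_of_le ?_ (min_le_left _ _ : ε ≤ δ)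
    rw [abs_lt] at *
    exact ⟨by linarith [ht.1], by linarith [ht.2]⟩
  have hxsrc : ∀ t ∈ Icc a b, x t ∈ (chartAt (E n) x₀).source := fun t ht => by
    have := (hxs t ht).1
    rwa [hφ, extChartAt_source] at this
  have hba : C * (b - a) ≤ min 1 r / 2 := by
    refine le_trans (mul_le_mul_of_nonneg_left ?_ hC0) hε2
    rw [abs_lt] at *
    linarith
  have hinv : ∀ t ∈ Icc a b, φ.symm (φ (x t)) = x t := fun t ht => φ.left_inv (hxs t ht).1
  have hxab := hx.mono ha hb1
  have hxl := hxab.isLocalTrajectory hF hab hxsrc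
  have hLint : ∀ s ∈ Icc a b, ∫ τ in s..b, L (φ.symm (φ (x τ))) (u τ) =
      ∫ τ in s..b, L (x τ) (u τ) := fun s hs =>
    intervalIntegral.integral_congr fun τ hτ => by
      rw [uIcc_of_le hs.2] at hτ
      simp only [hinv τ ⟨hs.1.trans hτ.1, hτ.2⟩]
  have haI : a ∈ Icc a b := left_mem_Icc.2 hab
  have hbI : b ∈ Icc a b := right_mem_Icc.2 hab
  have hR := isBackwardStable_isRemainingCost hF hL (x 1) x₀ (a := a) hb1
  set R : ℝ → E n → ℝ → Prop :=
    fun t q c => IsRemainingCost U F L (x 1) t (φ.symm q) c with hRdef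
  set c := ∫ τ in b..1, L (x τ) (u τ) with hc
  have hg' : TouchesBelow (R a) (fun q => g (φ.symm q)) (φ (x a))
      (covectorCoord x₀ (γ a)) (c + ∫ τ in a..b, L (φ.symm (φ (x τ))) (u τ)) := by
    refine ⟨?_, ?_, ?_⟩
    · have := hasFDerivAt_comp_extChartAt_symm (hxsrc a haI) hgd
        (z₀ := negDifferential n (0 : M → ℝ) x₀) rfl
      rw [extChartAt_cotangent_apply, hgγ] at this
      exact this
    · have h1 : Filter.Tendsto φ.symm (𝓝 (φ (x a))) (𝓝 (x a)) := by
        have := (continuousOn_extChartAt_symm x₀).continuousAt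
          (hopen.mem_nhds (φ.map_source (hxs a haI).1))
        rw [ContinuousAt, hinv a haI] at this
        exact this
      filter_upwards [h1.eventually hgle] with q hq c' hc' using hq c' hc'
    · have hi := hx.intervalIntegrable hF hL zero_le_one
      show g (φ.symm (φ (x a))) = _
      rw [hinv a haI, hgeq, hLint a haI, hc, add_comm]
      exact (intervalIntegral.integral_add_adjacent_intervals
        (hi.mono_set (uIcc_subset_uIcc (by simp [ha, hab.trans hb1]) (by simp [ha.trans hab, hb1])))
        (hi.mono_set (uIcc_subset_uIcc_right (by simp [ha.trans hab, hb1])))).symm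
  obtain ⟨p, hpc, hpa, hpint, hpeq, hpt⟩ := exists_adjoint_propagation hF.isClosed hFc hLc hB hK hKU
    hC hab (hba.trans (by have := min_le_left 1 r; linarith))
    (hba.trans (by have := min_le_right 1 r; linarith)) hxl (fun t ht => (hxs t ht).2)
    (fun t ht => subset_closure (mem_image_of_mem u (hsub ht))) hR hg'
  have hRb : R b (φ (x b)) c := ⟨x, u, hx.mono (ha.trans hab) le_rfl, (hinv b hbI).symm, rfl, rfl⟩
  have hae := ae_maximality hopen hF.isClosed hFc hLc hr hB hab hxl
    (fun t ht => (hxs t ht).2) hR hRb hpt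
  -- Any covector over `x₀` would do; this one is zero.
  set z₀ : Cotangent n M := negDifferential n (0 : M → ℝ) x₀ with hz₀
  have hval : ∀ q ∈ φ.target, ∀ p : E n →L[ℝ] ℝ, ∀ v,
      controlHamiltonian F L v ((extChartAt (cotangentModel n) z₀).symm (q, p)) =
        p (localRep F x₀ q v) - L (φ.symm q) v := fun q hq p v =>
    controlHamiltonian_extChartAt_symm (z₀ := z₀) hq p v
  have hd := fun t ht => hasDerivWithinAt_of_maximality hopen hF.isClosed hFc hLc
    (H := fun ζ => maxHamiltonian U F L ((extChartAt (cotangentModel n) z₀).symm ζ))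
    (contDiffOn_comp_extChartAt_symm hH z₀)
    (fun q hq p v hv => by rw [← hval q hq]; exact le_maxHamiltonian hmax _ hv)
    (fun q hq p => by
      obtain ⟨v, hv, h⟩ := exists_maxHamiltonian_eq hmax
        ((extChartAt (cotangentModel n) z₀).symm (q, p))
      exact ⟨v, hv, h.trans (hval q hq p v)⟩) hab hxl hpc hpint hpeq hae (t := t) ht
  have hγa : (γ a).proj = x a := by rw [← hgγ]; rfl
  obtain ⟨hb1', hb2'⟩ := hγ.eqOn_Icc hH (z₀ := z₀) hxab.cont hxsrc hd hγa hpa.symm b hbI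
  obtain ⟨g', hg'd, hg'le, hg'eq⟩ := hpt b hbI
  obtain ⟨h1, h2⟩ := mdifferentiableAt_comp_extChartAt (hxsrc b hbI) hg'd (z₀ := z₀) rfl
  refine ⟨fun y => g' (φ y), h1, ?_, ?_, ?_⟩
  · refine (extChartAt (cotangentModel n) z₀).injOn
      (mem_extChartAt_cotangent_source (z := negDifferential n (fun y => g' (φ y)) (x b)).2
        (hxsrc b hbI))
      (mem_extChartAt_cotangent_source.2 (by rw [hb1']; exact hxsrc b hbI)) ?_
    rw [h2, extChartAt_cotangent_apply, hb1', ← hb2']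
    rfl
  · filter_upwards [(continuousAt_extChartAt' (hxs b hbI).1).eventually hg'le,
      (isOpen_extChartAt_source x₀).mem_nhds (hxs b hbI).1] with z hz hzs c' hc'
    refine hz c' ?_
    show IsRemainingCost U F L (x 1) b (φ.symm (φ z)) c'
    rwa [φ.left_inv hzs]
  · show g' (φ (x b)) = _
    rw [hg'eq, intervalIntegral.integral_same, add_zero]

/-- The step works across the supremum of the good times, from a good time just before it to one
just after, so `P` need be neither open nor closed. -/
theorem forall_Icc_of_local_step {P : ℝ → Prop} {a b : ℝ} (hab : a ≤ b) (ha : P a)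
    (hstep : ∀ t ∈ Icc a b, ∃ ε > 0, ∀ s s' : ℝ, a ≤ s → s ≤ s' → s' ≤ b → |s - t| < ε →
      |s' - t| < ε → P s → P s') : P b := by
  set T := {t | t ∈ Icc a b ∧ P t} with hT
  have hne : T.Nonempty := ⟨a, left_mem_Icc.2 hab, ha⟩
  have hbdd : BddAbove T := ⟨b, fun t ht => ht.1.2⟩
  have hs1 : a ≤ sSup T := le_csSup hbdd ⟨left_mem_Icc.2 hab, ha⟩
  have hs2 : sSup T ≤ b := csSup_le hne fun t ht => ht.1.2
  obtain ⟨ε, hε, h⟩ := hstep (sSup T) ⟨hs1, hs2⟩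
  obtain ⟨t, ht, htε⟩ := exists_lt_of_lt_csSup hne (sub_lt_self (sSup T) hε)
  have hts : t ≤ sSup T := le_csSup hbdd ht
  have h1 : t ≤ min b (sSup T + ε / 2) := le_min ht.1.2 (by linarith)
  have h2 : min b (sSup T + ε / 2) ≤ sSup T + ε / 2 := min_le_right _ _
  have h3 : sSup T ≤ min b (sSup T + ε / 2) := le_min hs2 (by linarith)
  have hP : P (min b (sSup T + ε / 2)) :=
    h t _ ht.1.1 h1 (min_le_left _ _) (by rw [abs_lt]; constructor <;> linarith)
      (by rw [abs_lt]; constructor <;> linarith) ht.2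
  rcases le_total b (sSup T + ε / 2) with h4 | h4
  · rwa [min_eq_left h4] at hP
  · rw [min_eq_right h4] at hP
    have := le_csSup hbdd (show sSup T + ε / 2 ∈ T from ⟨⟨by linarith, h4⟩, hP⟩)
    linarith

theorem proj_eq_of_isCalibratedAt (hF : IsControlSystem U F)
    (hL : IsSmoothLagrangian n U L) (hmax : IsWellDefinedMaxHamiltonian U F L)
    (hH : ContMDiff (cotangentModel n) 𝓘(ℝ, ℝ) 2 (maxHamiltonian U F L))
    {γ : ℝ → Cotangent n M} (hγ : IsHamiltonianTrajectory (maxHamiltonian U F L) γ)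
    {x : ℝ → M} {u : ℝ → E m} (hx : IsAdmissibleOn U F 0 1 x u)
    (h : IsCalibratedAt U F L x u 0 (γ 0)) : (γ 1).proj = x 1 := by
  obtain ⟨g, -, hg, -⟩ := forall_Icc_of_local_step (P := fun t => IsCalibratedAt U F L x u t (γ t))
    zero_le_one h fun t ht => hγ.exists_isCalibratedAt hF hL hmax hH hx ht
  rw [← hg]
  rfl

theorem realCost_le_action (hbdd : ∃ b : ℝ, ∀ x y : M, (b : EReal) ≤ cost U F L x y)
    {x : ℝ → M} {u : ℝ → E m} (hx : IsAdmissiblePair U F x u) :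
    realCost U F L (x 0) (x 1) ≤ action L x u := by
  obtain ⟨b, hb⟩ := hbdd
  have h : cost U F L (x 0) (x 1) ≤ (action L x u : EReal) :=
    sInf_le ⟨x, u, hx, rfl, rfl, rfl⟩
  -- The lower bound excludes the cost `-∞`, whose `toReal` would be the meaningless value `0`.
  have := EReal.toReal_le_toReal h (fun h0 => by simpa [h0] using hb (x 0) (x 1))
    (EReal.coe_ne_top _)
  simpa [realCost] using this

theorem exists_action_eq_realCost (hcomplete : IsCompleteCost U F L) (x₀ x₁ : M) :
    ∃ x u, IsAdmissiblePair U F x u ∧ x 0 = x₀ ∧ x 1 = x₁ ∧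
      action L x u = realCost U F L x₀ x₁ := by
  obtain ⟨x, u, h, h0, h1, hc⟩ := hcomplete x₀ x₁
  exact ⟨x, u, h, h0, h1, by rw [realCost, ← hc, EReal.toReal_coe]⟩

/-- If a differentiable function touches `c(·, y)` from below at `x`, up to a constant, then `y` is
the image of its differential under the Hamiltonian flow at time one. -/
theorem displacement_eq_of_touching (hF : IsControlSystem U F)
    (hL : IsSmoothLagrangian n U L) (hcomplete : IsCompleteCost U F L)
    (hbdd : ∃ b : ℝ, ∀ x y : M, (b : EReal) ≤ cost U F L x y)
    (hmax : IsWellDefinedMaxHamiltonian U F L)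
    (hH : ContMDiff (cotangentModel n) 𝓘(ℝ, ℝ) 2 (maxHamiltonian U F L))
    (hflow : IsCompleteHamiltonian (maxHamiltonian U F L)) {f : M → ℝ} {x y : M} {κ : ℝ}
    (hf : MDifferentiableAt (𝓡 n) 𝓘(ℝ, ℝ) f x)
    (hle : ∀ᶠ z in 𝓝 x, f z + κ ≤ realCost U F L z y) (heq : f x + κ = realCost U F L x y) :
    displacement (maxHamiltonian U F L) hflow f x 1 = y := by
  obtain ⟨ξ, u, hξ, rfl, rfl, hact⟩ := exists_action_eq_realCost hcomplete x y
  set z := negDifferential n f (ξ 0) with hz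
  -- It remains to calibrate at time `0`, where the remaining cost from `w` is at least `c(w, y)`;
  -- the function `f + κ` does it.
  refine proj_eq_of_isCalibratedAt hF hL hmax hH (hflow z).choose_spec.2
    (isAdmissibleOn_zero_one_iff.2 hξ) ?_
  rw [(hflow z).choose_spec.1]
  have hd : HasMFDerivAt (𝓡 n) 𝓘(ℝ, ℝ) (fun w => f w + κ) (ξ 0)
      (mfderiv (𝓡 n) 𝓘(ℝ, ℝ) f (ξ 0)) := by
    have h1 : HasMFDerivAt 𝓘(ℝ, ℝ) 𝓘(ℝ, ℝ) (fun s : ℝ => s + κ) (f (ξ 0))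
        (ContinuousLinearMap.id ℝ ℝ) := ((hasFDerivAt_id _).add_const κ).hasMFDerivAt
    exact (h1.comp (ξ 0) hf.hasMFDerivAt).congr_mfderiv (ContinuousLinearMap.id_comp _)
  refine ⟨fun w => f w + κ, hd.mdifferentiableAt, ?_, ?_, ?_⟩
  · rw [hz, negDifferential, negDifferential, hd.mfderiv]
    rfl
  · filter_upwards [hle] with w hw c hc
    obtain ⟨x', u', h1, rfl, h3, rfl⟩ := hc
    rw [← h3] at hw
    exact hw.trans (realCost_le_action hbdd (isAdmissibleOn_zero_one_iff.1 h1))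
  · show f (ξ 0) + κ = _
    rw [heq, ← hact, action]

end Propagation

/-! ### Rademacher's theorem on manifolds -/

section Rademacher

variable {n : ℕ} {M : Type*} [TopologicalSpace M] [SecondCountableTopology M]
  [ChartedSpace (E n) M] [IsManifold (𝓡 n) ∞ M] [MeasurableSpace M] [BorelSpace M]

/-- Rademacher's theorem in charts, combined with a countable subcover of `S`, available by second
countability. -/
theorem IsLebesgueAC.ae_mdifferentiableAt {μ : Measure M} (hμ : IsLebesgueAC n μ) {f : M → ℝ}
    {S : Set M} (hS : IsOpen S) (hf : IsLocallyLipschitzOn n f S) :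
    ∀ᵐ x ∂μ, x ∈ S → MDifferentiableAt (𝓡 n) 𝓘(ℝ, ℝ) f x := by
  have hloc : ∀ x₀ : M, ∃ V : Set M, x₀ ∈ S → V ∈ 𝓝[S] x₀ ∧
      ∀ᵐ x ∂μ, x ∈ V → MDifferentiableAt (𝓡 n) 𝓘(ℝ, ℝ) f x := by
    intro x₀
    by_cases hx₀ : x₀ ∈ S
    swap
    · exact ⟨∅, fun h => absurd h hx₀⟩
    obtain ⟨K, V, hV, hVs, hlip⟩ := hf x₀ hx₀
    rw [hS.nhdsWithin_eq hx₀] at hV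
    set φ := extChartAt (𝓡 n) x₀ with hφ
    have hVs' : V ⊆ φ.source := by rwa [hφ, extChartAt_source]
    have hlip' : LipschitzOnWith K (fun q => f (φ.symm q)) (φ '' V) := by
      refine LipschitzOnWith.of_dist_le_mul ?_
      rintro _ ⟨x, hx, rfl⟩ _ ⟨y, hy, rfl⟩
      rw [φ.left_inv (hVs' hx), φ.left_inv (hVs' hy), Real.dist_eq, dist_eq_norm]
      exact hlip x hx y hy
    have hae := hlip'.ae_differentiableWithinAt_of_mem (μ := volume)
    -- At interior points of `V`, differentiability within the image of `V` is differentiability.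
    refine ⟨interior V, fun _ => ⟨mem_nhdsWithin_of_mem_nhds (interior_mem_nhds.2 hV), ?_⟩⟩
    have hnull := hμ x₀ _ (ae_iff.1 hae)
    rw [ae_iff]
    refine measure_mono_null ?_ hnull
    intro x hx
    simp only [mem_ofPred_eq, Classical.not_imp] at hx
    obtain ⟨hxV, hxd⟩ := hx
    have hxs : x ∈ φ.source := hVs' (interior_subset hxV)
    refine ⟨hxs, fun hd => hxd ?_⟩
    have h1 : φ '' V ∈ 𝓝 (φ x) :=
      extChartAt_image_nhds_mem_nhds_of_mem_interior_range hxs (by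
        rw [ModelWithCorners.range_eq_univ, interior_univ]; exact mem_univ _)
        (mem_interior_iff_mem_nhds.1 hxV)
    have h2 : DifferentiableAt ℝ (fun q => f (φ.symm q)) (φ x) :=
      (hd (mem_image_of_mem _ (interior_subset hxV))).differentiableAt h1
    have h3 : MDifferentiableAt (𝓡 n) 𝓘(ℝ, ℝ) (fun y => f (φ.symm (φ y))) x :=
      MDifferentiableAt.comp (g := fun q => f (φ.symm q)) x h2.mdifferentiableAt
        (mdifferentiableAt_extChartAt (by rwa [hφ, extChartAt_source] at hxs))
    refine h3.congr_of_eventuallyEq ?_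
    filter_upwards [(isOpen_extChartAt_source x₀).mem_nhds hxs] with y hy
    rw [φ.left_inv hy]
  choose V hV using hloc
  obtain ⟨t, htS, htc, ht⟩ := TopologicalSpace.countable_cover_nhdsWithin fun x hx => (hV x hx).1
  have := (ae_ball_iff htc).2 fun x hx => (hV x (htS hx)).2
  filter_upwards [this] with x hx hxS
  obtain ⟨i, hi, hxi⟩ := mem_iUnion₂.1 (ht hxS)
  exact hx i hi hxi

end Rademacher

/-! ### Kantorovich duality on compact spaces -/

/-- Hahn–Banach from the line spanned by `w`; on negative multiples the domination follows from `0 ≤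
N x + N (-x)`. -/
theorem exists_linearMap_le_of_sublinear {V : Type*} [AddCommGroup V] [Module ℝ V] (N : V → ℝ)
    (hN : ∀ c : ℝ, 0 < c → ∀ x, N (c • x) = c * N x) (hadd : ∀ x y, N (x + y) ≤ N x + N y)
    (w : V) : ∃ Λ : V →ₗ[ℝ] ℝ, Λ w = N w ∧ ∀ x, Λ x ≤ N x := by
  have h0 : N 0 = 0 := by
    have := hN 2 two_pos 0
    rw [smul_zero] at this
    linarith
  have hneg : ∀ x, 0 ≤ N x + N (-x) := fun x => by
    have := hadd x (-x)
    rwa [add_neg_cancel, h0] at this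
  have hH : ∀ c : ℝ, c • w = 0 → (RingHom.id ℝ) c • N w = 0 := fun c hc => by
    rcases smul_eq_zero.1 hc with rfl | rfl
    · simp
    · simp [h0]
  obtain ⟨Λ, h1, h2⟩ := exists_extension_of_le_sublinear
    (LinearPMap.mkSpanSingleton' (σ := RingHom.id ℝ) w (N w) hH) N hN hadd (by
      rintro ⟨x, hx⟩
      obtain ⟨c, rfl⟩ := Submodule.mem_span_singleton.1 hx
      rw [LinearPMap.mkSpanSingleton'_apply]
      show c * N w ≤ N (c • w)
      rcases lt_trichotomy c 0 with hc | rfl | hc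
      · have h3 := hN (-c) (by linarith) w
        have h4 := hneg (c • w)
        rw [← neg_smul, h3] at h4
        linarith
      · simp [h0]
      · rw [hN c hc])
  refine ⟨Λ, ?_, h2⟩
  have := h1 ⟨w, Submodule.mem_span_singleton_self w⟩
  rw [this]
  exact LinearPMap.mkSpanSingleton'_apply_self w (N w) hH _

section CompactDuality

variable {X Y : Type*} [TopologicalSpace X] [CompactSpace X] [T2Space X]
  [SecondCountableTopology X] [MeasurableSpace X] [BorelSpace X] [TopologicalSpace Y]
  [CompactSpace Y] [T2Space Y] [SecondCountableTopology Y] [MeasurableSpace Y] [BorelSpace Y]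
  (μ : Measure X) (ν : Measure Y) [IsProbabilityMeasure μ] [IsProbabilityMeasure ν]

theorem integrable_continuousMap (μ : Measure X) [IsFiniteMeasure μ] (g : C(X, ℝ)) :
    Integrable g μ := by
  refine Integrable.of_bound g.continuous.measurable.aestronglyMeasurable ‖g‖ ?_
  exact Filter.Eventually.of_forall g.norm_coe_le_norm

/-- The values `∫ g dμ + ∫ h dν` of the continuous pairs with `φ(x, y) ≤ g(x) + h(y)`. -/
def superValues (φ : C(X × Y, ℝ)) : Set ℝ :=
  {s | ∃ (g : C(X, ℝ)) (h : C(Y, ℝ)), (∀ x y, φ (x, y) ≤ g x + h y) ∧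
    s = ∫ x, g x ∂μ + ∫ y, h y ∂ν}

variable {μ ν}

theorem le_of_mem_superValues {φ : C(X × Y, ℝ)} {a s : ℝ} (ha : ∀ z, a ≤ φ z)
    (hs : s ∈ superValues μ ν φ) : a ≤ s := by
  obtain ⟨g, h, hgh, rfl⟩ := hs
  have h1 : ∀ y, a - h y ≤ ∫ x, g x ∂μ := fun y => by
    have := integral_mono (μ := μ) (integrable_const (a - h y)) (integrable_continuousMap μ g)
      fun x => by have := hgh x y; have := ha (x, y); simp only; linarith
    simpa using this
  have := integral_mono (μ := ν) (integrable_const (a - ∫ x, g x ∂μ)) (integrable_continuousMap ν h)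
    fun y => by have := h1 y; simp only; linarith
  simp only [integral_const, probReal_univ, smul_eq_mul, one_mul] at this
  linarith

theorem bddBelow_superValues (φ : C(X × Y, ℝ)) : BddBelow (superValues μ ν φ) :=
  ⟨-‖φ‖, fun _ hs => le_of_mem_superValues (fun z => neg_le_of_abs_le (φ.norm_coe_le_norm z)) hs⟩

theorem nonempty_superValues (φ : C(X × Y, ℝ)) : (superValues μ ν φ).Nonempty :=
  ⟨_, ContinuousMap.const X ‖φ‖, 0, fun x y => by
    simpa using (le_abs_self _).trans (φ.norm_coe_le_norm (x, y)), rfl⟩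

theorem smul_mem_superValues {φ : C(X × Y, ℝ)} {s c : ℝ} (hc : 0 ≤ c)
    (hs : s ∈ superValues μ ν φ) : c * s ∈ superValues μ ν (c • φ) := by
  obtain ⟨g, h, hgh, rfl⟩ := hs
  refine ⟨c • g, c • h, fun x y => ?_, ?_⟩
  · have := mul_le_mul_of_nonneg_left (hgh x y) hc
    simpa [mul_add] using this
  · simp [integral_const_mul, mul_add]

theorem add_mem_superValues {φ ψ : C(X × Y, ℝ)} {s t : ℝ}
    (hs : s ∈ superValues μ ν φ) (ht : t ∈ superValues μ ν ψ) :
    s + t ∈ superValues μ ν (φ + ψ) := by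
  obtain ⟨g, h, hgh, rfl⟩ := hs
  obtain ⟨g', h', hgh', rfl⟩ := ht
  refine ⟨g + g', h + h', fun x y => ?_, ?_⟩
  · have := hgh x y
    have := hgh' x y
    simp only [ContinuousMap.add_apply]
    linarith
  · simp only [ContinuousMap.add_apply]
    rw [integral_add (integrable_continuousMap μ g) (integrable_continuousMap μ g'),
      integral_add (integrable_continuousMap ν h) (integrable_continuousMap ν h')]
    ring

/-- The infimum of `superValues` is sublinear in `φ`, and finite by integrating in one variable
after the other. A linear functional below it will be represented by a plan. -/
theorem exists_linearMap_le_superValues (w : C(X × Y, ℝ)) :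
    ∃ Λ : C(X × Y, ℝ) →ₗ[ℝ] ℝ, Λ w = sInf (superValues μ ν w) ∧
      ∀ φ, ∀ s ∈ superValues μ ν φ, Λ φ ≤ s := by
  have hle : ∀ (c : ℝ), 0 < c → ∀ φ : C(X × Y, ℝ),
      sInf (superValues μ ν (c • φ)) ≤ c * sInf (superValues μ ν φ) := fun c hc φ => by
    rw [← div_le_iff₀' hc]
    refine le_csInf (nonempty_superValues φ) fun s hs => ?_
    rw [div_le_iff₀' hc]
    exact csInf_le (bddBelow_superValues _) (smul_mem_superValues hc.le hs)
  obtain ⟨Λ, h1, h2⟩ := exists_linearMap_le_of_sublinear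
    (fun φ : C(X × Y, ℝ) => sInf (superValues μ ν φ)) (fun c hc φ => by
      refine le_antisymm (hle c hc φ) ?_
      have := hle c⁻¹ (inv_pos.2 hc) (c • φ)
      rw [smul_smul, inv_mul_cancel₀ hc.ne', one_smul] at this
      rwa [le_inv_mul_iff₀ hc] at this)
    (fun φ ψ => by
      have h3 : ∀ s ∈ superValues μ ν φ, sInf (superValues μ ν (φ + ψ)) - s ≤
          sInf (superValues μ ν ψ) := fun s hs =>
        le_csInf (nonempty_superValues ψ) fun t ht => by
          have := csInf_le (bddBelow_superValues _) (add_mem_superValues hs ht)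
          linarith
      have h4 : sInf (superValues μ ν (φ + ψ)) - sInf (superValues μ ν ψ) ≤
          sInf (superValues μ ν φ) :=
        le_csInf (nonempty_superValues φ) fun s hs => by have := h3 s hs; linarith
      show sInf _ ≤ sInf _ + sInf _
      linarith) w
  exact ⟨Λ, h1, fun φ s hs => (h2 φ).trans (csInf_le (bddBelow_superValues φ) hs)⟩

theorem exists_measure_eq_integral {Z : Type*} [TopologicalSpace Z] [CompactSpace Z] [T2Space Z]
    [MeasurableSpace Z] [BorelSpace Z] (Λ : C(Z, ℝ) →ₗ[ℝ] ℝ)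
    (hΛ : ∀ φ : C(Z, ℝ), (∀ z, 0 ≤ φ z) → 0 ≤ Λ φ) :
    ∃ γ : Measure Z, IsFiniteMeasure γ ∧ ∀ φ : C(Z, ℝ), ∫ z, φ z ∂γ = Λ φ := by
  let Λ' : CompactlySupportedContinuousMap Z ℝ →ₗ[ℝ] ℝ :=
    { toFun := fun f => Λ f.toContinuousMap
      map_add' := fun f g => Λ.map_add f.toContinuousMap g.toContinuousMap
      map_smul' := fun c f => Λ.map_smul c f.toContinuousMap }
  let P : CompactlySupportedContinuousMap Z ℝ →ₚ[ℝ] ℝ :=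
    PositiveLinearMap.mk₀ Λ' fun f hf => hΛ f.toContinuousMap fun z => hf z
  refine ⟨RealRMK.rieszMeasure P, inferInstance, fun φ => ?_⟩
  exact RealRMK.integral_rieszMeasure P (CompactlySupportedContinuousMap.continuousMapEquiv φ)

variable (μ ν) in
/-- Kantorovich duality on compact spaces. -/
theorem exists_plan_of_compact (c : C(X × Y, ℝ)) :
    ∃ γ : Measure (X × Y), γ.map Prod.fst = μ ∧ γ.map Prod.snd = ν ∧
      ∀ ε > 0, ∃ (g : C(X, ℝ)) (h : C(Y, ℝ)), (∀ x y, g x + h y ≤ c (x, y)) ∧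
        ∫ z, c z ∂γ < ∫ x, g x ∂μ + ∫ y, h y ∂ν + ε := by
  -- Contact at `-c` is what excludes a duality gap: `-Λ(-c)` is the supremum of the dual problem
  -- and also the cost of the plan representing `Λ`.
  obtain ⟨Λ, hΛc, hΛ⟩ := exists_linearMap_le_superValues (μ := μ) (ν := ν) (-c)
  have hpos : ∀ φ : C(X × Y, ℝ), (∀ z, 0 ≤ φ z) → 0 ≤ Λ φ := fun φ hφ => by
    have := hΛ (-φ) 0 ⟨0, 0, fun x y => by simpa using hφ (x, y), by simp⟩
    rw [map_neg] at this
    linarith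
  obtain ⟨γ, hγf, hγ⟩ := exists_measure_eq_integral Λ hpos
  have hle : ∀ (g : C(X, ℝ)) (h : C(Y, ℝ)),
      Λ (g.comp ⟨Prod.fst, continuous_fst⟩ + h.comp ⟨Prod.snd, continuous_snd⟩) ≤
        ∫ x, g x ∂μ + ∫ y, h y ∂ν := fun g h => hΛ _ _ ⟨g, h, fun x y => le_rfl, rfl⟩
  -- Applying the inequality to `(-g, -h)` as well turns it into an equality; this prescribes both
  -- marginals.
  have heq : ∀ (g : C(X, ℝ)) (h : C(Y, ℝ)),
      Λ (g.comp ⟨Prod.fst, continuous_fst⟩ + h.comp ⟨Prod.snd, continuous_snd⟩) =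
        ∫ x, g x ∂μ + ∫ y, h y ∂ν := fun g h => by
    refine le_antisymm (hle g h) ?_
    have h1 := hle (-g) (-h)
    have h2 : ((-g).comp (⟨Prod.fst, continuous_fst⟩ : C(X × Y, X)) +
        (-h).comp ⟨Prod.snd, continuous_snd⟩) =
        -(g.comp ⟨Prod.fst, continuous_fst⟩ + h.comp ⟨Prod.snd, continuous_snd⟩) := by
      ext z; simp; ring
    rw [h2, map_neg] at h1
    simp only [ContinuousMap.neg_apply, integral_neg] at h1
    linarith
  refine ⟨γ, ?_, ?_, fun ε hε => ?_⟩
  · refine ext_of_forall_integral_eq_of_IsFiniteMeasure fun g => ?_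
    rw [integral_map measurable_fst.aemeasurable
      g.continuous.measurable.aestronglyMeasurable]
    have h1 := heq g.toContinuousMap 0
    rw [← hγ] at h1
    simpa using h1
  · refine ext_of_forall_integral_eq_of_IsFiniteMeasure fun h => ?_
    rw [integral_map measurable_snd.aemeasurable
      h.continuous.measurable.aestronglyMeasurable]
    have h1 := heq 0 h.toContinuousMap
    rw [← hγ] at h1
    simpa using h1
  · obtain ⟨s, ⟨g, h, hgh, rfl⟩, hs⟩ :=
      exists_lt_of_csInf_lt (nonempty_superValues (μ := μ) (ν := ν) (-c))
        (lt_add_of_pos_right _ hε)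
    refine ⟨-g, -h, fun x y => ?_, ?_⟩
    · have := hgh x y
      simp only [ContinuousMap.neg_apply] at this ⊢
      linarith
    · rw [← hΛc, map_neg, ← hγ] at hs
      simp only [ContinuousMap.neg_apply, integral_neg]
      linarith

/-- Moving the constant `max g` from `g` to `h` gives `g ≤ 0` and `h ≤ ‖c‖`. Truncating below at
`-2‖c‖` and `-‖c‖` then increases both integrals, and any sum involving a truncated value is at most
`-‖c‖ ≤ c`. -/
theorem exists_bounded_pair {c : C(X × Y, ℝ)} {g : C(X, ℝ)} {h : C(Y, ℝ)}
    (hgh : ∀ x y, g x + h y ≤ c (x, y)) :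
    ∃ (g' : C(X, ℝ)) (h' : C(Y, ℝ)), (∀ x y, g' x + h' y ≤ c (x, y)) ∧
      (∀ x, |g' x| ≤ 2 * ‖c‖) ∧ (∀ y, |h' y| ≤ ‖c‖) ∧
      ∫ x, g x ∂μ + ∫ y, h y ∂ν ≤ ∫ x, g' x ∂μ + ∫ y, h' y ∂ν := by
  have : Nonempty X := nonempty_of_isProbabilityMeasure μ
  obtain ⟨x₀, -, hx₀⟩ := isCompact_univ.exists_isMaxOn univ_nonempty g.continuous.continuousOn
  have hg : ∀ x, g x ≤ g x₀ := fun x => hx₀ (mem_univ x)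
  have hc : ∀ z, |c z| ≤ ‖c‖ := fun z => c.norm_coe_le_norm z
  have hh : ∀ y, h y + g x₀ ≤ ‖c‖ := fun y => by
    have := hgh x₀ y
    have := (abs_le.1 (hc (x₀, y))).2
    linarith
  have hc0 : 0 ≤ ‖c‖ := norm_nonneg c
  refine ⟨(g - ContinuousMap.const X (g x₀)) ⊔ ContinuousMap.const X (-(2 * ‖c‖)),
    (h + ContinuousMap.const Y (g x₀)) ⊔ ContinuousMap.const Y (-‖c‖), fun x y => ?_, fun x => ?_,
    fun y => ?_, ?_⟩
  · simp only [ContinuousMap.sup_apply, ContinuousMap.sub_apply, ContinuousMap.add_apply,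
      ContinuousMap.const_apply]
    have h1 := hgh x y
    have h2 := (abs_le.1 (hc (x, y))).1
    have h3 := hg x
    have h4 := hh y
    rcases max_choice (g x - g x₀) (-(2 * ‖c‖)) with h5 | h5 <;>
    rcases max_choice (h y + g x₀) (-‖c‖) with h6 | h6 <;> rw [h5, h6] <;> linarith
  · simp only [ContinuousMap.sup_apply, ContinuousMap.sub_apply, ContinuousMap.const_apply]
    have h3 := hg x
    exact abs_le.2 ⟨le_max_right _ _, max_le (by linarith) (by linarith)⟩
  · simp only [ContinuousMap.sup_apply, ContinuousMap.add_apply, ContinuousMap.const_apply]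
    exact abs_le.2 ⟨le_max_right _ _, max_le (hh y) (by linarith)⟩
  · have h1 := integral_mono (μ := μ) (integrable_continuousMap μ (g - ContinuousMap.const X (g x₀)))
      (integrable_continuousMap μ ((g - ContinuousMap.const X (g x₀)) ⊔
        ContinuousMap.const X (-(2 * ‖c‖)))) fun x => le_max_left _ _
    have h2 := integral_mono (μ := ν) (integrable_continuousMap ν (h + ContinuousMap.const Y (g x₀)))
      (integrable_continuousMap ν ((h + ContinuousMap.const Y (g x₀)) ⊔
        ContinuousMap.const Y (-‖c‖))) fun x => le_max_left _ _
    have h3 : ∫ x, (g - ContinuousMap.const X (g x₀)) x ∂μ = ∫ x, g x ∂μ - g x₀ := by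
      simp only [ContinuousMap.sub_apply, ContinuousMap.const_apply]
      rw [integral_sub (integrable_continuousMap μ g) (integrable_const _)]
      simp
    have h4 : ∫ x, (h + ContinuousMap.const Y (g x₀)) x ∂ν = ∫ x, h x ∂ν + g x₀ := by
      simp only [ContinuousMap.add_apply, ContinuousMap.const_apply]
      rw [integral_add (integrable_continuousMap ν h) (integrable_const _)]
      simp
    linarith

theorem exists_seq_tendsto_ae_zero_of_integral_le {Z : Type*} [MeasurableSpace Z] {γ : Measure Z}
    [IsFiniteMeasure γ] {f : ℕ → Z → ℝ} (hf : ∀ k, Integrable (f k) γ) (h0 : ∀ k z, 0 ≤ f k z)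
    (hle : ∀ k : ℕ, ∫ z, f k z ∂γ ≤ 1 / ((k : ℝ) + 1)) :
    ∃ ns : ℕ → ℕ, ∀ᵐ z ∂γ, Filter.Tendsto (fun k => f (ns k) z) Filter.atTop (𝓝 0) := by
  have h1 : Filter.Tendsto (fun k => eLpNorm (f k - 0) 1 γ) Filter.atTop (𝓝 0) := by
    have h2 : ∀ k, eLpNorm (f k - 0) 1 γ = ENNReal.ofReal (∫ z, f k z ∂γ) := fun k => by
      rw [sub_zero, eLpNorm_one_eq_lintegral_enorm,
        ofReal_integral_eq_lintegral_ofReal (hf k) (Filter.Eventually.of_forall (h0 k))]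
      exact lintegral_congr fun z => Real.enorm_of_nonneg (h0 k z)
    simp_rw [h2]
    rw [← ENNReal.ofReal_zero]
    refine (ENNReal.continuous_ofReal.tendsto 0).comp ?_
    exact squeeze_zero (fun k => integral_nonneg (h0 k)) hle tendsto_one_div_add_atTop_nhds_zero_nat
  obtain ⟨ns, -, hns⟩ := (tendstoInMeasure_of_tendsto_eLpNorm one_ne_zero
    (fun k => (hf k).aestronglyMeasurable) aestronglyMeasurable_zero h1).exists_seq_tendsto_ae
  exact ⟨ns, hns⟩

theorem isBoundedUnder_of_abs_le {f : ℕ → ℝ} {C : ℝ} (h : ∀ k, |f k| ≤ C) :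
    Filter.IsBoundedUnder (· ≤ ·) Filter.atTop f ∧ Filter.IsBoundedUnder (· ≥ ·) Filter.atTop f :=
  ⟨Filter.isBoundedUnder_of ⟨C, fun k => (abs_le.1 (h k)).2⟩,
    Filter.isBoundedUnder_of ⟨-C, fun k => (abs_le.1 (h k)).1⟩⟩

theorem abs_limsup_le {f : ℕ → ℝ} {C : ℝ} (h : ∀ k, |f k| ≤ C) :
    |Filter.limsup f Filter.atTop| ≤ C := by
  obtain ⟨h1, h2⟩ := isBoundedUnder_of_abs_le h
  refine abs_le.2 ⟨?_, ?_⟩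
  · exact Filter.le_limsup_of_frequently_le
      (Filter.Frequently.of_forall fun k => (abs_le.1 (h k)).1) h1
  · exact Filter.limsup_le_of_le h2.isCoboundedUnder_le
      (Filter.Eventually.of_forall fun k => (abs_le.1 (h k)).2)

/-- Taking `liminf` for one function and `limsup` for the other preserves the constraint at every
pair of points, because `liminf (c - g) = c - limsup g`. Neither sequence needs to converge. -/
theorem liminf_le_const_sub_limsup {f g : ℕ → ℝ} {c C : ℝ} (hf : ∀ k, |f k| ≤ C)
    (hg : ∀ k, |g k| ≤ C) (h : ∀ᶠ k in Filter.atTop, f k ≤ c - g k) :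
    Filter.liminf f Filter.atTop ≤ c - Filter.limsup g Filter.atTop := by
  obtain ⟨h1, h2⟩ := isBoundedUnder_of_abs_le hf
  obtain ⟨h3, h4⟩ := isBoundedUnder_of_abs_le hg
  have h5 : ∀ k, |c - g k| ≤ |c| + C := fun k => (abs_sub _ _).trans (by linarith [hg k])
  rw [← liminf_const_sub Filter.atTop g c h3 h4.isCoboundedUnder_le]
  exact Filter.liminf_le_liminf h h2 (isBoundedUnder_of_abs_le h5).1.isCoboundedUnder_ge

theorem const_sub_limsup_le_liminf {f g : ℕ → ℝ} {c C : ℝ} (hf : ∀ k, |f k| ≤ C)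
    (hg : ∀ k, |g k| ≤ C) (h : ∀ᶠ k in Filter.atTop, c - g k ≤ f k) :
    c - Filter.limsup g Filter.atTop ≤ Filter.liminf f Filter.atTop := by
  obtain ⟨h1, h2⟩ := isBoundedUnder_of_abs_le hf
  obtain ⟨h3, h4⟩ := isBoundedUnder_of_abs_le hg
  have h5 : ∀ k, |c - g k| ≤ |c| + C := fun k => (abs_sub _ _).trans (by linarith [hg k])
  rw [← liminf_const_sub Filter.atTop g c h3 h4.isCoboundedUnder_le]
  exact Filter.liminf_le_liminf h (isBoundedUnder_of_abs_le h5).2 h1.isCoboundedUnder_ge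

variable (μ ν) in
/-- On compact spaces, there are a plan and a bounded measurable admissible pair that is tight
on it. -/
theorem exists_plan_and_pair_of_compact (c : C(X × Y, ℝ)) :
    ∃ γ : Measure (X × Y), γ.map Prod.fst = μ ∧ γ.map Prod.snd = ν ∧
      ∃ (g : X → ℝ) (h : Y → ℝ) (C : ℝ), Measurable g ∧ Measurable h ∧ (∀ x, |g x| ≤ C) ∧
        (∀ y, |h y| ≤ C) ∧ (∀ x y, g x + h y ≤ c (x, y)) ∧
        ∀ᵐ z ∂γ, g z.1 + h z.2 = c z := by
  obtain ⟨γ, hγ1, hγ2, hγ⟩ := exists_plan_of_compact μ ν c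
  have hprob : IsProbabilityMeasure γ := by
    refine ⟨?_⟩
    have h1 : γ.map Prod.fst univ = 1 := by rw [hγ1]; exact measure_univ
    rwa [Measure.map_apply measurable_fst MeasurableSet.univ, preimage_univ] at h1
  have hseq : ∀ k : ℕ, ∃ (g : C(X, ℝ)) (h : C(Y, ℝ)), (∀ x y, g x + h y ≤ c (x, y)) ∧
      (∀ x, |g x| ≤ 2 * ‖c‖) ∧ (∀ y, |h y| ≤ ‖c‖) ∧
      ∫ z, c z ∂γ ≤ ∫ x, g x ∂μ + ∫ y, h y ∂ν + 1 / ((k : ℝ) + 1) := fun k => by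
    obtain ⟨g, h, h1, h2⟩ := hγ (1 / ((k : ℝ) + 1)) (by positivity)
    obtain ⟨g', h', h3, h4, h5, h6⟩ := exists_bounded_pair (μ := μ) (ν := ν) h1
    exact ⟨g', h', h3, h4, h5, by linarith⟩
  choose g h hle hgb hhb hint using hseq
  have hgi : ∀ k, Integrable (fun z : X × Y => g k z.1) γ := fun k =>
    integrable_continuousMap γ ((g k).comp ⟨Prod.fst, continuous_fst⟩)
  have hhi : ∀ k, Integrable (fun z : X × Y => h k z.2) γ := fun k =>
    integrable_continuousMap γ ((h k).comp ⟨Prod.snd, continuous_snd⟩)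
  have hgm : ∀ k, ∫ z, g k z.1 ∂γ = ∫ x, g k x ∂μ := fun k => by
    rw [← hγ1, integral_map measurable_fst.aemeasurable
      (g k).continuous.measurable.aestronglyMeasurable]
  have hhm : ∀ k, ∫ z, h k z.2 ∂γ = ∫ y, h k y ∂ν := fun k => by
    rw [← hγ2, integral_map measurable_snd.aemeasurable
      (h k).continuous.measurable.aestronglyMeasurable]
  obtain ⟨ns, hns⟩ := exists_seq_tendsto_ae_zero_of_integral_le (γ := γ)
    (f := fun k z => c z - (g k z.1 + h k z.2))
    (fun k => (integrable_continuousMap γ c).sub ((hgi k).add (hhi k)))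
    (fun k z => sub_nonneg.2 (hle k z.1 z.2)) (fun k => by
      have hsum : Integrable (fun z : X × Y => g k z.1 + h k z.2) γ := (hgi k).add (hhi k)
      rw [integral_sub (integrable_continuousMap γ c) hsum, integral_add (hgi k) (hhi k), hgm, hhm]
      linarith [hint k])
  have hc0 : 0 ≤ ‖c‖ := norm_nonneg c
  have hhb' : ∀ k y, |h k y| ≤ 2 * ‖c‖ := fun k y => (hhb k y).trans (by linarith)
  refine ⟨γ, hγ1, hγ2, fun x => Filter.liminf (fun k => g (ns k) x) Filter.atTop,
    fun y => Filter.limsup (fun k => h (ns k) y) Filter.atTop, 2 * ‖c‖,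
    Measurable.liminf fun k => (g (ns k)).continuous.measurable,
    Measurable.limsup fun k => (h (ns k)).continuous.measurable, fun x => ?_,
    fun y => abs_limsup_le fun k => hhb' (ns k) y, fun x y => ?_, ?_⟩
  · obtain ⟨h1, h2⟩ := isBoundedUnder_of_abs_le fun k => hgb (ns k) x
    refine abs_le.2 ⟨?_, ?_⟩
    · exact Filter.le_liminf_of_le h1.isCoboundedUnder_ge
        (Filter.Eventually.of_forall fun k => (abs_le.1 (hgb (ns k) x)).1)
    · exact (Filter.liminf_le_limsup h1 h2).trans
        (abs_le.1 (abs_limsup_le fun k => hgb (ns k) x)).2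
  · have := liminf_le_const_sub_limsup (c := c (x, y)) (fun k => hgb (ns k) x)
      (fun k => hhb' (ns k) y)
      (Filter.Eventually.of_forall fun k => by have := hle (ns k) x y; linarith)
    linarith
  · filter_upwards [hns] with z hz
    have h1 := liminf_le_const_sub_limsup (c := c z) (fun k => hgb (ns k) z.1)
      (fun k => hhb' (ns k) z.2)
      (Filter.Eventually.of_forall fun k => by have := hle (ns k) z.1 z.2; linarith)
    -- Where the gap `c - (g_k + h_k)` tends to zero, the constraint is reversed up to `ε` for large
    -- `k`, and this too survives in the limit.
    refine le_antisymm (by linarith) (le_of_forall_pos_le_add fun ε hε => ?_)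
    have h2 := const_sub_limsup_le_liminf (c := c z - ε) (fun k => hgb (ns k) z.1)
      (fun k => hhb' (ns k) z.2) (by
        filter_upwards [hz.eventually (gt_mem_nhds hε)] with k hk
        linarith)
    linarith

end CompactDuality

/-! ### Plans, dual pairs and optimal maps -/

section Plans

variable {M : Type*} [TopologicalSpace M] [T2Space M] [SecondCountableTopology M]
  [MeasurableSpace M] [BorelSpace M] {c : M → M → ℝ} {μ ν : Measure M}

theorem isProbabilityMeasure_comap_subtype {μ : Measure M} [IsProbabilityMeasure μ] {K : Set M}
    (hK : IsCompact K) (hμK : μ Kᶜ = 0) :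
    IsProbabilityMeasure (μ.comap (Subtype.val : K → M)) ∧
      (μ.comap (Subtype.val : K → M)).map Subtype.val = μ := by
  have h1 : (μ.comap (Subtype.val : K → M)).map Subtype.val = μ := by
    rw [map_comap_subtype_coe hK.measurableSet]
    exact Measure.restrict_eq_self_of_ae_mem (by rwa [ae_iff])
  refine ⟨⟨?_⟩, h1⟩
  have h2 : (μ.comap (Subtype.val : K → M)).map Subtype.val univ = 1 := by
    rw [h1]; exact measure_univ
  rwa [Measure.map_apply measurable_subtype_coe MeasurableSet.univ, preimage_univ] at h2

theorem exists_plan_and_pair [IsProbabilityMeasure μ] [IsProbabilityMeasure ν]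
    (hc : Continuous fun p : M × M => c p.1 p.2) {K₁ K₂ : Set M} (hK₁ : IsCompact K₁)
    (hK₂ : IsCompact K₂) (hμ : μ K₁ᶜ = 0) (hν : ν K₂ᶜ = 0) :
    ∃ γ : Measure (M × M), γ.map Prod.fst = μ ∧ γ.map Prod.snd = ν ∧
      ∃ (g h : M → ℝ) (C : ℝ), Measurable g ∧ Measurable h ∧ (∀ x ∈ K₁, |g x| ≤ C) ∧
        (∀ y ∈ K₂, |h y| ≤ C) ∧ (∀ x ∈ K₁, ∀ y ∈ K₂, g x + h y ≤ c x y) ∧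
        ∀ᵐ z ∂γ, g z.1 + h z.2 = c z.1 z.2 := by
  obtain ⟨hμp, hμm⟩ := isProbabilityMeasure_comap_subtype hK₁ hμ
  obtain ⟨hνp, hνm⟩ := isProbabilityMeasure_comap_subtype hK₂ hν
  have : CompactSpace K₁ := isCompact_iff_compactSpace.1 hK₁
  have : CompactSpace K₂ := isCompact_iff_compactSpace.1 hK₂
  obtain ⟨γ, h1, h2, g, h, C, hg, hh, hgC, hhC, hle, heq⟩ := exists_plan_and_pair_of_compact
    (μ.comap (Subtype.val : K₁ → M)) (ν.comap (Subtype.val : K₂ → M))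
    ⟨fun z : K₁ × K₂ => c z.1 z.2, hc.comp ((continuous_subtype_val.comp
      continuous_fst).prodMk (continuous_subtype_val.comp continuous_snd))⟩
  have hval : Measurable (Prod.map Subtype.val Subtype.val : K₁ × K₂ → M × M) :=
    measurable_subtype_coe.prodMap measurable_subtype_coe
  have e1 := MeasurableEmbedding.subtype_coe hK₁.measurableSet
  have e2 := MeasurableEmbedding.subtype_coe hK₂.measurableSet
  have hgv : ∀ x : K₁, Function.extend Subtype.val g 0 (x : M) = g x := fun x =>
    Subtype.val_injective.extend_apply g 0 x
  have hhv : ∀ y : K₂, Function.extend Subtype.val h 0 (y : M) = h y := fun y =>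
    Subtype.val_injective.extend_apply h 0 y
  have hgm : Measurable (Function.extend (Subtype.val : K₁ → M) g 0) :=
    e1.measurable_extend hg measurable_zero
  have hhm : Measurable (Function.extend (Subtype.val : K₂ → M) h 0) :=
    e2.measurable_extend hh measurable_zero
  refine ⟨γ.map (Prod.map Subtype.val Subtype.val), ?_, ?_,
    Function.extend Subtype.val g 0, Function.extend Subtype.val h 0, C, hgm, hhm,
    fun x hx => ?_, fun y hy => ?_, fun x hx y hy => ?_, ?_⟩
  · rw [Measure.map_map measurable_fst hval, ← hμm, ← h1,
      Measure.map_map measurable_subtype_coe measurable_fst]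
    rfl
  · rw [Measure.map_map measurable_snd hval, ← hνm, ← h2,
      Measure.map_map measurable_subtype_coe measurable_snd]
    rfl
  · rw [hgv ⟨x, hx⟩]; exact hgC _
  · rw [hhv ⟨y, hy⟩]; exact hhC _
  · rw [hgv ⟨x, hx⟩, hhv ⟨y, hy⟩]; exact hle _ _
  · rw [ae_map_iff hval.aemeasurable]
    · filter_upwards [heq] with z hz
      simp only [Prod.map_fst, Prod.map_snd, hgv, hhv]
      exact hz
    · exact measurableSet_eq_fun ((hgm.comp measurable_fst).add (hhm.comp measurable_snd))
        hc.measurable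

theorem add_le_coe_toReal {a b : EReal} {r : ℝ} (ha : a ≠ ⊤) (ha' : a ≠ ⊥) (hb : b ≠ ⊤)
    (hb' : b ≠ ⊥) (h : a + b ≤ r) : a.toReal + b.toReal ≤ r := by
  lift a to ℝ using ⟨ha, ha'⟩
  lift b to ℝ using ⟨hb, hb'⟩
  exact_mod_cast h

theorem IsDualPair.ae_le {g h : M → EReal} (hgh : IsDualPair c μ ν g h)
    {π : Measure (M × M)} (h1 : π.map Prod.fst = μ) (h2 : π.map Prod.snd = ν) :
    ∀ᵐ z ∂π, g z.1 ≠ ⊥ ∧ h z.2 ≠ ⊥ ∧ (g z.1).toReal + (h z.2).toReal ≤ c z.1 z.2 := by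
  obtain ⟨⟨hg1, hg2, -⟩, ⟨hh1, hh2, -⟩, hle⟩ := hgh
  rw [← h1] at hg2
  rw [← h2] at hh2
  filter_upwards [ae_of_ae_map measurable_fst.aemeasurable hg2,
    ae_of_ae_map measurable_snd.aemeasurable hh2] with z hz1 hz2
  exact ⟨hz1, hz2, add_le_coe_toReal (hg1 _) hz1 (hh1 _) hz2 (hle _ _)⟩

theorem IsDualPair.integrable_and_dualValue_eq {g h : M → EReal} (hgh : IsDualPair c μ ν g h)
    {π : Measure (M × M)} (h1 : π.map Prod.fst = μ) (h2 : π.map Prod.snd = ν) :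
    Integrable (fun z : M × M => (g z.1).toReal + (h z.2).toReal) π ∧
      dualValue μ ν g h = ∫ z, ((g z.1).toReal + (h z.2).toReal) ∂π := by
  obtain ⟨⟨-, -, hg⟩, ⟨-, -, hh⟩, -⟩ := hgh
  have hg' : Integrable (fun x => (g x).toReal) (π.map Prod.fst) := by rwa [h1]
  have hh' : Integrable (fun x => (h x).toReal) (π.map Prod.snd) := by rwa [h2]
  have hg'' : Integrable (fun z : M × M => (g z.1).toReal) π :=
    hg'.comp_measurable measurable_fst
  have hh'' : Integrable (fun z : M × M => (h z.2).toReal) π :=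
    hh'.comp_measurable measurable_snd
  refine ⟨hg''.add hh'', ?_⟩
  rw [integral_add hg'' hh'', dualValue]
  congr 1
  · rw [← integral_map measurable_fst.aemeasurable hg'.aestronglyMeasurable, h1]
  · rw [← integral_map measurable_snd.aemeasurable hh'.aestronglyMeasurable, h2]

theorem IsDualPair.dualValue_le {g h : M → EReal} (hgh : IsDualPair c μ ν g h)
    {π : Measure (M × M)} (h1 : π.map Prod.fst = μ) (h2 : π.map Prod.snd = ν)
    (hc : Integrable (fun z : M × M => c z.1 z.2) π) :
    dualValue μ ν g h ≤ ∫ z, c z.1 z.2 ∂π := by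
  obtain ⟨hi, he⟩ := hgh.integrable_and_dualValue_eq h1 h2
  rw [he]
  exact integral_mono_ae hi hc ((hgh.ae_le h1 h2).mono fun z hz => hz.2.2)

/-- Complementary slackness: the gap is nonnegative a.e. and has zero integral. It serves both for
the plan from duality and for plans carried by graphs. -/
theorem IsDualPair.ae_eq {g h : M → EReal} (hgh : IsDualPair c μ ν g h)
    {π : Measure (M × M)} (h1 : π.map Prod.fst = μ) (h2 : π.map Prod.snd = ν)
    (hc : Integrable (fun z : M × M => c z.1 z.2) π)
    (hle : ∫ z, c z.1 z.2 ∂π ≤ dualValue μ ν g h) :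
    ∀ᵐ z ∂π, g z.1 ≠ ⊥ ∧ h z.2 ≠ ⊥ ∧ (g z.1).toReal + (h z.2).toReal = c z.1 z.2 := by
  obtain ⟨hi, he⟩ := hgh.integrable_and_dualValue_eq h1 h2
  have hae := hgh.ae_le h1 h2
  have h0 : ∫ z, (c z.1 z.2 - ((g z.1).toReal + (h z.2).toReal)) ∂π = 0 := by
    rw [integral_sub hc hi, ← he]
    exact sub_eq_zero.2 (le_antisymm hle (hgh.dualValue_le h1 h2 hc))
  have h3 := (integral_eq_zero_iff_of_nonneg_ae
    (hae.mono fun z hz => sub_nonneg.2 hz.2.2) (hc.sub hi)).1 h0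
  filter_upwards [hae, h3] with z hz hz'
  exact ⟨hz.1, hz.2.1, (sub_eq_zero.1 hz').symm⟩

theorem map_graph {T : M → M} (hT : Measurable T) (hTν : μ.map T = ν) :
    (μ.map fun x => (x, T x)).map Prod.fst = μ ∧ (μ.map fun x => (x, T x)).map Prod.snd = ν := by
  have hm : Measurable fun x => (x, T x) := measurable_id.prodMk hT
  rw [Measure.map_map measurable_fst hm, Measure.map_map measurable_snd hm]
  exact ⟨Measure.map_id, hTν⟩

/-- A plan that is concentrated on the graph of a (possibly non-measurable) map is induced by a
Borel map. -/
theorem exists_measurable_of_ae_eq_graph {γ : Measure (M × M)} {K : Set (M × M)}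
    (hK : IsCompact K) (hγK : γ Kᶜ = 0) {D : M → M} (hD : ∀ᵐ z ∂γ, D z.1 = z.2)
    [Nonempty M] :
    ∃ T : M → M, Measurable T ∧ (∀ᵐ z ∂γ, T z.1 = z.2) ∧ ∀ᵐ x ∂(γ.map Prod.fst), T x = D x := by
  -- The graph of `D` may fail to be measurable, so it is replaced by a measurable subset of full
  -- measure inside `K`.
  obtain ⟨Γ, hΓsub, hΓm, hΓ⟩ : ∃ Γ ⊆ {z | D z.1 = z.2} ∩ K, MeasurableSet Γ ∧ γ Γᶜ = 0 := by
    have h0 : γ ({z | D z.1 = z.2} ∩ K)ᶜ = 0 := by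
      rw [compl_inter]
      exact measure_union_null (ae_iff.1 hD) hγK
    refine ⟨(toMeasurable γ ({z | D z.1 = z.2} ∩ K)ᶜ)ᶜ, ?_, (measurableSet_toMeasurable _ _).compl,
      by rw [compl_compl, measure_toMeasurable, h0]⟩
    rw [compl_subset_comm]
    exact subset_toMeasurable _ _
  have : CompactSpace K := isCompact_iff_compactSpace.1 hK
  let _ : MetricSpace K := TopologicalSpace.metrizableSpaceMetric K
  have hpolish : PolishSpace K := inferInstance
  -- The first projection is injective on a graph, and an injective Borel image from the Polish
  -- space `K` is Borel (Lusin–Souslin). Preimages under `D` are such projections.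
  have himage : ∀ B ⊆ Γ, MeasurableSet B → MeasurableSet (Prod.fst '' B) := by
    intro B hB hBm
    have h1 : Prod.fst '' B = (fun z : K => z.1.1) '' (Subtype.val ⁻¹' B) := by
      ext x
      constructor
      · rintro ⟨z, hz, rfl⟩
        exact ⟨⟨z, (hΓsub (hB hz)).2⟩, hz, rfl⟩
      · rintro ⟨z, hz, rfl⟩
        exact ⟨z, hz, rfl⟩
    rw [h1]
    refine (measurable_subtype_coe hBm).image_of_measurable_injOn
      (measurable_fst.comp measurable_subtype_coe) ?_
    rintro ⟨z, hz⟩ hzB ⟨w, hw⟩ hwB (hzw : z.1 = w.1)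
    have h2 : D z.1 = z.2 := (hΓsub (hB hzB)).1
    have h3 : D w.1 = w.2 := (hΓsub (hB hwB)).1
    exact Subtype.ext (Prod.ext hzw (by rw [← h2, ← h3, hzw]))
  classical
  obtain ⟨y₀⟩ := ‹Nonempty M›
  set A : Set M := Prod.fst '' Γ with hA
  have hAm : MeasurableSet A := himage Γ subset_rfl hΓm
  have hDA : ∀ B : Set M, A ∩ D ⁻¹' B = Prod.fst '' (Γ ∩ Prod.snd ⁻¹' B) := by
    intro B
    ext x
    constructor
    · rintro ⟨⟨z, hz, rfl⟩, hB⟩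
      refine ⟨z, ⟨hz, ?_⟩, rfl⟩
      have h2 : D z.1 = z.2 := (hΓsub hz).1
      show z.2 ∈ B
      rw [← h2]; exact hB
    · rintro ⟨z, ⟨hz, hzB⟩, rfl⟩
      refine ⟨⟨z, hz, rfl⟩, ?_⟩
      have h2 : D z.1 = z.2 := (hΓsub hz).1
      show D z.1 ∈ B
      rw [h2]; exact hzB
  have hTA : ∀ x ∈ A, A.piecewise D (fun _ => y₀) x = D x := fun x hx => piecewise_eq_of_mem _ _ _ hx
  refine ⟨A.piecewise D fun _ => y₀, fun B hB => ?_, ?_, ?_⟩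
  · rw [piecewise_preimage, Set.ite, inter_comm, hDA]
    refine (himage _ inter_subset_left (hΓm.inter (measurable_snd hB))).union ?_
    exact (measurable_const hB).diff hAm
  · have : ∀ᵐ z ∂γ, z ∈ Γ := by rwa [ae_iff]
    filter_upwards [this] with z hz
    rw [hTA _ ⟨z, hz, rfl⟩]
    exact (hΓsub hz).1
  · have h1 : (γ.map Prod.fst) Aᶜ = 0 := by
      rw [Measure.map_apply measurable_fst hAm.compl]
      exact measure_mono_null (fun z hz hzΓ => hz ⟨z, hzΓ, rfl⟩) hΓ
    have h2 : ∀ᵐ x ∂(γ.map Prod.fst), x ∈ A := by rwa [ae_iff]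
    exact h2.mono hTA

/-- By `hD`, tightness at `(x, y)` forces `y = D x`. Hence `γ` lives on the graph of `D` and is
induced by a Borel map, optimal by weak duality; the graph of any other optimal map is tight a.e. as
well, so that map also agrees with `D`. -/
theorem exists_isOptimalMap (hc : Continuous fun p : M × M => c p.1 p.2)
    {γ : Measure (M × M)} (h1 : γ.map Prod.fst = μ) (h2 : γ.map Prod.snd = ν)
    {K : Set (M × M)} (hK : IsCompact K) (hγK : γ Kᶜ = 0)
    (hcγ : Integrable (fun z : M × M => c z.1 z.2) γ) {g h : M → EReal}
    (hgh : IsDualPair c μ ν g h) (hle : ∫ z, c z.1 z.2 ∂γ ≤ dualValue μ ν g h) {D : M → M}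
    (hD : ∀ᵐ x ∂μ, ∀ y, h y ≠ ⊥ → (g x).toReal + (h y).toReal = c x y → D x = y) [Nonempty M] :
    ∃ T, IsOptimalMap c μ ν T ∧ (∀ᵐ x ∂μ, T x = D x) ∧
      ∀ T', IsOptimalMap c μ ν T' → T' =ᵐ[μ] T := by
  have hDγ : ∀ᵐ z ∂γ, D z.1 = z.2 := by
    rw [← h1] at hD
    filter_upwards [ae_of_ae_map measurable_fst.aemeasurable hD, hgh.ae_eq h1 h2 hcγ hle]
      with z hz hz'
    exact hz _ hz'.2.1 hz'.2.2
  obtain ⟨T, hTm, hTγ, hTD⟩ := exists_measurable_of_ae_eq_graph hK hγK hDγ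
  rw [h1] at hTD
  have hTν : μ.map T = ν := by
    rw [← h1, ← h2, Measure.map_map hTm measurable_fst]
    exact Measure.map_congr hTγ
  have hsm : ∀ S : M → M, Measurable S → Measurable fun x => c x (S x) := fun S hS =>
    hc.measurable.comp (measurable_id.prodMk hS)
  have hTc : (fun z : M × M => c z.1 (T z.1)) =ᵐ[γ] fun z => c z.1 z.2 :=
    hTγ.mono fun z hz => by simp only [hz]
  have hTint : Integrable (fun x => c x (T x)) μ := by
    rw [← h1, integrable_map_measure (hsm T hTm).aestronglyMeasurable measurable_fst.aemeasurable]
    exact hcγ.congr hTc.symm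
  have hTval : ∫ x, c x (T x) ∂μ = ∫ z, c z.1 z.2 ∂γ := by
    rw [← h1, integral_map measurable_fst.aemeasurable (hsm T hTm).aestronglyMeasurable]
    exact integral_congr_ae hTc
  have hgraph : ∀ S : M → M, Measurable S → Integrable (fun x => c x (S x)) μ →
      Integrable (fun z : M × M => c z.1 z.2) (μ.map fun x => (x, S x)) ∧
        ∫ z, c z.1 z.2 ∂(μ.map fun x => (x, S x)) = ∫ x, c x (S x) ∂μ := fun S hS hSi => by
    have hm : Measurable fun x => (x, S x) := measurable_id.prodMk hS
    refine ⟨?_, integral_map hm.aemeasurable hc.measurable.aestronglyMeasurable⟩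
    rw [integrable_map_measure hc.measurable.aestronglyMeasurable hm.aemeasurable]
    exact hSi
  refine ⟨T, ⟨hTm, hTν, hTint, fun S hS hSν hSi => ?_⟩, hTD, fun T' hT' => ?_⟩
  · obtain ⟨h3, h4⟩ := map_graph hS hSν
    obtain ⟨h5, h6⟩ := hgraph S hS hSi
    have := hgh.dualValue_le h3 h4 h5
    rw [hTval, ← h6]
    exact hle.trans this
  · obtain ⟨hT'm, hT'ν, hT'i, hT'le⟩ := hT'
    obtain ⟨h3, h4⟩ := map_graph hT'm hT'ν
    obtain ⟨h5, h6⟩ := hgraph T' hT'm hT'i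
    have h7 := hT'le T hTm hTν hTint
    have h8 := hgh.ae_eq h3 h4 h5 (by rw [h6]; exact (h7.trans hTval.le).trans hle)
    have h9 := ae_of_ae_map (measurable_id.prodMk hT'm).aemeasurable h8
    filter_upwards [h9, hD, hTD] with x hx hx' hx''
    rw [hx'']
    exact (hx' _ hx.2.1 hx.2.2).symm

end Plans

/-! ### Existence of locally Lipschitz Kantorovich potentials -/

/-- Valid at infinite values too, since `r` is real. It makes the two transforms an antitone Galois
connection without forming sums of opposite infinities. -/
theorem le_coe_sub_comm {a b : EReal} {r : ℝ} : a ≤ (r : EReal) - b ↔ b ≤ (r : EReal) - a := by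
  have hne : ∀ s : ℝ, (r : EReal) - s ≠ ⊤ := fun s => by
    rw [← EReal.coe_sub]
    exact EReal.coe_ne_top _
  induction a <;> induction b <;> try simp [hne]
  norm_cast
  constructor <;> intro h <;> linarith

section Transforms

variable {M : Type*} {c : M → M → ℝ}

theorem le_c₁Transform_iff {f h : M → EReal} :
    h ≤ c₁Transform c f ↔ f ≤ c₂Transform c h := by
  simp only [Pi.le_def, c₁Transform, c₂Transform, le_iInf_iff]
  exact ⟨fun H x y => le_coe_sub_comm.1 (H y x), fun H y x => le_coe_sub_comm.1 (H x y)⟩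

theorem c₂Transform_c₁Transform_c₂Transform (h : M → EReal) :
    c₂Transform c (c₁Transform c (c₂Transform c h)) = c₂Transform c h := by
  refine le_antisymm ?_ (le_c₁Transform_iff.1 le_rfl)
  intro x
  have h1 : h ≤ c₁Transform c (c₂Transform c h) := le_c₁Transform_iff.2 le_rfl
  exact le_iInf fun y => (iInf_le _ y).trans (EReal.sub_le_sub le_rfl (h1 y))

theorem add_c₁Transform_le {f : M → EReal} {x : M} (hf : f x ≠ ⊥) (hf' : f x ≠ ⊤) (y : M) :
    f x + c₁Transform c f y ≤ c x y := by
  have h : c₁Transform c f y ≤ (c x y : EReal) - f x := iInf_le _ x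
  lift f x to ℝ using ⟨hf', hf⟩ with r
  calc (r : EReal) + c₁Transform c f y ≤ r + ((c x y : EReal) - r) := by gcongr
    _ = c x y := by
      rw [← EReal.coe_sub, ← EReal.coe_add]
      congr 1
      ring

end Transforms

section Potential

variable {n : ℕ} {M : Type*} [TopologicalSpace M] [T2Space M] [SecondCountableTopology M]
  [ChartedSpace (E n) M] [MeasurableSpace M] [BorelSpace M] {c : M → M → ℝ}
  {μ ν : Measure M}

/-- A finite cover of `K` makes both the constant and the neighbourhood of `x₀` independent of `y`.
-/
theorem IsLocallyLipschitzInFst.exists_nhds_of_compact (hlip : IsLocallyLipschitzInFst n c)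
    {K : Set M} (hK : IsCompact K) (x₀ : M) :
    ∃ C : ℝ≥0, ∃ V ∈ 𝓝 x₀, V ⊆ (chartAt (E n) x₀).source ∧
      ∀ y ∈ K, ∀ x ∈ V, ∀ x' ∈ V,
        |c x y - c x' y| ≤ C * ‖extChartAt (𝓡 n) x₀ x - extChartAt (𝓡 n) x₀ x'‖ := by
  refine hK.induction_on (p := fun K => ∃ C : ℝ≥0, ∃ V ∈ 𝓝 x₀, V ⊆ (chartAt (E n) x₀).source ∧
      ∀ y ∈ K, ∀ x ∈ V, ∀ x' ∈ V,
        |c x y - c x' y| ≤ C * ‖extChartAt (𝓡 n) x₀ x - extChartAt (𝓡 n) x₀ x'‖) ?_ ?_ ?_ ?_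
  · exact ⟨0, _, chart_source_mem_nhds (E n) x₀, subset_rfl, fun y hy => hy.elim⟩
  · rintro s t hst ⟨C, V, hV, hVs, h⟩
    exact ⟨C, V, hV, hVs, fun y hy => h y (hst hy)⟩
  · rintro s t ⟨C, V, hV, hVs, h⟩ ⟨C', V', hV', hVs', h'⟩
    refine ⟨max C C', V ∩ V', Filter.inter_mem hV hV', inter_subset_left.trans hVs, ?_⟩
    rintro y (hy | hy) x hx x' hx'
    · refine (h y hy x hx.1 x' hx'.1).trans (mul_le_mul_of_nonneg_right ?_ (norm_nonneg _))
      exact_mod_cast le_max_left C C'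
    · refine (h' y hy x hx.2 x' hx'.2).trans (mul_le_mul_of_nonneg_right ?_ (norm_nonneg _))
      exact_mod_cast le_max_right C C'
  · intro y _
    obtain ⟨C, V, hV, W, hW, hVs, h⟩ := hlip x₀ y
    exact ⟨W, mem_nhdsWithin_of_mem_nhds hW, C, V, hV, hVs, h⟩

/-- The function equal to `h` on `K` and to `-∞` outside `K`. -/
def restrictBot (K : Set M) (h : M → ℝ) (y : M) : EReal :=
  open Classical in if y ∈ K then (h y : EReal) else ⊥

/-- Points outside `K` contribute `+∞` to the infimum and disappear. -/
theorem le_c₂Transform_restrictBot_iff {K : Set M} {h : M → ℝ} {a : ℝ} {x : M} :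
    (a : EReal) ≤ c₂Transform c (restrictBot K h) x ↔ ∀ y ∈ K, a + h y ≤ c x y := by
  rw [c₂Transform, le_iInf_iff]
  refine forall_congr' fun y => ?_
  by_cases hy : y ∈ K
  · rw [restrictBot, if_pos hy, forall_prop_of_true hy, ← EReal.coe_sub, EReal.coe_le_coe_iff]
    constructor <;> intro h <;> linarith
  · simp [restrictBot, hy]

theorem c₂Transform_restrictBot_eq_coe (hc : Continuous fun p : M × M => c p.1 p.2) {K : Set M}
    (hK : IsCompact K) (hne : K.Nonempty) {h : M → ℝ} {C : ℝ} (hh : ∀ y ∈ K, |h y| ≤ C) :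
    ∃ f : M → ℝ, ∀ x, c₂Transform c (restrictBot K h) x = f x := by
  obtain ⟨y₀, hy₀⟩ := hne
  have : ∀ x, ∃ r : ℝ, c₂Transform c (restrictBot K h) x = r := by
    intro x
    have h1 : c₂Transform c (restrictBot K h) x ≠ ⊤ := by
      refine ne_top_of_le_ne_top (EReal.coe_ne_top (c x y₀ - h y₀)) ((iInf_le _ y₀).trans ?_)
      simp only [restrictBot, if_pos hy₀]
      exact le_rfl
    have h2 : c₂Transform c (restrictBot K h) x ≠ ⊥ := by
      have hcx : ContinuousOn (fun y => c x y) K :=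
        (hc.comp (continuous_const.prodMk continuous_id)).continuousOn
      obtain ⟨B, hB⟩ := hK.exists_bound_of_continuousOn hcx
      refine ne_bot_of_le_ne_bot (EReal.coe_ne_bot (-B - C)) (le_c₂Transform_restrictBot_iff.2 ?_)
      intro y hy
      have h3 := neg_le_of_abs_le (hB y hy)
      have h4 := le_of_abs_le (hh y hy)
      linarith
    exact ⟨_, (EReal.coe_toReal h1 h2).symm⟩
  choose f hf using this
  exact ⟨f, hf⟩

/-- An infimum of functions with a common local Lipschitz constant; `hf` expresses the infimum over
`K` in real terms. -/
theorem isLocallyLipschitzOn_of_forall_le_iff (hlip : IsLocallyLipschitzInFst n c) {K : Set M}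
    (hK : IsCompact K) {f h : M → ℝ} (hf : ∀ (a : ℝ) (x : M), a ≤ f x ↔ ∀ y ∈ K, a + h y ≤ c x y) :
    IsLocallyLipschitzOn n f univ := by
  intro x₀ _
  obtain ⟨C, V, hV, hVs, hle⟩ := hlip.exists_nhds_of_compact hK x₀
  have key : ∀ x ∈ V, ∀ x' ∈ V,
      f x - C * ‖extChartAt (𝓡 n) x₀ x - extChartAt (𝓡 n) x₀ x'‖ ≤ f x' := by
    intro x hx x' hx'
    refine (hf _ _).2 fun y hy => ?_
    have h1 := (hf _ _).1 (le_refl (f x)) y hy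
    have h2 := (abs_le.1 (hle y hy x hx x' hx')).2
    linarith
  refine ⟨C, V, by rwa [nhdsWithin_univ], hVs, fun x hx x' hx' => abs_le.2 ⟨?_, ?_⟩⟩
  · have := key x' hx' x hx
    rw [norm_sub_rev] at this
    linarith
  · have := key x hx x' hx'
    linarith

theorem IsLocallyLipschitzOn.continuous {f : M → ℝ} (hf : IsLocallyLipschitzOn n f univ) :
    Continuous f := by
  refine continuous_iff_continuousAt.2 fun x₀ => ?_
  obtain ⟨C, V, hV, hVs, hle⟩ := hf x₀ (mem_univ _)
  rw [nhdsWithin_univ] at hV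
  refine tendsto_iff_dist_tendsto_zero.2 ?_
  have h1 : Filter.Tendsto (fun x => C * ‖extChartAt (𝓡 n) x₀ x - extChartAt (𝓡 n) x₀ x₀‖)
      (𝓝 x₀) (𝓝 0) := by
    have h2 : Filter.Tendsto (fun x => ‖extChartAt (𝓡 n) x₀ x - extChartAt (𝓡 n) x₀ x₀‖)
        (𝓝 x₀) (𝓝 0) :=
      tendsto_iff_norm_sub_tendsto_zero.1 (continuousAt_extChartAt (I := 𝓡 n) x₀)
    simpa using h2.const_mul (C : ℝ)
  refine squeeze_zero' (Filter.Eventually.of_forall fun x => dist_nonneg) ?_ h1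
  filter_upwards [hV] with x hx
  rw [Real.dist_eq]
  exact hle x hx x₀ (mem_of_mem_nhds hV)

theorem integrable_of_abs_le_on {μ : Measure M} [IsFiniteMeasure μ] {K : Set M} (hμ : μ Kᶜ = 0)
    {f : M → ℝ} (hf : Measurable f) {C : ℝ} (hC : ∀ x ∈ K, |f x| ≤ C) : Integrable f μ := by
  have h : ∀ᵐ x ∂μ, x ∈ K := by rwa [ae_iff]
  exact Integrable.of_bound hf.aestronglyMeasurable C (h.mono hC)

/-- Start from a pair `(g, h)` tight on a plan over `K₁ ×ˢ K₂`, and let `f` be the transform of `h`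
restricted to `K₂`. Being an infimum over a compact set, `f` is finite and locally Lipschitz on all
of `M`. Moreover `f ≥ g` on `K₁` and `f^{c₁} ≥ h` on `K₂`, so the new pair costs nothing in dual
value and inherits optimality. -/
theorem exists_isKantorovichPotential [IsProbabilityMeasure μ] [IsProbabilityMeasure ν]
    (hc : Continuous fun p : M × M => c p.1 p.2) (hlip : IsLocallyLipschitzInFst n c)
    {K₁ K₂ : Set M} (hK₁ : IsCompact K₁) (hK₂ : IsCompact K₂) (hμ : μ K₁ᶜ = 0) (hν : ν K₂ᶜ = 0) :
    ∃ f : M → EReal, IsKantorovichPotential c μ ν f ∧ IsFiniteLocallyLipschitzOn n f univ ∧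
      ∃ γ : Measure (M × M), γ.map Prod.fst = μ ∧ γ.map Prod.snd = ν ∧ γ (K₁ ×ˢ K₂)ᶜ = 0 ∧
        Integrable (fun z : M × M => c z.1 z.2) γ ∧
        ∫ z, c z.1 z.2 ∂γ ≤ dualValue μ ν f (c₁Transform c f) := by
  obtain ⟨γ, h1, h2, g, h, C, hgm, hhm, hgC, hhC, hle, heq⟩ :=
    exists_plan_and_pair hc hK₁ hK₂ hμ hν
  have hne₁ : K₁.Nonempty := by
    by_contra! h0
    rw [h0, compl_empty, measure_univ] at hμ
    exact one_ne_zero hμ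
  have hne₂ : K₂.Nonempty := by
    by_contra! h0
    rw [h0, compl_empty, measure_univ] at hν
    exact one_ne_zero hν
  obtain ⟨x₀, hx₀⟩ := hne₁
  obtain ⟨f, hf⟩ := c₂Transform_restrictBot_eq_coe hc hK₂ hne₂ hhC
  have hf' : c₂Transform c (restrictBot K₂ h) = fun x => (f x : EReal) := funext hf
  have hfle : ∀ (a : ℝ) (x : M), a ≤ f x ↔ ∀ y ∈ K₂, a + h y ≤ c x y := fun a x => by
    rw [← le_c₂Transform_restrictBot_iff, hf, EReal.coe_le_coe_iff]
  have hflip := isLocallyLipschitzOn_of_forall_le_iff hlip hK₂ hfle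
  have hfc : Continuous f := hflip.continuous
  set F : M → EReal := fun x => (f x : EReal) with hF
  set G : M → EReal := c₁Transform c F with hG
  have hGle : ∀ x y, G y ≤ ((c x y - f x : ℝ) : EReal) := fun x y => iInf_le _ x
  have hGtop : ∀ y, G y ≠ ⊤ := fun y => ne_top_of_le_ne_top (EReal.coe_ne_top _) (hGle x₀ y)
  have hGh : ∀ y ∈ K₂, (h y : EReal) ≤ G y := fun y hy => by
    have h3 : restrictBot K₂ h ≤ c₁Transform c (c₂Transform c (restrictBot K₂ h)) :=
      le_c₁Transform_iff.2 le_rfl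
    have h4 := h3 y
    rw [hf'] at h4
    simpa only [restrictBot, if_pos hy] using h4
  have hGreal : ∀ y ∈ K₂, G y ≠ ⊥ ∧ h y ≤ (G y).toReal ∧ ∀ x, (G y).toReal ≤ c x y - f x :=
    fun y hy => by
      have h3 : G y ≠ ⊥ := ne_bot_of_le_ne_bot (EReal.coe_ne_bot _) (hGh y hy)
      refine ⟨h3, ?_, fun x => ?_⟩
      · simpa using EReal.toReal_le_toReal (hGh y hy) (EReal.coe_ne_bot _) (hGtop y)
      · have h4 := EReal.toReal_le_toReal (hGle x y) h3 (EReal.coe_ne_top _)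
        rwa [EReal.toReal_coe] at h4
  have hGm : Measurable G := by
    -- An uncountable infimum need not be measurable, but an infimum of continuous functions is
    -- upper semicontinuous.
    have : UpperSemicontinuous G := by
      refine upperSemicontinuous_iInf fun x => Continuous.upperSemicontinuous ?_
      have h3 : Continuous fun y => c x y - f x :=
        (hc.comp (continuous_const.prodMk continuous_id)).sub continuous_const
      exact continuous_coe_real_ereal.comp h3
    exact this.measurable
  have hfint : Integrable f μ := by
    obtain ⟨B, hB⟩ := hK₁.exists_bound_of_continuousOn hfc.continuousOn
    exact integrable_of_abs_le_on hμ hfc.measurable hB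
  have hGint : Integrable (fun y => (G y).toReal) ν := by
    have h3 : ContinuousOn (fun y => c x₀ y - f x₀) K₂ :=
      ((hc.comp (continuous_const.prodMk continuous_id)).sub continuous_const).continuousOn
    obtain ⟨B, hB⟩ := hK₂.exists_bound_of_continuousOn h3
    -- On `K₂`, `G` lies between `h ≥ -C` and `c(x₀, ·) - f(x₀) ≤ B`.
    refine integrable_of_abs_le_on hν hGm.ereal_toReal (C := max B C) fun y hy => ?_
    obtain ⟨-, h4, h5⟩ := hGreal y hy
    have h6 := le_of_abs_le (hB y hy)
    have h7 := neg_le_of_abs_le (hhC y hy)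
    have h8 := h5 x₀
    have h9 := le_max_left B C
    have h10 := le_max_right B C
    exact abs_le.2 ⟨by linarith, by linarith⟩
  have hν' : ∀ᵐ y ∂ν, y ∈ K₂ := by rwa [ae_iff]
  have hμ' : ∀ᵐ x ∂μ, x ∈ K₁ := by rwa [ae_iff]
  have hpair : IsDualPair c μ ν F G := by
    refine ⟨⟨fun x => EReal.coe_ne_top _, Filter.Eventually.of_forall fun x => EReal.coe_ne_bot _,
      by simpa [hF] using hfint⟩, ⟨hGtop, hν'.mono fun y hy => (hGreal y hy).1, hGint⟩, ?_⟩
    exact fun x y => add_c₁Transform_le (f := F) (EReal.coe_ne_bot _) (EReal.coe_ne_top _) y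
  have hγ₁ : ∀ᵐ z ∂γ, z.1 ∈ K₁ := ae_of_ae_map measurable_fst.aemeasurable (by rwa [h1])
  have hγ₂ : ∀ᵐ z ∂γ, z.2 ∈ K₂ := ae_of_ae_map measurable_snd.aemeasurable (by rwa [h2])
  have hγK : ∀ᵐ z ∂γ, z ∈ K₁ ×ˢ K₂ := by
    filter_upwards [hγ₁, hγ₂] with z hz1 hz2 using ⟨hz1, hz2⟩
  have hfin : IsFiniteMeasure γ := by
    refine ⟨?_⟩
    have h3 : γ.map Prod.fst univ = 1 := by rw [h1]; exact measure_univ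
    rw [Measure.map_apply measurable_fst MeasurableSet.univ, preimage_univ] at h3
    rw [h3]
    exact ENNReal.one_lt_top
  have hcγ : Integrable (fun z : M × M => c z.1 z.2) γ := by
    obtain ⟨B, hB⟩ := (hK₁.prod hK₂).exists_bound_of_continuousOn hc.continuousOn
    exact Integrable.of_bound hc.measurable.aestronglyMeasurable B (hγK.mono hB)
  have hval : ∫ z, c z.1 z.2 ∂γ ≤ dualValue μ ν F G := by
    obtain ⟨h3, h4⟩ := hpair.integrable_and_dualValue_eq h1 h2
    rw [h4]
    refine integral_mono_ae hcγ h3 ?_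
    filter_upwards [hγK, heq] with z hz hz'
    have h5 : g z.1 ≤ f z.1 := (hfle _ _).2 fun y hy => hle _ hz.1 y hy
    have h6 := (hGreal z.2 hz.2).2.1
    simp only [hF, EReal.toReal_coe]
    linarith
  refine ⟨F, ⟨?_, hpair, fun g' h' hgh' => ?_⟩, ⟨fun x _ => ⟨EReal.coe_ne_bot _,
    EReal.coe_ne_top _⟩, by simpa [hF] using hflip⟩, γ, h1, h2, hγK, hcγ, hval⟩
  · rw [← hf']
    exact c₂Transform_c₁Transform_c₂Transform _
  · exact (hgh'.dualValue_le h1 h2 hcγ).trans hval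

end Potential

end ControlTransport

end

theorem theorem4p1 {n m : ℕ} {M : Type*} [TopologicalSpace M] [T2Space M]
    [SecondCountableTopology M] [ChartedSpace (E n) M] [IsManifold (𝓡 n) ∞ M]
    [MeasurableSpace M] [BorelSpace M]
    (U : Set (E m)) (F : (x : M) → E m → TangentSpace (𝓡 n) x) (L : M → E m → ℝ)
    (hF : IsControlSystem U F) (hL : IsSmoothLagrangian n U L)
    (μ ν : Measure M) [IsProbabilityMeasure μ] [IsProbabilityMeasure ν]
    (hμc : IsCompactlySupported μ) (hνc : IsCompactlySupported ν)
    (hμ : IsLebesgueAC n μ) (hν : IsLebesgueAC n ν)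
    (hcomplete : IsCompleteCost U F L)
    (hcont : Continuous fun p : M × M => realCost U F L p.1 p.2)
    (hbdd : ∃ b : ℝ, ∀ x y : M, (b : EReal) ≤ cost U F L x y)
    (hlip : IsLocallyLipschitzInFst n (realCost U F L))
    (hmax : IsWellDefinedMaxHamiltonian U F L)
    (hH : ContMDiff (cotangentModel n) 𝓘(ℝ, ℝ) 2 (maxHamiltonian U F L))
    (hflow : IsCompleteHamiltonian (maxHamiltonian U F L)) :
    (∃ f : M → EReal, IsKantorovichPotential (realCost U F L) μ ν f ∧
      IsFiniteLocallyLipschitzOn n f univ) ∧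
    ∀ f : M → EReal, IsKantorovichPotential (realCost U F L) μ ν f →
      ∀ S : Set M, IsOpen S → μ Sᶜ = 0 → IsFiniteLocallyLipschitzOn n f S →
        (∀ᵐ x ∂μ, MDifferentiableAt (𝓡 n) 𝓘(ℝ, ℝ) (fun x => (f x).toReal) x) ∧
        ∃ T : M → M, IsOptimalMap (realCost U F L) μ ν T ∧
          (∀ᵐ x ∂μ, T x = displacement (maxHamiltonian U F L) hflow
            (fun x => (f x).toReal) x 1) ∧
          ∀ T' : M → M, IsOptimalMap (realCost U F L) μ ν T' → T' =ᵐ[μ] T := by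
  obtain ⟨K₁, hK₁, hμK⟩ := hμc
  obtain ⟨K₂, hK₂, hνK⟩ := hνc
  obtain ⟨f₀, hf₀, hf₀lip, γ, hγ₁, hγ₂, hγK, hcγ, hval⟩ :=
    exists_isKantorovichPotential hcont hlip hK₁ hK₂ hμK hνK
  refine ⟨⟨f₀, hf₀, hf₀lip⟩, fun f hf S hS hμS hfS => ?_⟩
  have hSae : ∀ᵐ x ∂μ, x ∈ S := by rwa [ae_iff]
  have hdiff : ∀ᵐ x ∂μ, MDifferentiableAt (𝓡 n) 𝓘(ℝ, ℝ) (fun x => (f x).toReal) x := by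
    filter_upwards [hμ.ae_mdifferentiableAt hS hfS.2, hSae] with x hx hxS using hx hxS
  have : Nonempty M := nonempty_of_isProbabilityMeasure μ
  -- By maximality the dual value of `f` is at least that of `f₀`, hence at least the cost of `γ`;
  -- so the plan built from `f₀` serves every potential `f`.
  obtain ⟨T, hT, hTD, hTu⟩ := exists_isOptimalMap hcont hγ₁ hγ₂ (hK₁.prod hK₂) hγK hcγ hf.dualPair
    (hval.trans (hf.maximal _ _ hf₀.dualPair))
    (D := fun x => displacement (maxHamiltonian U F L) hflow (fun x => (f x).toReal) x 1) (by
      filter_upwards [hdiff, hSae] with x hx hxS y hy heq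
      -- The touching constant is `κ = f^{c₁}(y)`. The inequality in real terms is needed only near
      -- `x`, where the open set `S` keeps `f` finite.
      refine displacement_eq_of_touching hF hL hcomplete hbdd hmax hH hflow hx ?_ heq
      filter_upwards [hS.mem_nhds hxS] with z hz
      exact add_le_coe_toReal (hfS.1 z hz).2 (hfS.1 z hz).1 (hf.dualPair.2.1.1 y) hy
        (hf.dualPair.2.2 z y))
  exact ⟨hdiff, T, hT, hTD, hTu⟩
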